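/- **Model (perceptive ring network).** $n$ agents occupy distinct points of a circle of circumference $1$. They have distinct identifiers from $\{1,\dots,N\}$, and each agent has its own sense of direction (which of the two directions on the circle it calls clockwise, or "right"); different agents may disagree. Time is divided into synchronous rounds of length $1$. At the beginning of a round each agent chooses to start moving right or left (in its own sense; idling is not allowed); all agents move at unit speed, and two agents that collide instantly reverse their directions. At the end of a round an agent learns only (i) the distance, in its own clockwise direction, from its position at the beginning of the round to its position at the end of the round, and (ii) the distance between its position at the beginning of the round and the place of its first collision in the round (or that it had no collision). A deterministic algorithm is the same for all agents: the choices and the output of an agent are functions of $N$, the parity of $n$, the agent's own identifier, and its own observations in the rounds so far; $n$ itself is not given to the agents. An algorithm solves *location discovery* (position discovery) in $t$ rounds on a network if all agents finish after exactly $t$ rounds and then every agent outputs the set of initial positions of all other agents, each position being given as the distance from the agent's own initial position in the agent's own clockwise direction. **Theorem.** There are a deterministic algorithm and a constant $C$ such that, for all $N\ge n>4$ and every network of $n$ agents with identifiers from $\{1,\dots,N\}$ (arbitrary distinct initial positions, arbitrary distinct identifiers, arbitrary senses of direction), the algorithm solves location discovery in the perceptive model in at most $$\frac n2 + C\,\sqrt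 n\,\log N$$ rounds. That is, location discovery can be solved in the perceptive model in $n/2+O(\sqrt n\log N)$ rounds. -/

import Mathlib

noncomputable section

namespace RingNetwork

/-! ### The circle and its motion

The circle of circumference one is `UnitAddCircle`, oriented so that adding a small positive real
moves a point clockwise.  This objective orientation is never disclosed to the agents. -/

/-- The length, in `[0, 1)`, of the clockwise arc from `x` to `y`. -/
def cwArc (x y : UnitAddCircle) : ℝ := (AddCircle.equivIco (1 : ℝ) 0 (y - x) : ℝ)

/-- The time in `(0, 1/2]` after which a point moving clockwise from `x` and a point moving
anticlockwise from `y`, both at unit speed, next meet.  Two agents that are at the same point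
because they have just bounced off each other meet again after time `1/2`, not after time `0`. -/
def meetTime (x y : UnitAddCircle) : ℝ := (AddCircle.equivIoc (1 : ℝ) 0 (y - x) : ℝ) / 2

/-- A snapshot of the `n` agents during a round. -/
structure Snapshot (n : ℕ) where
  /-- the time elapsed since the beginning of the round -/
  clock : ℝ
  /-- the current positions -/
  pos : Fin n → UnitAddCircle
  /-- whether an agent is currently moving clockwise (`true`) or anticlockwise (`false`) -/
  cw : Fin n → Bool
  /-- the place of the first collision of an agent in this round, if there has been one -/
  first : Fin n → Option UnitAddCircle

namespace Snapshot

variable {n : ℕ}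

/-- The agents `i` and `j` move in opposite directions and, moving on freely, next meet after
time `τ`. -/
def MeetAfter (s : Snapshot n) (i j : Fin n) (τ : ℝ) : Prop :=
  (s.cw i = true ∧ s.cw j = false ∧ meetTime (s.pos i) (s.pos j) = τ) ∨
  (s.cw j = true ∧ s.cw i = false ∧ meetTime (s.pos j) (s.pos i) = τ)

/-- The time until the next event: the next collision of two agents or the end of the round
(at clock `1`), whichever comes first. -/
def timeToNextEvent (s : Snapshot n) : ℝ :=
  sInf (insert (1 - s.clock) {τ | ∃ i j, s.MeetAfter i j τ})

/-- Agent `i` collides with another agent at the next event. -/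
def Collides (s : Snapshot n) (i : Fin n) : Prop := ∃ j, s.MeetAfter i j s.timeToNextEvent

open Classical in
/-- Let all agents move at unit speed until the next event; the agents that collide then reverse
their directions, and those for which this is the first collision record its place. -/
def step (s : Snapshot n) : Snapshot n :=
  let newPos : Fin n → UnitAddCircle := fun i =>
    s.pos i + ((if s.cw i then s.timeToNextEvent else -s.timeToNextEvent : ℝ) : UnitAddCircle)
  { clock := s.clock + s.timeToNextEvent
    pos := newPos
    cw := fun i => if s.Collides i then !(s.cw i) else s.cw i
    first := fun i => if s.Collides i then (s.first i).or (some (newPos i)) else s.first i }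

/-- The snapshot at the beginning of a round with starting positions `p` and starting
directions `d` (`true` for clockwise). -/
def start (p : Fin n → UnitAddCircle) (d : Fin n → Bool) : Snapshot n :=
  { clock := 0, pos := p, cw := d, first := fun _ => none }

/-- The snapshot at the end of a round: events are processed until one unit of time is over.
(Only finitely many collisions happen in a round that starts at distinct positions.) -/
def finish (p : Fin n → UnitAddCircle) (d : Fin n → Bool) : Snapshot n :=
  step^[sInf {k : ℕ | (step^[k] (start p d)).clock = 1}] (start p d)

end Snapshot

/-! ### Networks of agents and their algorithms -/

/-- `n` agents at distinct positions of the circle, with distinct identifiers from `{1, …, N}`,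
each with its own sense of direction. -/
structure Network (N n : ℕ) where
  /-- the initial positions -/
  pos : Fin n → UnitAddCircle
  pos_injective : Function.Injective pos
  /-- the identifiers -/
  ident : Fin n → ℕ
  ident_injective : Function.Injective ident
  ident_mem : ∀ i, ident i ∈ Finset.Icc 1 N
  /-- whether the agent's own clockwise direction is the objective one -/
  sense : Fin n → Bool

/-- The directions in which an agent of the perceptive model may start a round, according to its
own sense of direction; `right` is its own clockwise direction. -/
inductive Direction
  | right
  | left

/-- What an agent learns in a round of the perceptive model. -/
structure Observation where
  /-- the distance, in the agent's own clockwise direction, from its position at the beginning of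
  the round to its position at the end of the round -/
  dist : ℝ
  /-- the distance between its position at the beginning of the round and the place of its first
  collision in the round; `none` if it did not collide in the round -/
  coll : Option ℝ

/-- A deterministic algorithm, the same for all agents.  Everything that an agent does is a
function of `N`, of the parity of the number of agents (`true` for even), of the agent's own
identifier and of its observations in the rounds so far (in chronological order). -/
structure Algorithm where
  /-- the direction in which the agent starts the next round -/
  move : (N : ℕ) → (parity : Bool) → (ident : ℕ) → List Observation → Direction
  /-- `none` as long as the agent has not finished; when it finishes, it announces a set of
  positions, each given by its distance from the agent's own initial position in the agent's own
  clockwise direction -/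
  output : (N : ℕ) → (parity : Bool) → (ident : ℕ) → List Observation → Option (Set ℝ)

/-- The distance from `x` to `y` in the clockwise direction of an agent with the given sense of
direction. -/
def rightDist (sense : Bool) (x y : UnitAddCircle) : ℝ :=
  if sense then cwArc x y else cwArc y x

/-- Whether an agent with the given sense of direction that starts in direction `d` starts
clockwise in the objective sense. -/
def startsCw (sense : Bool) : Direction → Bool
  | .right => sense
  | .left => !sense

namespace Algorithm

variable {N n : ℕ}

/-- The agents' positions and their lists of observations after `t` rounds. -/
def run (A : Algorithm) (net : Network N n) :
    ℕ → (Fin n → UnitAddCircle) × (Fin n → List Observation)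
  | 0 => (net.pos, fun _ => [])
  | t + 1 =>
    let p := (A.run net t).1
    let h := (A.run net t).2
    let e := Snapshot.finish p fun i =>
      startsCw (net.sense i) (A.move N (decide (Even n)) (net.ident i) (h i))
    (e.pos, fun i => h i ++
      [{ dist := rightDist (net.sense i) (p i) (e.pos i)
         coll := (e.first i).map fun c => Dist.dist (p i) c }])

/-- The output of agent `i` after `t` rounds. -/
def outputAt (A : Algorithm) (net : Network N n) (t : ℕ) (i : Fin n) : Option (Set ℝ) :=
  A.output N (decide (Even n)) (net.ident i) ((A.run net t).2 i)

end Algorithm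

/-- The initial positions of all agents other than `i`, relative to the initial position and the
sense of direction of `i`. -/
def Network.othersFrom {N n : ℕ} (net : Network N n) (i : Fin n) : Set ℝ :=
  {x | ∃ j, j ≠ i ∧ x = rightDist (net.sense i) (net.pos i) (net.pos j)}

/-- The algorithm solves location discovery on the network in exactly `t` rounds: all agents finish
after round `t`, and not earlier, and each announces the initial positions of all other agents
with respect to its own initial position. -/
def Algorithm.SolvesLocationDiscovery {N n : ℕ} (A : Algorithm) (net : Network N n) (t : ℕ) :
    Prop :=
  ∀ i, (∀ s < t, A.outputAt net s i = none) ∧ A.outputAt net t i = some (net.othersFrom i)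

end RingNetwork

end

/-! Colliding agents may be regarded as exchanging tokens that move on undisturbed. After one unit
of time every token is back where it started, so a round only permutes the occupied places. The
cyclic order of the agents persists, hence the permutation is a rotation; the sum of the lifted
coordinates shows that it goes by the number of agents starting clockwise minus the number starting
anticlockwise (`Snapshot.finish_at`). The first collision of an agent lies halfway to the nearest
agent ahead that starts towards it (`obs_coll_fwd`, `obs_coll_bwd`). Reversing all directions undoes
a round, so most measurements can be made without a net motion.

The main term n/2 comes from a single sweep (`runs_sweep`, `runs_locate`). In it the first B places
produce the desired rotation, and the remaining places are paired so that partners start towards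
each other; an agent on a paired place learns two places in one round. The rotation has the parity
of n. For even n, B = 2 and a rotation by 2 in each round suffice. For odd n, B = 2k - 1 and the
rotations follow a zigzag whose blocks of 2k rounds serve 4k - 2 consecutive places
(`exists_sweepShift`); for n ≤ 32k² this costs only O(k) extra rounds (`sweepTime_le`).

The sweep presupposes a common orientation, the value of n, the number of each agent's own place,
and the first 2k positions. These are prepared in O(k log N) rounds. Whether a collision occurs at
half the distance to a neighbour is one bit sent by that neighbour (`runs_exchange`). Flooding
identifiers over distance 2k leaves sparse local maxima; since the displacement observed in a round
is common knowledge, a family of test sets built from power sums modulo a prime, followed by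
bisection, singles out one agent (`exists_powerFamily`, `runs_elect`). The leader's orientation
becomes known through a net rotation by two places (`runs_orient`). The positions of the first 2k
places are learnt one by one (`runs_window`), and rotations by 2k places reveal n and every agent's
place (`runs_walk`).

The right k, of order √n, is not known in advance. Stages with k = 1, 2, 4, … are tried; a failed
stage is cheap, restores the positions and certifies n > 32k². The preparation costs form a
geometric sum (`runs_stages`). -/

noncomputable section

namespace RingNetwork

/-! ### Periodic enumerations of the places -/

/-- The sign `±1` of a Boolean. -/
def sgn (b : Bool) : ℝ := if b then 1 else -1

@[simp] lemma sgn_true : sgn true = 1 := rfl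
@[simp] lemma sgn_false : sgn false = -1 := rfl

/-- An enumeration of the places of `n` agents along the circle by the integers, in the
clockwise direction if `g = true` and in the anticlockwise one otherwise, together with a lift of
the places to the real line. -/
structure Frame (n : ℕ) where
  g : Bool
  x : ℤ → ℝ
  ag : ℤ → Fin n
  mono : StrictMono x
  x_add : ∀ k, x (k + n) = x k + 1
  ag_eq_iff : ∀ k l, ag k = ag l ↔ (n : ℤ) ∣ l - k
  ag_surj : Function.Surjective ag

namespace Frame

variable {n : ℕ} (f : Frame n)

lemma ag_add (k : ℤ) : f.ag (k + n) = f.ag k := by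
  rw [eq_comm, f.ag_eq_iff]; simp

lemma x_add_mul (k m : ℤ) : f.x (k + m * n) = f.x k + m := by
  induction m using Int.induction_on with
  | zero => simp
  | succ i ih =>
    have := f.x_add (k + i * n)
    rw [show k + (i + 1 : ℤ) * n = k + i * n + n by ring, this, ih]; push_cast; ring
  | pred i ih =>
    have := f.x_add (k + (-i - 1 : ℤ) * n)
    rw [show k + (-i - 1 : ℤ) * n + n = k + -i * n by ring, ih] at this
    push_cast at this ⊢; linarith

lemma coe_x_eq_iff (k l : ℤ) : (f.x k : UnitAddCircle) = f.x l ↔ (n : ℤ) ∣ l - k := by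
  rw [eq_comm, ← sub_eq_zero, ← AddCircle.coe_sub, AddCircle.coe_eq_zero_iff]
  constructor
  · rintro ⟨m, hm⟩
    have h : f.x l = f.x (k + m * n) := by
      rw [f.x_add_mul]; simp at hm; linarith
    have := f.mono.injective h
    exact ⟨m, by rw [this]; ring⟩
  · rintro ⟨m, hm⟩
    refine ⟨m, ?_⟩
    rw [show l = k + m * n by linarith, f.x_add_mul]; simp

lemma sum_ag {M : Type*} [AddCommMonoid M] (F : Fin n → M) :
    ∑ k ∈ Finset.range n, F (f.ag k) = ∑ i, F i := by
  rw [← Fin.sum_univ_eq_sum_range (fun k => F (f.ag k))]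
  refine Fintype.sum_bijective (fun i : Fin n => f.ag (i : ℕ)) ?_ _ _ (fun _ => rfl)
  rw [Fintype.bijective_iff_injective_and_card]
  refine ⟨fun i j h => ?_, rfl⟩
  have h1 := (f.ag_eq_iff _ _).1 h
  have hi := i.2
  have hj := j.2
  have h2 : ((j : ℕ) : ℤ) - (i : ℕ) = 0 :=
    Int.eq_zero_of_abs_lt_dvd h1 (by rw [abs_lt]; constructor <;> omega)
  ext; omega

/-- The positions `p` are those of the frame after a rotation by `R` places. -/
def At (R : ℤ) (p : Fin n → UnitAddCircle) : Prop :=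
  ∀ k, p (f.ag k) = ((sgn f.g * f.x (k + R) : ℝ) : UnitAddCircle)

/-- The frame whose place `k` is the place `k + m` of the given one. -/
def shift (m : ℤ) : Frame n where
  g := f.g
  x k := f.x (k + m)
  ag k := f.ag (k + m)
  mono _ _ h := f.mono (by linarith)
  x_add k := by rw [show k + n + m = k + m + n by ring, f.x_add]
  ag_eq_iff k l := by rw [f.ag_eq_iff]; simp
  ag_surj i := by obtain ⟨k, rfl⟩ := f.ag_surj i; exact ⟨k - m, by simp⟩

/-- The frame of the rotated agents. -/
def rotate (R : ℤ) : Frame n where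
  g := f.g
  x k := f.x (k + R)
  ag := f.ag
  mono _ _ h := f.mono (by linarith)
  x_add k := by rw [show k + n + R = k + R + n by ring, f.x_add]
  ag_eq_iff := f.ag_eq_iff
  ag_surj := f.ag_surj

/-- The frame with the opposite orientation. -/
def mirror : Frame n where
  g := !f.g
  x k := -f.x (-k)
  ag k := f.ag (-k)
  mono _ _ h := neg_lt_neg (f.mono (neg_lt_neg h))
  x_add k := by
    have := f.x_add (-k - n)
    rw [show -k - (n : ℤ) + n = -k by ring] at this
    rw [show -(k + n : ℤ) = -k - n by ring]; linarith
  ag_eq_iff k l := by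
    rw [f.ag_eq_iff, show -l - -k = -(l - k) by ring, Int.dvd_neg]
  ag_surj i := by obtain ⟨k, rfl⟩ := f.ag_surj i; exact ⟨-k, by simp⟩

variable {f}

lemma At.shift {R : ℤ} {p : Fin n → UnitAddCircle} (h : f.At R p) (m : ℤ) :
    (f.shift m).At R p := fun k => by
  show p (f.ag (k + m)) = ((sgn f.g * f.x (k + R + m) : ℝ) : UnitAddCircle)
  rw [h, show k + m + R = k + R + m by ring]

lemma At.rotate {R : ℤ} {p : Fin n → UnitAddCircle} (h : f.At R p) :
    (f.rotate R).At 0 p := fun k => by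
  show p (f.ag k) = ((sgn f.g * f.x (k + 0 + R) : ℝ) : UnitAddCircle)
  rw [h, add_zero]

/-- Mirroring exchanges the two directions; through it the statements about agents that start
backward follow from those about agents that start forward. -/
lemma At.mirror {R : ℤ} {p : Fin n → UnitAddCircle} (h : f.At R p) :
    f.mirror.At (-R) p := fun k => by
  show p (f.ag (-k)) = ((sgn (!f.g) * -f.x (-(k + -R)) : ℝ) : UnitAddCircle)
  rw [h, show -(k + -R) = -k + R by ring]
  cases f.g <;> simp

lemma at_rotate_iff {R S : ℤ} {p : Fin n → UnitAddCircle} :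
    (f.rotate R).At S p ↔ f.At (R + S) p := by
  refine forall_congr' fun k => ?_
  show p (f.ag k) = ((sgn f.g * f.x (k + S + R) : ℝ) : UnitAddCircle) ↔ _
  rw [show k + S + R = k + (R + S) by ring]

lemma At.unique {R : ℤ} {p q : Fin n → UnitAddCircle} (h : f.At R p) (h' : f.At R q) : p = q := by
  ext i; obtain ⟨k, rfl⟩ := f.ag_surj i; rw [h, h']

lemma sum_periodic_shift {M : Type*} [AddCommMonoid M] [IsRightCancelAdd M] (F : ℤ → M)
    (hF : ∀ k, F (k + n) = F k) :
    ∑ k ∈ Finset.range n, F (k + 1) = ∑ k ∈ Finset.range n, F k := by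
  have h1 := Finset.sum_range_succ (fun k : ℕ => F k) n
  have h2 := Finset.sum_range_succ' (fun k : ℕ => F k) n
  have h3 := hF 0
  simp only [zero_add] at h3
  rw [h1] at h2
  push_cast at h2
  rw [h3] at h2
  exact (add_right_cancel h2).symm

end Frame

/-! ### Meeting times in lifted coordinates -/

lemma meetTime_pos (x y : UnitAddCircle) : 0 < meetTime x y :=
  half_pos (AddCircle.equivIoc (1 : ℝ) 0 (y - x)).2.1

lemma meetTime_coe {a b : ℝ} (h : a < b) (h' : b ≤ a + 1) :
    meetTime (a : UnitAddCircle) b = (b - a) / 2 := by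
  unfold meetTime
  rw [← AddCircle.coe_sub]
  congr 1
  exact (toIocMod_eq_iff one_pos).2 ⟨⟨by linarith, by linarith⟩, 0, by simp⟩

lemma meetTime_coe_le {a b : ℝ} (h : a < b) : meetTime (a : UnitAddCircle) b ≤ (b - a) / 2 := by
  rcases le_or_gt b (a + 1) with h' | h'
  · rw [meetTime_coe h h']
  · have := (AddCircle.equivIoc (1 : ℝ) 0 ((b : UnitAddCircle) - a)).2.2
    unfold meetTime; linarith

lemma exists_meetTime_eq (a b : ℝ) :
    ∃ m : ℤ, 2 * meetTime (a : UnitAddCircle) b = b + m - a := by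
  obtain ⟨-, z, hz⟩ := (toIocMod_eq_iff (one_pos (α := ℝ))
    (b := b - a) (a := 0) (c := toIocMod one_pos 0 (b - a))).1 rfl
  refine ⟨-z, ?_⟩
  unfold meetTime
  rw [← AddCircle.coe_sub]
  have : (AddCircle.equivIoc (1 : ℝ) 0 ((b - a : ℝ) : UnitAddCircle) : ℝ)
    = toIocMod one_pos 0 (b - a) := rfl
  rw [this]; push_cast; simp at hz; linarith

/-! ### The motion between two events and its invariants -/

namespace Snapshot

variable {n : ℕ}

lemma finite_meet (s : Snapshot n) :
    (insert (1 - s.clock) {τ | ∃ i j, s.MeetAfter i j τ}).Finite := by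
  refine Set.Finite.insert _ (Set.Finite.subset
    (Set.finite_range fun q : Fin n × Fin n => meetTime (s.pos q.1) (s.pos q.2)) ?_)
  rintro τ ⟨i, j, ⟨-, -, h⟩ | ⟨-, -, h⟩⟩
  · exact ⟨(i, j), h⟩
  · exact ⟨(j, i), h⟩

lemma timeToNextEvent_le (s : Snapshot n) : s.timeToNextEvent ≤ 1 - s.clock :=
  csInf_le s.finite_meet.bddBelow (Set.mem_insert _ _)

lemma timeToNextEvent_le_meet (s : Snapshot n) {i j : Fin n} {τ : ℝ} (h : s.MeetAfter i j τ) :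
    s.timeToNextEvent ≤ τ :=
  csInf_le s.finite_meet.bddBelow (Set.mem_insert_of_mem _ ⟨i, j, h⟩)

lemma timeToNextEvent_mem (s : Snapshot n) :
    s.timeToNextEvent = 1 - s.clock ∨ ∃ i j, s.MeetAfter i j s.timeToNextEvent :=
  (Set.insert_nonempty _ _).csInf_mem s.finite_meet

lemma timeToNextEvent_pos (s : Snapshot n) (h : s.clock < 1) : 0 < s.timeToNextEvent := by
  rcases s.timeToNextEvent_mem with h' | ⟨i, j, ⟨-, -, h'⟩ | ⟨-, -, h'⟩⟩
  · linarith
  · rw [← h']; exact meetTime_pos _ _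
  · rw [← h']; exact meetTime_pos _ _

variable (f : Frame n) (d : Fin n → Bool)

/-- `X` lifts the positions of the snapshot `s` of a round that started at the places of `f` in the
directions `d`, and the freely moving tokens are still where they have to be. -/
structure Lift (s : Snapshot n) (X : ℤ → ℝ) : Prop where
  pos : ∀ k, s.pos (f.ag k) = (X k : UnitAddCircle)
  per : ∀ k, X (k + n) = X k + 1
  le_succ : ∀ k, X k ≤ X (k + 1)
  tie : ∀ k, X k = X (k + 1) → s.cw (f.ag k) = false ∧ s.cw (f.ag (k + 1)) = true
  plus : ∀ k, s.cw (f.ag k) = true → ∃ a, d (f.ag a) = true ∧ X k = f.x a + s.clock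
  plus' : ∀ a, d (f.ag a) = true → ∃ k, s.cw (f.ag k) = true ∧ X k = f.x a + s.clock
  minus : ∀ k, s.cw (f.ag k) = false → ∃ a, d (f.ag a) = false ∧ X k = f.x a - s.clock
  minus' : ∀ a, d (f.ag a) = false → ∃ k, s.cw (f.ag k) = false ∧ X k = f.x a - s.clock
  sum_X : ∑ k ∈ Finset.range n, X k = ∑ k ∈ Finset.range n, f.x k + s.clock * ∑ i, sgn (d i)
  sum_cw : ∑ i, sgn (s.cw i) = ∑ i, sgn (d i)

variable {f d} {s : Snapshot n} {X : ℤ → ℝ}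

namespace Lift

lemma per_mul (h : Lift f d s X) (k m : ℤ) : X (k + m * n) = X k + m := by
  induction m using Int.induction_on with
  | zero => simp
  | succ i ih =>
    have := h.per (k + i * n)
    rw [show k + (i + 1 : ℤ) * n = k + i * n + n by ring, this, ih]; push_cast; ring
  | pred i ih =>
    have := h.per (k + (-i - 1 : ℤ) * n)
    rw [show k + (-i - 1 : ℤ) * n + n = k + -i * n by ring, ih] at this
    push_cast at this ⊢; linarith

lemma mono (h : Lift f d s X) : Monotone X := monotone_int_of_le_succ h.le_succ

lemma event_le (h : Lift f d s X) {k l : ℤ} (hk : s.cw (f.ag k) = true)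
    (hl : s.cw (f.ag l) = false) (hkl : X k < X l) : s.timeToNextEvent ≤ (X l - X k) / 2 := by
  refine le_trans ?_ (meetTime_coe_le hkl)
  refine s.timeToNextEvent_le_meet (i := f.ag k) (j := f.ag l) (Or.inl ⟨hk, hl, ?_⟩)
  rw [h.pos, h.pos]

lemma exists_lift_right (h : Lift f d s X) (k : ℤ) (j : Fin n) :
    ∃ l, f.ag l = j ∧ X l = X k + 2 * meetTime (s.pos (f.ag k)) (s.pos j) := by
  obtain ⟨l, rfl⟩ := f.ag_surj j
  rw [h.pos, h.pos]
  obtain ⟨m, hm⟩ := exists_meetTime_eq (X k) (X l)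
  refine ⟨l + m * n, ?_, ?_⟩
  · rw [eq_comm, f.ag_eq_iff]; simp
  · rw [h.per_mul]; linarith

lemma exists_lift_left (h : Lift f d s X) (k : ℤ) (j : Fin n) :
    ∃ l, f.ag l = j ∧ X k = X l + 2 * meetTime (s.pos j) (s.pos (f.ag k)) := by
  obtain ⟨l, rfl⟩ := f.ag_surj j
  rw [h.pos, h.pos]
  obtain ⟨m, hm⟩ := exists_meetTime_eq (X l) (X k)
  refine ⟨l - m * n, ?_, ?_⟩
  · rw [eq_comm, f.ag_eq_iff]; simp
  · have := h.per_mul l (-m)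
    rw [show l - m * n = l + -m * n by ring, this]; push_cast; linarith

/-- An agent strictly between the two would meet one of them earlier. What remains are coincident
agents, and by `tie` these have just bounced apart, at most two at a point, with directions that do
not fit. -/
lemma adjacent (h : Lift f d s X) (hτ : 0 < s.timeToNextEvent) {k l : ℤ}
    (hk : s.cw (f.ag k) = true) (hl : s.cw (f.ag l) = false)
    (hkl : X l = X k + 2 * s.timeToNextEvent) : l = k + 1 := by
  have hlt : k < l := by
    by_contra hc
    have := h.mono (not_lt.1 hc)
    linarith
  by_contra hne
  have hlt' : k + 1 < l := by omega
  have h1 := h.le_succ k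
  have h2 := h.mono hlt'.le
  cases hw : s.cw (f.ag (k + 1))
  · rcases h1.eq_or_lt with he | hlt1
    · simp [(h.tie k he).2] at hw
    have h3 := h.event_le hk hw hlt1
    have h4 : X (k + 1) = X l := by linarith
    have h5 : X (k + 1) = X (k + 1 + 1) :=
      le_antisymm (h.le_succ _) (by rw [h4]; exact h.mono (by omega))
    have h6 := (h.tie _ h5).2
    rcases (show k + 1 + 1 ≤ l by omega).eq_or_lt with he | hlt2
    · rw [← he, h6] at hl; simp at hl
    have h7 : X (k + 1 + 1) = X (k + 1 + 1 + 1) :=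
      le_antisymm (h.le_succ _) (by rw [← h5, h4]; exact h.mono (by omega))
    have := (h.tie _ h7).1
    simp [h6] at this
  · rcases h2.eq_or_lt with he | hlt1
    · have h5 : X (k + 1) = X (k + 1 + 1) :=
        le_antisymm (h.le_succ _) (by rw [he]; exact h.mono (by omega))
      have := (h.tie _ h5).1
      simp [hw] at this
    have h3 := h.event_le hw hl hlt1
    have h4 : X k = X (k + 1) := by linarith
    have := (h.tie _ h4).1
    simp [hk] at this

/-- The agents at `k` and `k + 1` collide at the next event. -/
def Coll (f : Frame n) (s : Snapshot n) (X : ℤ → ℝ) (k : ℤ) : Prop :=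
  s.cw (f.ag k) = true ∧ s.cw (f.ag (k + 1)) = false ∧ X (k + 1) = X k + 2 * s.timeToNextEvent

lemma collides_of_cw (h : Lift f d s X) (hτ : 0 < s.timeToNextEvent) {k : ℤ}
    (hk : s.cw (f.ag k) = true) : s.Collides (f.ag k) ↔ Coll f s X k := by
  constructor
  · rintro ⟨j, ⟨-, hj, hm⟩ | ⟨-, hj, -⟩⟩
    · obtain ⟨l, rfl, hl⟩ := h.exists_lift_right k j
      rw [hm] at hl
      obtain rfl := h.adjacent hτ hk hj hl
      exact ⟨hk, hj, hl⟩
    · simp [hk] at hj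
  · rintro ⟨-, h1, h2⟩
    refine ⟨f.ag (k + 1), Or.inl ⟨hk, h1, ?_⟩⟩
    have hlt : X k < X (k + 1) := by linarith
    have h3 := meetTime_coe_le hlt
    have h4 := s.timeToNextEvent_le_meet (i := f.ag k) (j := f.ag (k + 1)) (Or.inl ⟨hk, h1, rfl⟩)
    rw [h.pos, h.pos] at *
    linarith

lemma collides_of_not_cw (h : Lift f d s X) (hτ : 0 < s.timeToNextEvent) {k : ℤ}
    (hk : s.cw (f.ag (k + 1)) = false) : s.Collides (f.ag (k + 1)) ↔ Coll f s X k := by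
  constructor
  · rintro ⟨j, ⟨hj, -, -⟩ | ⟨hj, -, hm⟩⟩
    · simp [hk] at hj
    · obtain ⟨l, rfl, hl⟩ := h.exists_lift_left (k + 1) j
      rw [hm] at hl
      have := h.adjacent hτ hj hk hl
      obtain rfl : k = l := by omega
      exact ⟨hj, hk, hl⟩
  · rintro ⟨h0, -, h2⟩
    refine ⟨f.ag k, Or.inr ⟨h0, hk, ?_⟩⟩
    have hlt : X k < X (k + 1) := by linarith
    have h3 := meetTime_coe_le hlt
    have h4 := s.timeToNextEvent_le_meet (i := f.ag k) (j := f.ag (k + 1)) (Or.inl ⟨h0, hk, rfl⟩)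
    rw [h.pos, h.pos] at *
    linarith

lemma Coll.add_n (h : Lift f d s X) (k : ℤ) : Coll f s X (k + n) ↔ Coll f s X k := by
  unfold Coll
  rw [f.ag_add, show k + n + 1 = k + 1 + n by ring, f.ag_add, h.per, h.per]
  constructor <;> rintro ⟨h1, h2, h3⟩ <;> exact ⟨h1, h2, by linarith⟩

open Classical in
lemma step_cw (h : Lift f d s X) (hτ : 0 < s.timeToNextEvent) (k : ℤ) :
    s.step.cw (f.ag (k + 1)) =
      if Coll f s X (k + 1) then false else if Coll f s X k then true
        else s.cw (f.ag (k + 1)) := by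
  have h0 : s.step.cw (f.ag (k + 1)) = if s.Collides (f.ag (k + 1)) then !s.cw (f.ag (k + 1))
    else s.cw (f.ag (k + 1)) := rfl
  rw [h0]
  cases hk : s.cw (f.ag (k + 1))
  · have : ¬ Coll f s X (k + 1) := fun h1 => by simp [h1.1] at hk
    simp only [h.collides_of_not_cw hτ hk, this, if_false]
    rfl
  · have : ¬ Coll f s X k := fun h1 => by simp [h1.2.1] at hk
    simp only [h.collides_of_cw hτ hk, this, if_false]
    rfl

lemma step_pos (h : Lift f d s X) (k : ℤ) :
    s.step.pos (f.ag k) =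
      ((X k + sgn (s.cw (f.ag k)) * s.timeToNextEvent : ℝ) : UnitAddCircle) := by
  show s.pos (f.ag k) + _ = _
  rw [h.pos]
  cases s.cw (f.ag k) <;> simp

/-- At a bounce of `k` and `k + 1` the forward token passes to `k + 1` and the backward token to
`k`, while the order of the agents stays. So every token remains carried by someone, and the witness
of the old owner serves the new one. -/
theorem step (h : Lift f d s X) (hc : s.clock < 1) :
    Lift f d s.step (fun k => X k + sgn (s.cw (f.ag k)) * s.timeToNextEvent) := by
  classical
  have hτ := s.timeToNextEvent_pos hc
  set τ := s.timeToNextEvent with hτdef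
  have hclock : s.step.clock = s.clock + τ := rfl
  have hcw : ∀ k, s.step.cw (f.ag k) =
      if Coll f s X k then false else if Coll f s X (k - 1) then true
        else s.cw (f.ag k) := fun k => by
    have := h.step_cw hτ (k - 1); rwa [sub_add_cancel] at this
  refine ⟨h.step_pos, ?_, ?_, ?_, ?_, ?_, ?_, ?_, ?_, ?_⟩
  · intro k; simp only [f.ag_add, h.per]; ring
  · intro k
    have h1 := h.le_succ k
    have h2 := h.tie k
    have h3 := @event_le _ _ _ _ _ h k (k + 1)
    cases ha : s.cw (f.ag k) <;> cases hb : s.cw (f.ag (k + 1)) <;>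
      simp only [ha, hb, sgn_true, sgn_false] at h2 h3 ⊢
    · linarith
    · linarith
    · rcases h1.eq_or_lt with he | hlt
      · simp at h2; exact absurd he h2
      · have := h3 trivial trivial hlt; linarith
    · linarith
  · intro k hk
    have h1 := h.le_succ k
    have h2 := h.tie k
    cases ha : s.cw (f.ag k) <;> cases hb : s.cw (f.ag (k + 1)) <;>
      simp only [ha, hb, sgn_true, sgn_false] at h2 hk ⊢
    · have := h2 (by linarith); simp at this
    · linarith
    · have hC : Coll f s X k := ⟨ha, hb, by linarith⟩
      have hC' : ¬ Coll f s X (k + 1) := fun h' => by simp [h'.1] at hb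
      rw [hcw, hcw, if_pos hC, if_neg hC', add_sub_cancel_right, if_pos hC]; simp
    · have := h2 (by linarith); simp at this
  · intro k hk
    rw [hcw] at hk
    split_ifs at hk with h1 h2
    · obtain ⟨h3, h4, h5⟩ := h2
      rw [sub_add_cancel] at h4 h5
      obtain ⟨a, ha, hX⟩ := h.plus _ h3
      refine ⟨a, ha, ?_⟩
      simp only [h4, sgn_false, hclock, h5]; linarith
    · obtain ⟨a, ha, hX⟩ := h.plus _ hk
      refine ⟨a, ha, ?_⟩
      simp only [hk, sgn_true, hclock]; linarith
  · intro a ha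
    obtain ⟨k, hk, hX⟩ := h.plus' a ha
    by_cases hC : Coll f s X k
    · obtain ⟨h3, h4, h5⟩ := hC
      refine ⟨k + 1, ?_, ?_⟩
      · have hC' : ¬ Coll f s X (k + 1) := fun h' => by simp [h'.1] at h4
        rw [hcw, if_neg hC', add_sub_cancel_right, if_pos ⟨h3, h4, h5⟩]
      · simp only [h4, sgn_false, hclock, h5]; linarith
    · refine ⟨k, ?_, ?_⟩
      · have hC' : ¬ Coll f s X (k - 1) := fun h' => by
          have := h'.2.1; rw [sub_add_cancel, hk] at this; simp at this
        rw [hcw, if_neg hC, if_neg hC', hk]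
      · simp only [hk, sgn_true, hclock]; linarith
  · intro k hk
    rw [hcw] at hk
    split_ifs at hk with h1 h2
    · obtain ⟨h3, h4, h5⟩ := h1
      obtain ⟨a, ha, hX⟩ := h.minus _ h4
      refine ⟨a, ha, ?_⟩
      simp only [h3, sgn_true, hclock]; linarith
    · obtain ⟨a, ha, hX⟩ := h.minus _ hk
      refine ⟨a, ha, ?_⟩
      simp only [hk, sgn_false, hclock]; linarith
  · intro a ha
    obtain ⟨k, hk, hX⟩ := h.minus' a ha
    by_cases hC : Coll f s X (k - 1)
    · have hC2 := hC
      obtain ⟨h3, h4, h5⟩ := hC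
      rw [sub_add_cancel] at h5
      refine ⟨k - 1, ?_, ?_⟩
      · rw [hcw, if_pos hC2]
      · simp only [h3, sgn_true, hclock]; linarith
    · refine ⟨k, ?_, ?_⟩
      · have hC' : ¬ Coll f s X k := fun h' => by simp [h'.1] at hk
        rw [hcw, if_neg hC', if_neg hC, hk]
      · simp only [hk, sgn_false, hclock]; linarith
  · rw [Finset.sum_add_distrib, h.sum_X, ← Finset.sum_mul,
      f.sum_ag (fun i => sgn (s.cw i)), h.sum_cw, hclock]; ring
  · rw [← h.sum_cw, ← f.sum_ag, ← f.sum_ag (fun i => sgn (s.cw i))]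
    -- A bounce lowers the sign of one agent and raises that of the next. Written with the
    -- indicators of the bounces on both sides of an agent, the changes telescope over a period.
    have key : ∀ k, sgn (s.step.cw (f.ag (k + 1))) + 2 * (if Coll f s X (k + 1) then 1 else 0) =
        sgn (s.cw (f.ag (k + 1))) + 2 * (if Coll f s X k then 1 else 0) := by
      intro k
      rw [hcw, add_sub_cancel_right]
      by_cases h1 : Coll f s X (k + 1)
      · have h2 : ¬ Coll f s X k := fun h' => by have := h'.2.1; simp [h1.1] at this
        simp [h1, h2, h1.1]; norm_num
      · by_cases h2 : Coll f s X k
        · simp [h1, h2, h2.2.1]; norm_num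
        · simp [h1, h2]
    have e1 := Finset.sum_congr (rfl : Finset.range n = _) (fun (k : ℕ) _ => key k)
    rw [Finset.sum_add_distrib, Finset.sum_add_distrib, ← Finset.mul_sum, ← Finset.mul_sum,
      Frame.sum_periodic_shift (fun k => if Coll f s X k then (1 : ℝ) else 0)
        (fun k => by simp only [Coll.add_n h]),
      Frame.sum_periodic_shift (fun k => sgn (s.step.cw (f.ag k)))
        (fun k => by simp only [f.ag_add]),
      Frame.sum_periodic_shift (fun k => sgn (s.cw (f.ag k)))
        (fun k => by simp only [f.ag_add])] at e1
    exact add_right_cancel e1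

end Lift

end Snapshot

end RingNetwork

namespace RingNetwork

/-! ### The outcome of a round: net rotation and first collisions -/

/-- The number of places by which all agents rotate in a round, in the direction in which the
agents with `c i = true` start. -/
def rot {n : ℕ} (c : Fin n → Bool) : ℤ := ∑ i, if c i then 1 else -1

lemma rot_cast {n : ℕ} (c : Fin n → Bool) : ((rot c : ℤ) : ℝ) = ∑ i, sgn (c i) := by
  unfold rot
  rw [Int.cast_sum]
  refine Finset.sum_congr rfl fun i _ => ?_
  unfold sgn
  split_ifs <;> simp

lemma rot_not {n : ℕ} (c : Fin n → Bool) : rot (fun i => !c i) = -rot c := by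
  unfold rot
  rw [← Finset.sum_neg_distrib]
  refine Finset.sum_congr rfl fun i _ => ?_
  cases h : c i <;> simp [h]

namespace Snapshot

variable {n : ℕ} {f : Frame n} {d : Fin n → Bool} {s : Snapshot n} {X : ℤ → ℝ}
  {p : Fin n → UnitAddCircle}

lemma start_lift (hg : f.g = true) (hp : f.At 0 p) : Lift f d (start p d) f.x where
  pos k := by show p (f.ag k) = _; rw [hp k, hg]; simp
  per := f.x_add
  le_succ k := (f.mono (by linarith)).le
  tie k h := absurd h (f.mono (by linarith)).ne
  plus k h := ⟨k, h, by simp [start]⟩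
  plus' k h := ⟨k, h, by simp [start]⟩
  minus k h := ⟨k, h, by simp [start]⟩
  minus' k h := ⟨k, h, by simp [start]⟩
  sum_X := by simp [start]
  sum_cw := rfl

/-- The clocks at which an event can happen. -/
def eventClocks (f : Frame n) : Set ℝ :=
  {c | c = 1 ∨ c ≤ 1 ∧ ∃ a b, 0 < c ∧ f.x b - f.x a = 2 * c}

/-- Translation by whole turns brings `a` into one period; since the clock is at most 1, `b` then
lies at most two turns beyond `a`. -/
lemma finite_eventClocks (f : Frame n) : (eventClocks f).Finite := by
  have hn : 0 < n := (f.ag 0).pos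
  refine (Set.Finite.insert (1 : ℝ) (((Set.finite_Ico (0 : ℤ) n).prod
    (Set.finite_Icc (0 : ℤ) (3 * n))).image fun q => (f.x q.2 - f.x q.1) / 2)).subset ?_
  rintro c (rfl | ⟨h1, a, b, h0, h⟩)
  · exact Set.mem_insert _ _
  refine Set.mem_insert_of_mem _ ⟨(a % n, b - (a / n) * n), ⟨⟨?_, ?_⟩, ?_, ?_⟩, ?_⟩
  · exact Int.emod_nonneg _ (by omega)
  · exact Int.emod_lt_of_pos _ (by omega)
  · have h2 : a < b := by
      by_contra hc
      have := f.mono.monotone (not_lt.1 hc); linarith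
    have := Int.emod_nonneg a (show (n : ℤ) ≠ 0 by omega)
    have h3 := Int.emod_add_mul_ediv a n
    show 0 ≤ b - a / n * n
    nlinarith
  · have h2 : b ≤ a + 2 * n := by
      by_contra hc
      have h4 := f.mono (not_le.1 hc)
      rw [f.x_add_mul] at h4; push_cast at h4; linarith
    have := Int.emod_lt_of_pos a (show 0 < (n : ℤ) by omega)
    have h3 := Int.emod_add_mul_ediv a n
    show b - a / n * n ≤ 3 * n
    nlinarith
  · have e1 : f.x (a % n) = f.x a - (a / n : ℤ) := by
      have := f.x_add_mul (a % n) (a / n)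
      rw [mul_comm, Int.emod_add_mul_ediv] at this; linarith
    have e2 : f.x (b - a / n * n) = f.x b - (a / n : ℤ) := by
      have := f.x_add_mul (b - a / n * n) (a / n)
      rw [sub_add_cancel] at this; linarith
    show (f.x (b - a / n * n) - f.x (a % n)) / 2 = c
    rw [e1, e2]; linarith

/-- Where the tokens of `a` and `b` meet at clock c, f.x a + c = f.x b - c. -/
lemma Lift.step_clock_mem (h : Lift f d s X) (h0 : 0 ≤ s.clock) (h1 : s.clock < 1) :
    s.step.clock ∈ eventClocks f := by
  have hτ := s.timeToNextEvent_pos h1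
  have hle := s.timeToNextEvent_le
  have hclock : s.step.clock = s.clock + s.timeToNextEvent := rfl
  rw [hclock]
  have key : ∀ i j, s.cw i = true → s.cw j = false →
      meetTime (s.pos i) (s.pos j) = s.timeToNextEvent →
      s.clock + s.timeToNextEvent ∈ eventClocks f := by
    intro i j hi hj hm
    obtain ⟨k, rfl⟩ := f.ag_surj i
    obtain ⟨l, rfl, hl⟩ := h.exists_lift_right k j
    obtain ⟨a, -, ha⟩ := h.plus k hi
    obtain ⟨b, -, hb⟩ := h.minus l hj
    rw [hm] at hl
    exact Or.inr ⟨by linarith, a, b, by linarith, by linarith⟩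
  rcases s.timeToNextEvent_mem with h' | ⟨i, j, ⟨hi, hj, hm⟩ | ⟨hj, hi, hm⟩⟩
  · left; linarith
  · exact key i j hi hj hm
  · exact key j i hj hi hm

lemma Lift.step_clock_le (_ : Lift f d s X) : s.step.clock ≤ 1 := by
  have hle := s.timeToNextEvent_le
  have hclock : s.step.clock = s.clock + s.timeToNextEvent := rfl
  linarith

/-- The principle by which facts about a whole round are proved event by event. The round does end:
otherwise the clocks would be a strictly increasing sequence in the finite set `eventClocks f`, so
the infimum in `finish` is attained. -/
theorem finish_induction (hg : f.g = true) (hp : f.At 0 p) (P : Snapshot n → (ℤ → ℝ) → Prop)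
    (h0 : P (start p d) f.x)
    (hs : ∀ s X, Lift f d s X → 0 ≤ s.clock → s.clock < 1 → P s X →
      P s.step fun k => X k + sgn (s.cw (f.ag k)) * s.timeToNextEvent) :
    ∃ X, Lift f d (finish p d) X ∧ (finish p d).clock = 1 ∧ P (finish p d) X := by
  set u : ℕ → Snapshot n := fun k => step^[k] (start p d) with hu
  have hsucc : ∀ k, u (k + 1) = (u k).step := fun k => Function.iterate_succ_apply' _ _ _
  have inv : ∀ k, (∀ j < k, (u j).clock ≠ 1) →
      ∃ X, Lift f d (u k) X ∧ 0 ≤ (u k).clock ∧ (u k).clock ≤ 1 ∧ P (u k) X := by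
    intro k
    induction k with
    | zero => exact fun _ => ⟨f.x, start_lift hg hp, le_refl (0 : ℝ), zero_le_one (α := ℝ), h0⟩
    | succ k ih =>
      intro hk
      obtain ⟨X, hX, h1, h2, h3⟩ := ih fun j hj => hk j (by omega)
      have h4 : (u k).clock < 1 := lt_of_le_of_ne h2 (hk k (by omega))
      have h5 := (u k).timeToNextEvent_pos h4
      have hclock : (u k).step.clock = (u k).clock + (u k).timeToNextEvent := rfl
      rw [hsucc]
      exact ⟨_, hX.step h4, by linarith, hX.step_clock_le, hs _ _ hX h1 h4 h3⟩
  have hne : {k : ℕ | (u k).clock = 1}.Nonempty := by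
    by_contra hc
    rw [Set.not_nonempty_iff_eq_empty, Set.eq_empty_iff_forall_notMem] at hc
    have hinv := fun k => inv k fun j _ => hc j
    have hlt : ∀ k, (u k).clock < 1 := fun k => by
      obtain ⟨X, -, -, h, -⟩ := hinv k
      exact lt_of_le_of_ne h (hc k)
    have hmono : StrictMono fun k => (u (k + 1)).clock := by
      refine strictMono_nat_of_lt_succ fun k => ?_
      have h5 := (u (k + 1)).timeToNextEvent_pos (hlt _)
      rw [hsucc (k + 1)]
      have hclock : (u (k + 1)).step.clock = (u (k + 1)).clock + (u (k + 1)).timeToNextEvent := rfl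
      linarith
    refine Set.infinite_of_injective_forall_mem hmono.injective (fun k => ?_)
      (finite_eventClocks f)
    obtain ⟨X, hX, h1, -, -⟩ := hinv k
    rw [hsucc]
    exact hX.step_clock_mem h1 (hlt k)
  obtain ⟨X, hX, -, -, hP⟩ := inv (sInf {k : ℕ | (u k).clock = 1})
    fun j hj => Nat.notMem_of_lt_sInf hj
  exact ⟨X, hX, Nat.sInf_mem hne, hP⟩

/-- At clock 1 all tokens stand on places of the frame, and every place carries a token. The agents
thus fill all places in order, which leaves only a shift by a constant; comparing the sums of
coordinates over a period identifies it. -/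
lemma finish_at_base (hg : f.g = true) (hp : f.At 0 p) : f.At (rot d) (finish p d).pos := by
  have hn : 0 < n := (f.ag 0).pos
  obtain ⟨X, hX, hc, -⟩ := finish_induction (d := d) hg hp (fun _ _ => True) trivial
    (fun _ _ _ _ _ _ => trivial)
  have hlt : ∀ k, X k < X (k + 1) := fun k => by
    refine lt_of_le_of_ne (hX.le_succ k) fun he => ?_
    obtain ⟨h1, h2⟩ := hX.tie k he
    obtain ⟨a, ha, ha'⟩ := hX.minus _ h1
    obtain ⟨b, hb, hb'⟩ := hX.plus _ h2
    rw [hc] at ha' hb'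
    -- In a tie at clock 1 the backward token of `a` and the forward token of `b` share a place,
    -- hence belong to the same agent, which started in only one direction.
    have h3 : f.x a = f.x (b + 2 * n) := by rw [f.x_add_mul]; push_cast; linarith
    have h4 := f.mono.injective h3
    have h5 : f.ag b = f.ag a := by rw [f.ag_eq_iff, h4]; simp
    rw [h5, ha] at hb; simp at hb
  have hmono : StrictMono X := strictMono_int_of_lt_succ hlt
  have hρ : ∀ k, ∃ m, X k = f.x m := fun k => by
    cases hk : (finish p d).cw (f.ag k)
    · obtain ⟨a, -, ha⟩ := hX.minus k hk
      refine ⟨a + (-1) * n, ?_⟩; rw [f.x_add_mul, ha, hc]; push_cast; ring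
    · obtain ⟨a, -, ha⟩ := hX.plus k hk
      refine ⟨a + 1 * n, ?_⟩; rw [f.x_add_mul, ha, hc]; push_cast; ring
  choose ρ hρ using hρ
  have hρm : StrictMono ρ := fun a b hab => by
    have := hmono hab
    rw [hρ, hρ] at this
    exact f.mono.lt_iff_lt.1 this
  have hρs : Function.Surjective ρ := fun m => by
    cases hm : d (f.ag m)
    · have : d (f.ag (m + 1 * n)) = false := by rw [one_mul, f.ag_add, hm]
      obtain ⟨k, -, hk⟩ := hX.minus' _ this
      refine ⟨k, f.mono.injective ?_⟩
      rw [← hρ, hk, f.x_add_mul, hc]; push_cast; ring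
    · have : d (f.ag (m + (-1) * n)) = true := by
        rw [← hm]; congr 1; rw [f.ag_eq_iff]; simp
      obtain ⟨k, -, hk⟩ := hX.plus' _ this
      refine ⟨k, f.mono.injective ?_⟩
      rw [← hρ, hk, f.x_add_mul, hc]; push_cast; ring
  have hsucc : ∀ k, ρ (k + 1) = ρ k + 1 := fun k => by
    have h1 := hρm (show k < k + 1 by omega)
    obtain ⟨l, hl⟩ := hρs (ρ k + 1)
    have h2 : k < l := hρm.lt_iff_lt.1 (by omega)
    have h3 := hρm.monotone (show k + 1 ≤ l by omega)
    omega
  have hshift : ∀ k, ρ k = k + ρ 0 := fun k => by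
    induction k using Int.induction_on with
    | zero => simp
    | succ i ih => rw [hsucc, ih]; ring
    | pred i ih =>
      have := hsucc (-i - 1)
      rw [sub_add_cancel, ih] at this; linarith
  have hsum : ∀ r : ℤ, ∑ k ∈ Finset.range n, f.x (k + r) = ∑ k ∈ Finset.range n, f.x k + r := by
    have hs : ∀ r : ℤ, ∑ k ∈ Finset.range n, f.x (k + (r + 1)) =
        ∑ k ∈ Finset.range n, f.x (k + r) + 1 := fun r => by
      have h1 := Finset.sum_range_succ (fun k : ℕ => f.x (k + r)) n
      have h2 := Finset.sum_range_succ' (fun k : ℕ => f.x (k + r)) n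
      have h3 := f.x_add r
      rw [h1] at h2
      push_cast at h2
      rw [add_comm r, ] at h3
      rw [h3, zero_add] at h2
      have h4 : ∑ k ∈ Finset.range n, f.x (k + (r + 1)) = ∑ k ∈ Finset.range n, f.x (k + 1 + r) :=
        Finset.sum_congr rfl fun k _ => by congr 1; ring
      linarith
    intro r
    induction r using Int.induction_on with
    | zero => simp
    | succ i ih => rw [hs, ih]; push_cast; ring
    | pred i ih =>
      have := hs (-i - 1)
      rw [sub_add_cancel, ih] at this; push_cast at this ⊢; linarith
  have hr : (ρ 0 : ℤ) = rot d := by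
    have h1 := hX.sum_X
    rw [Finset.sum_congr rfl (fun (k : ℕ) _ => hρ k)] at h1
    rw [Finset.sum_congr rfl (fun (k : ℕ) _ => by rw [hshift k]), hsum, hc, ← rot_cast] at h1
    have : ((ρ 0 : ℤ) : ℝ) = (rot d : ℤ) := by linarith
    exact_mod_cast this
  intro k
  rw [hX.pos, hρ, hshift, hr, hg]; simp

lemma cw_step_of_not_collides {i : Fin n} (h : ¬ s.Collides i) : s.step.cw i = s.cw i := if_neg h

open Classical in
lemma first_step_of_some {i : Fin n} {c : UnitAddCircle} (h : s.first i = some c) :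
    s.step.first i = some c := by
  show (if s.Collides i then (s.first i).or _ else s.first i) = some c
  rw [h]; simp

lemma first_step_of_not_collides {i : Fin n} (h : ¬ s.Collides i) :
    s.step.first i = s.first i := if_neg h

open Classical in
lemma first_step_of_collides {i : Fin n} (h : s.Collides i) (h' : s.first i = none) :
    s.step.first i = some (s.step.pos i) := by
  show (if s.Collides i then (s.first i).or (some (s.step.pos i)) else s.first i) = _
  rw [if_pos h, h']; rfl

lemma finish_first_none_base (hg : f.g = true) (hp : f.At 0 p) (hd : ∀ i j, d i = d j)
    (i : Fin n) : (finish p d).first i = none := by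
  refine Exists.elim (finish_induction (d := d) hg hp
    (fun s _ => ∀ i, s.first i = none) (fun _ => rfl) ?_) fun X ⟨_, _, h⟩ => h i
  intro s X hX _ h1 h i
  rw [first_step_of_not_collides, h]
  have key : ∀ i j, s.cw i = true → s.cw j = false → False := fun i j hi hj => by
    obtain ⟨k, rfl⟩ := f.ag_surj i
    obtain ⟨l, rfl⟩ := f.ag_surj j
    obtain ⟨a, ha, -⟩ := hX.plus k hi
    obtain ⟨b, hb, -⟩ := hX.minus l hj
    rw [hd _ (f.ag b), hb] at ha; simp at ha
  rintro ⟨j, ⟨hi, hj, -⟩ | ⟨hj, hi, -⟩⟩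
  · exact key _ _ hi hj
  · exact key _ _ hj hi

/-- Until half the distance to `k + δ` has elapsed, agent `k` still carries its own token. Every
backward token ahead of it stems from `k + δ` or beyond, so no collision can come sooner. As δ < n,
the distance is below 1 and the meeting falls into the round. -/
lemma finish_first_fwd_base (hg : f.g = true) (hp : f.At 0 p) {k δ : ℤ} (hδ : 0 < δ)
    (hk : d (f.ag k) = true) (hkδ : d (f.ag (k + δ)) = false)
    (hj : ∀ j, 0 < j → j < δ → d (f.ag (k + j)) = true) :
    (finish p d).first (f.ag k) =
      some (((f.x k + f.x (k + δ)) / 2 : ℝ) : UnitAddCircle) := by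
  have hδn : δ < n := by
    by_contra hc
    rcases (not_lt.1 hc).eq_or_lt with he | hlt
    · rw [← he, f.ag_add, hk] at hkδ; simp at hkδ
    · have h1 := hj (δ - n) (by omega) (by have := (f.ag 0).pos; omega)
      rw [← f.ag_add, show k + (δ - n) + n = k + δ by ring, hkδ] at h1; simp at h1
  have hd1 : f.x (k + δ) < f.x k + 1 := by rw [← f.x_add]; exact f.mono (by omega)
  refine Exists.elim (finish_induction (d := d) hg hp
    (fun s X => (2 * s.clock < f.x (k + δ) - f.x k →
        s.first (f.ag k) = none ∧ s.cw (f.ag k) = true ∧ X k = f.x k + s.clock) ∧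
      (f.x (k + δ) - f.x k ≤ 2 * s.clock → s.first (f.ag k) =
        some (((f.x k + f.x (k + δ)) / 2 : ℝ) : UnitAddCircle))) ?_ ?_) fun X ⟨_, hc, h⟩ => h.2 (by rw [hc]; linarith)
  · refine ⟨fun _ => ⟨rfl, hk, by simp [start]⟩, fun h => ?_⟩
    have h1 := f.mono (show k < k + δ by omega)
    simp only [start] at h; linarith
  · rintro s X hX h0 h1 ⟨hP, hQ⟩
    have hτ := s.timeToNextEvent_pos h1
    have hclock : s.step.clock = s.clock + s.timeToNextEvent := rfl
    rcases lt_or_ge (2 * s.clock) (f.x (k + δ) - f.x k) with hlt | hge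
    · obtain ⟨hf, hw, hXk⟩ := hP hlt
      obtain ⟨l, hl, hXl⟩ := hX.minus' _ hkδ
      have hτle := hX.event_le hw hl (by linarith)
      by_cases hC : s.Collides (f.ag k)
      · obtain ⟨-, hw1, hX1⟩ := (hX.collides_of_cw hτ hw).1 hC
        obtain ⟨a, ha, hXa⟩ := hX.minus _ hw1
        have hka : k + δ ≤ a := by
          by_contra hc
          have h2 : k < a := f.mono.lt_iff_lt.1 (by linarith)
          have := hj (a - k) (by omega) (by omega)
          rw [show k + (a - k) = a by ring, ha] at this; simp at this
        have := f.mono.monotone hka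
        refine ⟨fun h => by linarith, fun _ => ?_⟩
        rw [first_step_of_collides hC hf, hX.step_pos, hw, sgn_true]
        congr 2; linarith
      · rw [first_step_of_not_collides hC]
        -- If the event took place exactly at half the distance, the token of `k + δ` would be met
        -- there and the agent would collide.
        have hne : s.step.clock * 2 ≠ f.x (k + δ) - f.x k := fun he => by
          have hXl' : X l = X k + 2 * s.timeToNextEvent := by linarith
          have := hX.adjacent hτ hw hl hXl'
          subst this
          exact hC ((hX.collides_of_cw hτ hw).2 ⟨hw, hl, hXl'⟩)
        refine ⟨fun _ => ⟨hf, ?_, ?_⟩, fun h => absurd ?_ hne⟩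
        · rw [cw_step_of_not_collides hC, hw]
        · simp only [hw, sgn_true]; linarith
        · linarith
    · refine ⟨fun h => by linarith, fun _ => first_step_of_some (hQ hge)⟩

lemma finish_first_bwd_base (hg : f.g = true) (hp : f.At 0 p) {k δ : ℤ} (hδ : 0 < δ)
    (hk : d (f.ag k) = false) (hkδ : d (f.ag (k - δ)) = true)
    (hj : ∀ j, 0 < j → j < δ → d (f.ag (k - j)) = false) :
    (finish p d).first (f.ag k) =
      some (((f.x k + f.x (k - δ)) / 2 : ℝ) : UnitAddCircle) := by
  have hδn : δ < n := by
    by_contra hc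
    rcases (not_lt.1 hc).eq_or_lt with he | hlt
    · have := f.ag_add (k - n)
      rw [sub_add_cancel] at this
      rw [← he, ← this, hk] at hkδ; simp at hkδ
    · have h1 := hj (δ - n) (by omega) (by have := (f.ag 0).pos; omega)
      have := f.ag_add (k - δ)
      rw [show k - (δ - n) = k - δ + n by ring, this, hkδ] at h1; simp at h1
  have hd1 : f.x k < f.x (k - δ) + 1 := by rw [← f.x_add]; exact f.mono (by omega)
  refine Exists.elim (finish_induction (d := d) hg hp
    (fun s X => (2 * s.clock < f.x k - f.x (k - δ) →
        s.first (f.ag k) = none ∧ s.cw (f.ag k) = false ∧ X k = f.x k - s.clock) ∧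
      (f.x k - f.x (k - δ) ≤ 2 * s.clock → s.first (f.ag k) =
        some (((f.x k + f.x (k - δ)) / 2 : ℝ) : UnitAddCircle))) ?_ ?_) fun X ⟨_, hc, h⟩ => h.2 (by rw [hc]; linarith)
  · refine ⟨fun _ => ⟨rfl, hk, by simp [start]⟩, fun h => ?_⟩
    have h1 := f.mono (show k - δ < k by omega)
    simp only [start] at h; linarith
  · rintro s X hX h0 h1 ⟨hP, hQ⟩
    have hτ := s.timeToNextEvent_pos h1
    have hclock : s.step.clock = s.clock + s.timeToNextEvent := rfl
    rcases lt_or_ge (2 * s.clock) (f.x k - f.x (k - δ)) with hlt | hge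
    · obtain ⟨hf, hw, hXk⟩ := hP hlt
      obtain ⟨l, hl, hXl⟩ := hX.plus' _ hkδ
      have hτle := hX.event_le hl hw (by linarith)
      have hw' : s.cw (f.ag (k - 1 + 1)) = false := by rw [sub_add_cancel]; exact hw
      have hiff := hX.collides_of_not_cw hτ hw'
      rw [sub_add_cancel] at hiff
      by_cases hC : s.Collides (f.ag k)
      · obtain ⟨hw1, -, hX1⟩ := hiff.1 hC
        rw [sub_add_cancel] at hX1
        obtain ⟨a, ha, hXa⟩ := hX.plus _ hw1
        have hka : a ≤ k - δ := by
          by_contra hc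
          have h2 : a < k := f.mono.lt_iff_lt.1 (by linarith)
          have := hj (k - a) (by omega) (by omega)
          rw [show k - (k - a) = a by ring, ha] at this; simp at this
        have := f.mono.monotone hka
        refine ⟨fun h => by linarith, fun _ => ?_⟩
        rw [first_step_of_collides hC hf, hX.step_pos, hw, sgn_false]
        congr 2; linarith
      · rw [first_step_of_not_collides hC]
        have hne : s.step.clock * 2 ≠ f.x k - f.x (k - δ) := fun he => by
          have hXl' : X k = X l + 2 * s.timeToNextEvent := by linarith
          have := hX.adjacent hτ hl hw hXl'
          obtain rfl : l = k - 1 := by omega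
          exact hC (hiff.2 ⟨hl, hw', by rw [sub_add_cancel]; exact hXl'⟩)
        refine ⟨fun _ => ⟨hf, ?_, ?_⟩, fun h => absurd ?_ hne⟩
        · rw [cw_step_of_not_collides hC, hw]
        · simp only [hw, sgn_false]; linarith
        · linarith
    · refine ⟨fun h => by linarith, fun _ => first_step_of_some (hQ hge)⟩

variable {R : ℤ}

/-- An anticlockwise frame is mirrored first; this changes the sign both of the starting directions
and of the rotation. -/
theorem finish_at (hp : f.At R p) (d : Fin n → Bool) :
    f.At (R + rot fun i => d i == f.g) (finish p d).pos := by
  cases hg : f.g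
  · have h1 := hp.mirror.rotate
    have h2 := finish_at_base (d := d) (by simp [Frame.rotate, Frame.mirror, hg]) h1
    rw [Frame.at_rotate_iff] at h2
    have h3 := h2.mirror
    have h4 : rot d = -rot fun i => d i == false := by
      rw [← rot_not]; congr 1; ext i; cases d i <;> rfl
    rw [h4, show -(-R + -rot fun i => d i == false) = R + rot fun i => d i == false by ring] at h3
    intro k
    have h5 := h3 k
    simpa [Frame.mirror] using h5
  · have h2 := finish_at_base (d := d) (by simp [Frame.rotate, hg]) hp.rotate
    rw [Frame.at_rotate_iff] at h2
    simpa using h2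

theorem finish_first_none (hp : f.At R p) {d : Fin n → Bool} (hd : ∀ i j, d i = d j)
    (i : Fin n) : (finish p d).first i = none := by
  cases hg : f.g
  · exact finish_first_none_base (by simp [Frame.rotate, Frame.mirror, hg]) hp.mirror.rotate hd i
  · exact finish_first_none_base (by simp [Frame.rotate, hg]) hp.rotate hd i

theorem finish_first_fwd (hp : f.At R p) {d : Fin n → Bool} {k δ : ℤ} (hδ : 0 < δ)
    (hk : (d (f.ag k) == f.g) = true) (hkδ : (d (f.ag (k + δ)) == f.g) = false)
    (hj : ∀ j, 0 < j → j < δ → (d (f.ag (k + j)) == f.g) = true) :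
    (finish p d).first (f.ag k) =
      some ((sgn f.g * ((f.x (k + R) + f.x (k + δ + R)) / 2) : ℝ) : UnitAddCircle) := by
  cases hg : f.g
  · have h := finish_first_bwd_base (d := d) (k := -k) (δ := δ)
      (by simp [Frame.rotate, Frame.mirror, hg]) hp.mirror.rotate hδ
      (by simpa [Frame.rotate, Frame.mirror, hg] using hk)
      (by simpa [Frame.rotate, Frame.mirror, hg, add_comm] using hkδ)
      (by simpa [Frame.rotate, Frame.mirror, hg, add_comm] using hj)
    simp only [Frame.rotate, Frame.mirror, neg_neg] at h
    rw [h]; simp only [sgn_false]; congr 2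
    rw [show -(-k + -R) = k + R by ring, show -(-k - δ + -R) = k + δ + R by ring]; ring
  · have h := finish_first_fwd_base (d := d) (k := k) (δ := δ)
      (by simp [Frame.rotate, hg]) hp.rotate hδ
      (by simpa [Frame.rotate, hg] using hk)
      (by simpa [Frame.rotate, hg] using hkδ)
      (by simpa [Frame.rotate, hg] using hj)
    simp only [Frame.rotate] at h
    rw [h]; simp

end Snapshot

end RingNetwork

namespace RingNetwork

/-! ### Signed distances on the circle and their real representatives -/

lemma sgn_beq (a b : Bool) : sgn (a == b) = sgn a * sgn b := by cases a <;> cases b <;> simp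

lemma coe_cwArc (x y : UnitAddCircle) : ((cwArc x y : ℝ) : UnitAddCircle) = y - x :=
  (AddCircle.equivIco (1 : ℝ) 0).symm_apply_apply (y - x)

lemma coe_rightDist_coe (b : Bool) (u v : ℝ) :
    ((rightDist b (u : UnitAddCircle) v : ℝ) : UnitAddCircle) =
      ((sgn b * (v - u) : ℝ) : UnitAddCircle) := by
  cases b <;> simp [rightDist, coe_cwArc]

lemma dist_coe_of_lt {u v : ℝ} (h : |u - v| < 1 / 2) :
    dist (u : UnitAddCircle) (v : UnitAddCircle) = |u - v| := by
  rw [dist_eq_norm, ← AddCircle.coe_sub, UnitAddCircle.norm_eq]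
  have : round (u - v) = 0 := by
    rw [round_eq_zero_iff]
    rw [abs_lt] at h
    exact ⟨by linarith, by linarith⟩
  rw [this]; simp

/-! ### Existence of frames -/

/-- The representatives in [0, 1) are sorted; place `k` is the one of index `k` modulo `n`, raised
by the number `k / n` of completed turns. -/
theorem exists_frame {n : ℕ} (hn : 0 < n) {p : Fin n → UnitAddCircle}
    (hp : Function.Injective p) : ∃ f : Frame n, f.At 0 p := by
  have : NeZero n := ⟨hn.ne'⟩
  have hn' : (0 : ℤ) < n := by exact_mod_cast hn
  set y : Fin n → ℝ := fun i => (AddCircle.equivIco (1 : ℝ) 0 (p i) : ℝ) with hy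
  have hcoe : ∀ i, ((y i : ℝ) : UnitAddCircle) = p i := fun i =>
    (AddCircle.equivIco (1 : ℝ) 0).symm_apply_apply (p i)
  have hy0 : ∀ i, 0 ≤ y i := fun i => (AddCircle.equivIco (1 : ℝ) 0 (p i)).2.1
  have hy1 : ∀ i, y i < 1 := fun i => by
    have := (AddCircle.equivIco (1 : ℝ) 0 (p i)).2.2; simpa using this
  have hyi : Function.Injective y := fun i j h => hp (by rw [← hcoe, h, hcoe])
  set τ := Tuple.sort y
  have hτ : StrictMono (y ∘ τ) :=
    (Tuple.monotone_sort y).strictMono_of_injective (hyi.comp τ.injective)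
  let q : ℤ → Fin n := fun k => ⟨(k % n).toNat, by
    have := Int.emod_nonneg k hn'.ne'; have := Int.emod_lt_of_pos k hn'; omega⟩
  have hqv : ∀ k, ((q k : ℕ) : ℤ) = k % n := fun k => by
    have := Int.emod_nonneg k hn'.ne'
    show ((k % n).toNat : ℤ) = _
    omega
  have hadd : ∀ k : ℤ, q (k + n) = q k := fun k => by
    ext; have h1 := hqv (k + n); have h2 := hqv k
    rw [Int.add_emod_right] at h1; omega
  refine ⟨⟨true, fun k => y (τ (q k)) + (k / n : ℤ), fun k => τ (q k), ?_, ?_, ?_, ?_⟩, ?_⟩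
  · refine strictMono_int_of_lt_succ fun k => ?_
    have h1 := Int.emod_add_mul_ediv k n
    have h2 := Int.emod_add_mul_ediv (k + 1) n
    have h3 := Int.emod_nonneg k hn'.ne'
    have h4 := Int.emod_lt_of_pos k hn'
    have h5 := Int.emod_nonneg (k + 1) hn'.ne'
    have h6 := Int.emod_lt_of_pos (k + 1) hn'
    have h7 := hqv k
    have h8 := hqv (k + 1)
    have h9 : k / n ≤ (k + 1) / n := Int.ediv_le_ediv hn' (by omega)
    rcases h9.eq_or_lt with he | hlt
    · rw [← he] at h2 ⊢
      have : y (τ (q k)) < y (τ (q (k + 1))) := hτ (show q k < q (k + 1) by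
        rw [Fin.lt_def]; omega)
      linarith
    · have h10 : ((k / n : ℤ) : ℝ) + 1 ≤ ((k + 1) / n : ℤ) := by exact_mod_cast hlt
      have := hy0 (τ (q (k + 1)))
      have := hy1 (τ (q k))
      linarith
  · intro k
    simp only [hadd, Int.add_ediv_of_dvd_right (dvd_refl (n : ℤ)), Int.ediv_self hn'.ne']
    push_cast; ring
  · intro k l
    show τ (q k) = τ (q l) ↔ _
    rw [τ.injective.eq_iff, Fin.ext_iff, ← Int.modEq_iff_dvd, Int.ModEq, ← hqv, ← hqv]
    exact_mod_cast Iff.rfl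
  · intro i
    refine ⟨(τ.symm i : ℕ), ?_⟩
    have : q ((τ.symm i : ℕ) : ℤ) = τ.symm i := by
      ext
      have := hqv ((τ.symm i : ℕ) : ℤ)
      rw [Int.emod_eq_of_lt (by omega) (by exact_mod_cast (τ.symm i).2)] at this
      exact_mod_cast this
    simp only [this, Equiv.apply_symm_apply]
  · intro k
    simp [hcoe]

/-! ### One round as the agents see it -/

/-- The direction that an agent calls right if `b = true`, left otherwise. -/
def dir (b : Bool) : Direction := if b then .right else .left

lemma startsCw_dir (s b : Bool) : startsCw s (dir b) = (s == b) := by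
  cases s <;> cases b <;> rfl

variable {n : ℕ} {f : Frame n} {R : ℤ} {p : Fin n → UnitAddCircle} {σ : Fin n → Bool}
  {c : Fin n → Bool}

/-- The snapshot at the end of a round in which agent `i` starts right, in its own sense of
direction `σ i`, if and only if `c i = true`. -/
def roundEnd (σ : Fin n → Bool) (p : Fin n → UnitAddCircle) (c : Fin n → Bool) : Snapshot n :=
  Snapshot.finish p fun i => startsCw (σ i) (dir (c i))

/-- The observation of agent `i` in such a round. -/
def obs (σ : Fin n → Bool) (p : Fin n → UnitAddCircle) (c : Fin n → Bool) (i : Fin n) :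
    Observation where
  dist := rightDist (σ i) (p i) ((roundEnd σ p c).pos i)
  coll := ((roundEnd σ p c).first i).map fun z => Dist.dist (p i) z

/-- Whether an agent starts forward with respect to the orientation `g`. -/
def fwd (σ : Fin n → Bool) (g : Bool) (c : Fin n → Bool) (i : Fin n) : Bool := (σ i == c i) == g

/-- The number of places by which the agents rotate with respect to the orientation `g`. -/
def rotOf (σ : Fin n → Bool) (g : Bool) (c : Fin n → Bool) : ℤ := rot (fwd σ g c)

lemma rotOf_not (g : Bool) : rotOf σ g (fun i => !c i) = -rotOf σ g c := by
  unfold rotOf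
  rw [← rot_not]; congr 1; ext i
  show ((σ i == !c i) == g) = !((σ i == c i) == g)
  generalize σ i = x, c i = y
  revert x y g; decide

lemma roundEnd_at (hp : f.At R p) : f.At (R + rotOf σ f.g c) (roundEnd σ p c).pos := by
  have := Snapshot.finish_at hp (fun i => startsCw (σ i) (dir (c i)))
  unfold rotOf fwd roundEnd
  simp only [startsCw_dir] at this ⊢
  exact this

/-- The whole round reversed restores the positions. -/
lemma roundEnd_reverse (hp : f.At R p) :
    (roundEnd σ (roundEnd σ p c).pos fun i => !c i).pos = p := by
  have := roundEnd_at (σ := σ) (c := fun i => !c i) (roundEnd_at (σ := σ) (c := c) hp)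
  rw [rotOf_not, add_neg_cancel_right] at this
  exact this.unique hp

lemma obs_dist (hp : f.At R p) (k : ℤ) :
    (((obs σ p c (f.ag k)).dist : ℝ) : UnitAddCircle) =
      ((sgn (σ (f.ag k) == f.g) * (f.x (k + R + rotOf σ f.g c) - f.x (k + R)) : ℝ) :
        UnitAddCircle) := by
  show ((rightDist _ (p (f.ag k)) ((roundEnd σ p c).pos (f.ag k)) : ℝ) : UnitAddCircle) = _
  rw [hp k, roundEnd_at hp k, coe_rightDist_coe, sgn_beq, ← add_assoc]
  congr 1; ring

lemma Frame.lt_of_first {c : Fin n → Bool} {k δ : ℤ}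
    (hkδ : c (f.ag (k + δ)) ≠ c (f.ag k))
    (hj : ∀ j, 0 < j → j < δ → c (f.ag (k + j)) = c (f.ag k)) : δ < n := by
  by_contra hc
  rcases (not_lt.1 hc).eq_or_lt with he | hlt
  · rw [← he, f.ag_add] at hkδ; exact hkδ rfl
  · have h1 := hj (δ - n) (by omega) (by have := (f.ag 0).pos; omega)
    rw [← f.ag_add, show k + (δ - n) + n = k + δ by ring] at h1
    exact hkδ h1

lemma obs_coll_fwd (hp : f.At R p) {k δ : ℤ} (hδ : 0 < δ) (hk : fwd σ f.g c (f.ag k) = true)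
    (hkδ : fwd σ f.g c (f.ag (k + δ)) = false)
    (hj : ∀ j, 0 < j → j < δ → fwd σ f.g c (f.ag (k + j)) = true) :
    (obs σ p c (f.ag k)).coll = some ((f.x (k + δ + R) - f.x (k + R)) / 2) := by
  have hlt := Frame.lt_of_first (f := f) (c := fwd σ f.g c) (by rw [hkδ, hk]; simp)
    (by simpa only [hk] using hj)
  have h := Snapshot.finish_first_fwd (d := fun i => startsCw (σ i) (dir (c i))) hp hδ
    (by simp only [startsCw_dir]; exact hk) (by simp only [startsCw_dir]; exact hkδ)
    (by simp only [startsCw_dir]; exact hj)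
  show ((roundEnd σ p c).first (f.ag k)).map _ = _
  unfold roundEnd
  rw [h, Option.map_some, hp k]
  have h1 := f.mono (show k + R < k + δ + R by omega)
  have h2 := f.mono (show k + δ + R < k + R + n by omega)
  rw [f.x_add] at h2
  have h3 : |sgn f.g * f.x (k + R) - sgn f.g * ((f.x (k + R) + f.x (k + δ + R)) / 2)| =
      (f.x (k + δ + R) - f.x (k + R)) / 2 := by
    rw [← mul_sub, abs_mul, show |sgn f.g| = 1 by cases f.g <;> simp, one_mul, abs_of_nonpos] <;>
      linarith
  rw [dist_coe_of_lt (by rw [h3]; linarith), h3]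

lemma fwd_not (g : Bool) (i : Fin n) : fwd σ (!g) c i = !fwd σ g c i := by
  unfold fwd
  generalize σ i = x, c i = y
  revert x y g; decide

lemma obs_coll_bwd (hp : f.At R p) {k δ : ℤ} (hδ : 0 < δ) (hk : fwd σ f.g c (f.ag k) = false)
    (hkδ : fwd σ f.g c (f.ag (k - δ)) = true)
    (hj : ∀ j, 0 < j → j < δ → fwd σ f.g c (f.ag (k - j)) = false) :
    (obs σ p c (f.ag k)).coll = some ((f.x (k + R) - f.x (k - δ + R)) / 2) := by
  have h := obs_coll_fwd (σ := σ) (c := c) hp.mirror (k := -k) hδ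
    (by simpa [Frame.mirror, fwd_not] using hk)
    (by
      have : -δ + k = k - δ := by ring
      simpa [Frame.mirror, fwd_not, this] using hkδ)
    (by
      intro j h1 h2
      have : -j + k = k - j := by ring
      simpa [Frame.mirror, fwd_not, this] using hj j h1 h2)
  simp only [Frame.mirror, neg_neg] at h
  rw [h, show -(-k + -R) = k + R by ring, show -(-k + δ + -R) = k - δ + R by ring]
  congr 1; ring

lemma obs_coll_none (hp : f.At R p) (h : ∀ i j, fwd σ f.g c i = fwd σ f.g c j) (i : Fin n) :
    (obs σ p c i).coll = none := by
  show ((roundEnd σ p c).first i).map _ = _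
  unfold roundEnd
  rw [Snapshot.finish_first_none hp, Option.map_none]
  intro i j
  have := h i j
  simp only [startsCw_dir]
  unfold fwd at this
  revert this
  cases (σ i == c i) <;> cases (σ j == c j) <;> cases f.g <;> simp

lemma Frame.exists_first (f : Frame n) (c : Fin n → Bool) (k : ℤ)
    (h : ∃ j, c j ≠ c (f.ag k)) : ∃ δ : ℤ, 0 < δ ∧ c (f.ag (k + δ)) ≠ c (f.ag k) ∧
      ∀ j, 0 < j → j < δ → c (f.ag (k + j)) = c (f.ag k) := by
  classical
  have hn : 0 < n := (f.ag 0).pos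
  have hex : ∃ m : ℕ, c (f.ag (k + (m + 1))) ≠ c (f.ag k) := by
    obtain ⟨j, hj⟩ := h
    obtain ⟨l, rfl⟩ := f.ag_surj j
    have h1 := Int.emod_nonneg (l - k - 1) (show (n : ℤ) ≠ 0 by omega)
    refine ⟨((l - k - 1) % n).toNat, ?_⟩
    rw [Int.toNat_of_nonneg h1]
    have : f.ag (k + ((l - k - 1) % n + 1)) = f.ag l := by
      rw [f.ag_eq_iff]
      have := Int.emod_add_mul_ediv (l - k - 1) n
      exact ⟨(l - k - 1) / n, by linarith⟩
    rwa [this]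
  refine ⟨Nat.find hex + 1, by omega, Nat.find_spec hex, fun j h1 h2 => ?_⟩
  have := Nat.find_min hex (m := (j - 1).toNat) (by omega)
  rw [not_not, Int.toNat_of_nonneg (by omega)] at this
  simpa using this

lemma exists_obs_coll_fwd (hp : f.At R p) {k : ℤ} (hk : fwd σ f.g c (f.ag k) = true) {v : ℝ}
    (hv : (obs σ p c (f.ag k)).coll = some v) :
    ∃ δ : ℤ, 0 < δ ∧ fwd σ f.g c (f.ag (k + δ)) = false ∧
      v = (f.x (k + δ + R) - f.x (k + R)) / 2 := by
  by_cases h : ∃ j, fwd σ f.g c j ≠ fwd σ f.g c (f.ag k)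
  · obtain ⟨δ, h1, h2, h3⟩ := f.exists_first _ k h
    rw [hk] at h2 h3
    have h4 := obs_coll_fwd hp h1 hk (by simpa using h2) h3
    rw [hv, Option.some_inj] at h4
    exact ⟨δ, h1, by simpa using h2, h4⟩
  · push Not at h
    rw [obs_coll_none hp (fun i j => by rw [h i, h j])] at hv
    simp at hv

lemma exists_obs_coll_bwd (hp : f.At R p) {k : ℤ} (hk : fwd σ f.g c (f.ag k) = false) {v : ℝ}
    (hv : (obs σ p c (f.ag k)).coll = some v) :
    ∃ δ : ℤ, 0 < δ ∧ fwd σ f.g c (f.ag (k - δ)) = true ∧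
      v = (f.x (k + R) - f.x (k - δ + R)) / 2 := by
  obtain ⟨δ, h1, h2, h3⟩ := exists_obs_coll_fwd (σ := σ) (c := c) hp.mirror (k := -k) (v := v)
    (by simpa [Frame.mirror, fwd_not] using hk) (by simpa [Frame.mirror] using hv)
  refine ⟨δ, h1, ?_, ?_⟩
  · have : -δ + k = k - δ := by ring
    simpa [Frame.mirror, fwd_not, this] using h2
  · simp only [Frame.mirror] at h3
    rw [h3, show -(-k + -R) = k + R by ring, show -(-k + δ + -R) = k - δ + R by ring]
    ring

/-- The distance to the first collision, and `1` if there was none. -/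
def Observation.coll' (o : Observation) : ℝ := o.coll.getD 1

lemma Frame.gap_lt_one (f : Frame n) (hn : 1 < n) (k : ℤ) : f.x (k + 1) - f.x k < 1 := by
  have := f.mono (show k + 1 < k + n by omega)
  rw [f.x_add] at this; linarith

/-- The default value 1 of `coll'` exceeds half of every gap, so a missing collision is never
confused with one at the adjacent agent. -/
lemma obs_coll'_fwd_ge (hn : 1 < n) (hp : f.At R p) {k : ℤ}
    (hk : fwd σ f.g c (f.ag k) = true) :
    (f.x (k + 1 + R) - f.x (k + R)) / 2 ≤ (obs σ p c (f.ag k)).coll' := by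
  have h0 := f.gap_lt_one hn (k + R)
  rw [show k + R + 1 = k + 1 + R by ring] at h0
  have h0' := f.mono (show k + R < k + 1 + R by omega)
  unfold Observation.coll'
  cases hv : (obs σ p c (f.ag k)).coll with
  | none => rw [Option.getD_none]; linarith
  | some v =>
    obtain ⟨δ, h1, h2, h3⟩ := exists_obs_coll_fwd hp hk hv
    have := f.mono.monotone (show k + 1 + R ≤ k + δ + R by omega)
    rw [Option.getD_some]; linarith

/-- This is the one-bit channel between neighbours: once the gap is known, the observed distance
tells in which direction the neighbour started. -/
lemma obs_coll'_fwd_eq_iff (hn : 1 < n) (hp : f.At R p) {k : ℤ}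
    (hk : fwd σ f.g c (f.ag k) = true) :
    (obs σ p c (f.ag k)).coll' = (f.x (k + 1 + R) - f.x (k + R)) / 2 ↔
      fwd σ f.g c (f.ag (k + 1)) = false := by
  constructor
  · have h0 := f.gap_lt_one hn (k + R)
    rw [show k + R + 1 = k + 1 + R by ring] at h0
    have h0' := f.mono (show k + R < k + 1 + R by omega)
    unfold Observation.coll'
    cases hv : (obs σ p c (f.ag k)).coll with
    | none => intro h; rw [Option.getD_none] at h; linarith
    | some v =>
      obtain ⟨δ, h1, h2, h3⟩ := exists_obs_coll_fwd hp hk hv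
      intro h
      rw [Option.getD_some, h3] at h
      have h4 : f.x (k + δ + R) = f.x (k + 1 + R) := by linarith
      have := f.mono.injective h4
      obtain rfl : δ = 1 := by omega
      exact h2
  · intro h
    unfold Observation.coll'
    rw [obs_coll_fwd hp one_pos hk h (fun j h1 h2 => by omega)]; rfl

lemma obs_coll'_bwd_ge (hn : 1 < n) (hp : f.At R p) {k : ℤ}
    (hk : fwd σ f.g c (f.ag k) = false) :
    (f.x (k + R) - f.x (k - 1 + R)) / 2 ≤ (obs σ p c (f.ag k)).coll' := by
  have h := obs_coll'_fwd_ge (σ := σ) (c := c) hn hp.mirror (k := -k)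
    (by simpa [Frame.mirror, fwd_not] using hk)
  simp only [Frame.mirror, neg_neg] at h
  rw [show -(-k + -R) = k + R by ring, show -(-k + 1 + -R) = k - 1 + R by ring] at h
  linarith

lemma obs_coll'_bwd_eq_iff (hn : 1 < n) (hp : f.At R p) {k : ℤ}
    (hk : fwd σ f.g c (f.ag k) = false) :
    (obs σ p c (f.ag k)).coll' = (f.x (k + R) - f.x (k - 1 + R)) / 2 ↔
      fwd σ f.g c (f.ag (k - 1)) = true := by
  have h := obs_coll'_fwd_eq_iff (σ := σ) (c := c) hn hp.mirror (k := -k)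
    (by simpa [Frame.mirror, fwd_not] using hk)
  simp only [Frame.mirror, neg_neg, fwd_not] at h
  rw [show -(-k + -R) = k + R by ring, show -(-k + 1 + -R) = k - 1 + R by ring,
    show -(-k + 1) = k - 1 by ring] at h
  rw [show (f.x (k + R) - f.x (k - 1 + R)) / 2 = (-f.x (k - 1 + R) - -f.x (k + R)) / 2 by ring, h]
  simp

/-! ### Programs -/

/-- A program for one agent: it ends with a result, or it starts a round in some direction (right
if the Boolean is `true`) and goes on depending on the observation. -/
inductive Prog (α : Type) : Type
  | done : α → Prog α
  | act : Bool → (Observation → Prog α) → Prog α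

namespace Prog

variable {α β : Type}

/-- Run a program and then a second one that depends on the result of the first. -/
def bind : Prog α → (α → Prog β) → Prog β
  | done a, k => k a
  | act b h, k => act b fun o => (h o).bind k

instance : Monad Prog where
  pure := done
  bind := bind

/-- One round. -/
def turn (b : Bool) : Prog Observation := act b done

/-- One round followed by the reversed round. -/
def probe (b : Bool) : Prog Observation := do
  let o ← turn b
  let _ ← turn (!b)
  return o

/-- What is left of a program after an observation. -/
def step : Prog α → Observation → Prog α
  | done a, _ => done a
  | act _ h, o => h o

/-- What is left of a program after some observations. -/
def feed (P : Prog α) (l : List Observation) : Prog α := l.foldl step P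

/-- The direction in which a program starts the next round. -/
def next : Prog α → Bool
  | done _ => true
  | act b _ => b

/-- The result of a program that has ended. -/
def result : Prog α → Option α
  | done a => some a
  | act _ _ => none

end Prog

/-- When the agents with senses of direction `σ` start the programs at the positions `p`, all of
them end after exactly `T` rounds, at the positions `p'`, with the results `a`. -/
inductive Runs {n : ℕ} (σ : Fin n → Bool) {α : Type} :
    (Fin n → UnitAddCircle) → (Fin n → Prog α) → ℕ → (Fin n → UnitAddCircle) → (Fin n → α) → Prop
  | done (p : Fin n → UnitAddCircle) (a : Fin n → α) : Runs σ p (fun i => .done (a i)) 0 p a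
  | act (p : Fin n → UnitAddCircle) (c : Fin n → Bool) (k : Fin n → Observation → Prog α) (T : ℕ)
      (p' : Fin n → UnitAddCircle) (a : Fin n → α)
      (h : Runs σ (roundEnd σ p c).pos (fun i => k i (obs σ p c i)) T p' a) :
      Runs σ p (fun i => .act (c i) (k i)) (T + 1) p' a

namespace Runs

variable {α β : Type} {p' p'' : Fin n → UnitAddCircle} {T T' : ℕ}

lemma pure (p : Fin n → UnitAddCircle) (a : Fin n → α) :
    Runs σ p (fun i => (Pure.pure (a i) : Prog α)) 0 p a := Runs.done p a

/-- Composition is possible because all agents end the first program in the same round, so they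
enter the second one together. -/
lemma bind {P : Fin n → Prog α} {a : Fin n → α} (h : Runs σ p P T p' a)
    {k : Fin n → α → Prog β} {b : Fin n → β} (h' : Runs σ p' (fun i => k i (a i)) T' p'' b) :
    Runs σ p (fun i => P i >>= k i) (T + T') p'' b := by
  induction h with
  | done p a => rw [zero_add]; exact h'
  | act p c k₁ T p' a _ ih =>
    rw [show T + 1 + T' = T + T' + 1 by ring]
    exact Runs.act p c (fun i o => (k₁ i o).bind (k i)) _ _ _ (ih h')

lemma turn (p : Fin n → UnitAddCircle) (c : Fin n → Bool) :
    Runs σ p (fun i => Prog.turn (c i)) 1 (roundEnd σ p c).pos (obs σ p c) :=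
  Runs.act p c (fun _ => Prog.done) 0 _ _ (Runs.done _ _)

/-- A round and the reversed one. -/
lemma probe (hp : f.At R p) (c : Fin n → Bool) :
    Runs σ p (fun i => Prog.probe (c i)) 2 p (obs σ p c) := by
  have h := roundEnd_reverse (σ := σ) (c := c) hp
  have h1 := Runs.turn (σ := σ) (roundEnd σ p c).pos fun i => !c i
  rw [h] at h1
  exact (Runs.turn p c).bind (k := fun i o => Prog.turn (!c i) >>= fun _ => Pure.pure o)
    (h1.bind (k := fun i _ => Pure.pure (obs σ p c i)) (Runs.pure p _))

end Runs

/-! ### From programs to algorithms -/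

/-- The algorithm in which the agents execute the given programs. -/
def Algorithm.ofProg (P : ℕ → Bool → ℕ → Prog (Set ℝ)) : Algorithm where
  move N e id l := dir ((P N e id).feed l).next
  output N e id l := ((P N e id).feed l).result

theorem solves_of_runs {N n : ℕ} (net : Network N n) (P : ℕ → Bool → ℕ → Prog (Set ℝ)) {T : ℕ}
    {p' : Fin n → UnitAddCircle} {a : Fin n → Set ℝ}
    (h : Runs net.sense net.pos (fun i => P N (decide (Even n)) (net.ident i)) T p' a)
    (ha : ∀ i, a i = net.othersFrom i) :
    (Algorithm.ofProg P).SolvesLocationDiscovery net T := by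
  set A := Algorithm.ofProg P with hA
  have hfeed : ∀ (Q : Prog (Set ℝ)) l o, Q.feed (l ++ [o]) = (Q.feed l).step o :=
    fun Q l o => List.foldl_append ..
  -- Generalised to an arbitrary round `t` and to the remainders `Q i` of the programs after the
  -- observations made so far, so that the induction on `Runs` applies.
  have key : ∀ (p : Fin n → UnitAddCircle) (Q : Fin n → Prog (Set ℝ)) (T : ℕ)
      (p' : Fin n → UnitAddCircle) (a : Fin n → Set ℝ), Runs net.sense p Q T p' a →
      ∀ t, (A.run net t).1 = p →
        (∀ i, (P N (decide (Even n)) (net.ident i)).feed ((A.run net t).2 i) = Q i) →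
        ∀ i, (∀ s < T, A.outputAt net (t + s) i = none) ∧
          A.outputAt net (t + T) i = some (a i) := by
    intro p Q T p' a hr
    induction hr with
    | done p a =>
      intro t _ hQ i
      refine ⟨fun s hs => by omega, ?_⟩
      show ((P N (decide (Even n)) (net.ident i)).feed ((A.run net t).2 i)).result = _
      rw [hQ]; rfl
    | act p c k T p' a _ ih =>
      intro t hp hQ i
      have hdir : (fun i => startsCw (net.sense i) (A.move N (decide (Even n)) (net.ident i)
          ((A.run net t).2 i))) = fun i => startsCw (net.sense i) (dir (c i)) := by
        ext i
        show startsCw (net.sense i)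
          (dir ((P N (decide (Even n)) (net.ident i)).feed ((A.run net t).2 i)).next) = _
        rw [hQ]; rfl
      have hp1 : (A.run net (t + 1)).1 = (roundEnd net.sense p c).pos := by
        show (Snapshot.finish (A.run net t).1 _).pos = _
        rw [hdir, hp]; rfl
      have hl1 : ∀ i, (A.run net (t + 1)).2 i = (A.run net t).2 i ++ [obs net.sense p c i] := by
        intro i
        show (A.run net t).2 i ++ _ = _
        rw [hdir, hp]; rfl
      have h2 := ih (t + 1) hp1 (fun i => by rw [hl1, hfeed, hQ]; rfl) i
      refine ⟨fun s hs => ?_, by rw [← h2.2]; congr 1; ring⟩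
      cases s with
      | zero =>
        show ((P N (decide (Even n)) (net.ident i)).feed ((A.run net t).2 i)).result = _
        rw [hQ]; rfl
      | succ s =>
        rw [show t + (s + 1) = t + 1 + s by ring]
        exact h2.1 s (by omega)
  intro i
  have := key _ _ _ _ _ h 0 rfl (fun _ => rfl) i
  simpa [ha] using this

end RingNetwork

namespace RingNetwork

variable {n : ℕ} {f h : Frame n} {R : ℤ} {p : Fin n → UnitAddCircle} {σ : Fin n → Bool}
  {c : Fin n → Bool} {i : Fin n}

/-! ### Exchange of information between neighbours -/

/-- The frame `h` is that of the agent `i` at the positions `p`. -/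
structure Frame.Own (h : Frame n) (σ : Fin n → Bool) (p : Fin n → UnitAddCircle) (i : Fin n) :
    Prop where
  g_eq : h.g = σ i
  ag_zero : h.ag 0 = i
  at_zero : h.At 0 p

/-- The right or left neighbour. -/
def Frame.nbr (h : Frame n) (e : Bool) : Fin n := if e then h.ag 1 else h.ag (-1)

/-- Half the distance to the right or left neighbour. -/
def Frame.halfGap (h : Frame n) (e : Bool) : ℝ :=
  if e then (h.x 1 - h.x 0) / 2 else (h.x 0 - h.x (-1)) / 2

/-- The place `k` of the frame as seen from agent `k` in its own orientation. -/
def Frame.own (f : Frame n) (σ : Fin n → Bool) (k : ℤ) : Frame n :=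
  if σ (f.ag k) = f.g then f.shift k else (f.shift k).mirror

lemma Frame.own_own (hp : f.At 0 p) (k : ℤ) : (f.own σ k).Own σ p (f.ag k) := by
  unfold Frame.own
  split_ifs with hg
  · exact ⟨hg.symm, by simp [Frame.shift], hp.shift k⟩
  · refine ⟨?_, by simp [Frame.shift, Frame.mirror], by simpa using (hp.shift k).mirror⟩
    show (!f.g) = σ (f.ag k)
    revert hg; cases f.g <;> cases σ (f.ag k) <;> simp

lemma Frame.own_nbr (k : ℤ) :
    (f.own σ k).nbr true = f.ag (k + 1) ∧ (f.own σ k).nbr false = f.ag (k - 1) ∨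
      (f.own σ k).nbr true = f.ag (k - 1) ∧ (f.own σ k).nbr false = f.ag (k + 1) := by
  unfold Frame.own
  split_ifs with hg
  · left; simp [Frame.nbr, Frame.shift, add_comm, sub_eq_add_neg]
  · right; simp [Frame.nbr, Frame.shift, Frame.mirror, add_comm, sub_eq_add_neg]

lemma Frame.exists_own (hp : f.At 0 p) (σ : Fin n → Bool) (i : Fin n) :
    ∃ h : Frame n, h.Own σ p i := by
  obtain ⟨k, rfl⟩ := f.ag_surj i; exact ⟨_, f.own_own hp k⟩

/-- A round and its reversal, then the same with the opposite direction; the result consists of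
the observations in the round that started right and in the one that started left. -/
def Prog.probeBoth (b : Bool) : Prog (Bool → Observation) := do
  let o ← Prog.probe b
  let o' ← Prog.probe (!b)
  return fun e => if b == e then o else o'

/-- In the round in which an agent starts towards side `e`, the neighbour there starts towards it
precisely when exactly one of the following agrees for the two: the sense of direction, the
transmitted bit. -/
theorem runs_probeBoth (hn : 1 < n) (hp : f.At 0 p) (c : Fin n → Bool) :
    ∃ a : Fin n → Bool → Observation, Runs σ p (fun i => Prog.probeBoth (c i)) 4 p a ∧
      ∀ i h, Frame.Own h σ p i → ∀ e, h.halfGap e ≤ (a i e).coll' ∧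
        ((a i e).coll' = h.halfGap e ↔ (σ (h.nbr e) == σ i) ≠ (c (h.nbr e) == c i)) := by
  refine ⟨_, (Runs.probe hp c).bind (k := fun i o => Prog.probe (!c i) >>= fun o' =>
    pure fun e => if c i == e then o else o')
    ((Runs.probe hp fun i => !c i).bind (k := fun i o' =>
      pure fun e => if c i == e then obs σ p c i else o') (Runs.pure p _)), fun i h hi e => ?_⟩
  obtain ⟨hg, rfl, hh⟩ := hi
  have key : ∀ c : Fin n → Bool, c (h.ag 0) = e →
      h.halfGap e ≤ (obs σ p c (h.ag 0)).coll' ∧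
        ((obs σ p c (h.ag 0)).coll' = h.halfGap e ↔
          (σ (h.nbr e) == σ (h.ag 0)) ≠ (c (h.nbr e) == c (h.ag 0))) := by
    intro c hc
    cases e
    · have h1 : fwd σ h.g c (h.ag 0) = false := by
        unfold fwd; rw [hc, hg]; cases σ (h.ag 0) <;> rfl
      have h2 := obs_coll'_bwd_ge hn hh h1
      have h3 := obs_coll'_bwd_eq_iff hn hh h1
      simp only [zero_sub, add_zero] at h2 h3
      refine ⟨h2, h3.trans ?_⟩
      rw [hc]
      unfold fwd
      rw [hg]
      show _ ↔ (σ (h.ag (-1)) == σ (h.ag 0)) ≠ (c (h.ag (-1)) == false)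
      generalize σ (h.ag 0) = x, σ (h.ag (-1)) = y, c (h.ag (-1)) = z
      revert x y z; decide
    · have h1 : fwd σ h.g c (h.ag 0) = true := by
        unfold fwd; rw [hc, hg]; cases σ (h.ag 0) <;> rfl
      have h2 := obs_coll'_fwd_ge hn hh h1
      have h3 := obs_coll'_fwd_eq_iff hn hh h1
      simp only [zero_add, add_zero] at h2 h3
      refine ⟨h2, h3.trans ?_⟩
      rw [hc]
      unfold fwd
      rw [hg]
      show _ ↔ (σ (h.ag 1) == σ (h.ag 0)) ≠ (c (h.ag 1) == true)
      generalize σ (h.ag 0) = x, σ (h.ag 1) = y, c (h.ag 1) = z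
      revert x y z; decide
  by_cases hc : c (h.ag 0) = e
  · have := key c hc
    simpa [hc] using this
  · have h1 := key (fun i => !c i) (by revert hc; cases c (h.ag 0) <;> cases e <;> simp)
    have h2 : (c (h.ag 0) == e) = false := by simpa using hc
    -- Negating all bits in the second probe does not affect which agents agree.
    have h3 : ∀ a b : Bool, ((!a) == !b) = (a == b) := by decide
    simp only [h3] at h1
    simpa only [h2, Bool.false_eq_true, if_false] using h1

/-- The distances to the two neighbours and whether they have the same sense of direction. -/
structure Link where
  halfGap : Bool → ℝ
  same : Bool → Bool

/-- The link `L` is that of the agent with the frame `h`. -/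
def Link.Correct (L : Link) (σ : Fin n → Bool) (h : Frame n) : Prop :=
  L.halfGap = h.halfGap ∧ ∀ e, L.same e = (σ (h.nbr e) == σ (h.ag 0))

namespace Prog

/-- Measure the distances to the neighbours by means of the `b` lowest bits of `v`. -/
def gaps : ℕ → ℕ → Prog (Bool → ℝ)
  | 0, _ => do
    let o ← probeBoth true
    return fun e => (o e).coll'
  | b + 1, v => do
    let o ← probeBoth (v % 2 == 1)
    let r ← gaps b (v / 2)
    return fun e => min (o e).coll' (r e)

open Classical in
/-- Determine the link to the neighbours. -/
def link (b v : ℕ) : Prog Link := do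
  let r ← gaps b v
  let o ← probeBoth true
  return ⟨r, fun e => decide ((o e).coll' ≠ r e)⟩

open Classical in
/-- Send a bit to the neighbours and receive theirs. -/
def exchange (L : Link) (v : Bool) : Prog (Bool → Bool) := do
  let o ← probeBoth v
  return fun e => (L.same e ^^ decide ((o e).coll' = L.halfGap e)) == v

/-- Send the number consisting of the `b` lowest bits of `v` and receive those of the
neighbours. -/
def exchangeNat (L : Link) : ℕ → ℕ → Prog (Bool → ℕ)
  | 0, _ => return fun _ => 0
  | b + 1, v => do
    let r ← exchange L (v % 2 == 1)
    let q ← exchangeNat L b (v / 2)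
    return fun e => (r e).toNat + 2 * q e

/-- The maximum of the numbers held by the agents up to distance `j`. -/
def flood (L : Link) (b : ℕ) : ℕ → ℕ → Prog ℕ
  | 0, v => return v
  | j + 1, v => do
    let q ← exchangeNat L b v
    flood L b j (max v (max (q true) (q false)))

end Prog

/-- The half gap is a lower bound for all observed distances, and the minimum attains it as soon as
the neighbour once comes closer: in the last probe, where all bits agree, if the senses differ, and
at a bit where the numbers differ if the senses agree. -/
theorem runs_gaps (hn : 1 < n) (hp : f.At 0 p) (b : ℕ) (v : Fin n → ℕ) :
    ∃ a : Fin n → Bool → ℝ, Runs σ p (fun i => Prog.gaps b (v i)) (4 * (b + 1)) p a ∧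
      ∀ i h, Frame.Own h σ p i → ∀ e, h.halfGap e ≤ a i e ∧
        (σ (h.nbr e) ≠ σ i ∨ v (h.nbr e) % 2 ^ b ≠ v i % 2 ^ b → a i e = h.halfGap e) := by
  induction b generalizing v with
  | zero =>
    obtain ⟨o, ho, H⟩ := runs_probeBoth (σ := σ) hn hp fun _ => true
    refine ⟨_, ho.bind (k := fun i o => pure fun e => (o e).coll') (Runs.pure p _),
      fun i h hi e => ⟨(H i h hi e).1, fun hc => (H i h hi e).2.2 ?_⟩⟩
    simp only [pow_zero, Nat.mod_one, ne_eq, not_true_eq_false, or_false] at hc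
    simpa using hc
  | succ b ih =>
    obtain ⟨o, ho, H⟩ := runs_probeBoth (σ := σ) hn hp fun i => v i % 2 == 1
    obtain ⟨r, hr, H'⟩ := ih fun i => v i / 2
    refine ⟨fun i e => min (o i e).coll' (r i e), ?_,
      fun i h hi e => ⟨le_min (H i h hi e).1 (H' i h hi e).1, fun hc => ?_⟩⟩
    · have := ho.bind (k := fun i o => Prog.gaps b (v i / 2) >>= fun r =>
        pure fun e => min (o e).coll' (r e))
        (hr.bind (k := fun i r => pure fun e => min (o i e).coll' (r e)) (Runs.pure p _))
      rwa [show 4 + (4 * (b + 1) + 0) = 4 * (b + 1 + 1) by ring] at this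
    · have h1 := H i h hi e
      have h2 := H' i h hi e
      refine le_antisymm ?_ (le_min h1.1 h2.1)
      by_cases hs : σ (h.nbr e) = σ i
      · have hc' := hc.resolve_left (not_not.2 hs)
        by_cases hb : v (h.nbr e) % 2 = v i % 2
        · refine (min_le_right _ _).trans (h2.2 (Or.inr fun h3 => hc' ?_)).le
          rw [pow_succ', Nat.mod_mul, Nat.mod_mul, h3, hb]
        · refine (min_le_left _ _).trans (h1.2.2 ?_).le
          have h4 := Nat.mod_two_eq_zero_or_one (v (h.nbr e))
          have h5 := Nat.mod_two_eq_zero_or_one (v i)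
          rcases h4 with h4 | h4 <;> rcases h5 with h5 | h5 <;> simp_all
      · exact (min_le_right _ _).trans (h2.2 (Or.inl hs)).le

/-- Distinct identifiers make all half gaps exact. In the additional probe all bits are equal, so a
collision at the half gap means opposite senses. -/
theorem runs_link (hn : 1 < n) (hp : f.At 0 p) (b : ℕ) (v : Fin n → ℕ)
    (hv : Function.Injective v) (hb : ∀ i, v i < 2 ^ b) :
    ∃ a : Fin n → Link, Runs σ p (fun i => Prog.link b (v i)) (4 * (b + 2)) p a ∧
      ∀ i h, Frame.Own h σ p i → (a i).Correct σ h := by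
  classical
  obtain ⟨r, hr, H⟩ := runs_gaps (σ := σ) hn hp b v
  obtain ⟨o, ho, H'⟩ := runs_probeBoth (σ := σ) hn hp fun _ => true
  refine ⟨fun i => ⟨r i, fun e => decide ((o i e).coll' ≠ r i e)⟩, ?_, fun i h hi => ?_⟩
  · have := hr.bind (k := fun i r => Prog.probeBoth true >>= fun o =>
      pure (⟨r, fun e => decide ((o e).coll' ≠ r e)⟩ : Link))
      (ho.bind (k := fun i o => pure (⟨r i, fun e => decide ((o e).coll' ≠ r i e)⟩ : Link))
        (Runs.pure p _))
    rwa [show 4 * (b + 1) + (4 + 0) = 4 * (b + 2) by ring] at this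
  · have h1 : r i = h.halfGap := funext fun e => (H i h hi e).2 <| Or.inr <| by
      rw [Nat.mod_eq_of_lt (hb _), Nat.mod_eq_of_lt (hb _)]
      intro he
      have h3 := hv he
      rw [← hi.ag_zero] at h3
      unfold Frame.nbr at h3
      cases e <;> simp only [if_true, Bool.false_eq_true, if_false] at h3 <;>
        rw [h.ag_eq_iff] at h3 <;>
        · have := Int.eq_zero_of_abs_lt_dvd h3 (by simp; omega)
          omega
    refine ⟨h1, fun e => ?_⟩
    have h2 := (H' i h hi e).2
    show decide ((o i e).coll' ≠ r i e) = _
    rw [h1, hi.ag_zero]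
    simp only [BEq.rfl] at h2
    simp only [ne_eq, h2]
    cases (σ (h.nbr e) == σ i) <;> simp

theorem runs_exchange (hn : 1 < n) (hp : f.At 0 p) {L : Fin n → Link}
    (hL : ∀ i h, Frame.Own h σ p i → (L i).Correct σ h) (v : Fin n → Bool) :
    ∃ a : Fin n → Bool → Bool, Runs σ p (fun i => Prog.exchange (L i) (v i)) 4 p a ∧
      ∀ i h, Frame.Own h σ p i → ∀ e, a i e = v (h.nbr e) := by
  classical
  obtain ⟨o, ho, H⟩ := runs_probeBoth (σ := σ) hn hp v
  refine ⟨_, ho.bind (k := fun i o => pure fun e =>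
    (((L i).same e ^^ decide ((o e).coll' = (L i).halfGap e)) == v i)) (Runs.pure p _),
    fun i h hi e => ?_⟩
  obtain ⟨h1, h2⟩ := hL i h hi
  have h3 := (H i h hi e).2
  simp only [h1, h2, h3, hi.ag_zero]
  generalize σ (h.nbr e) = x, σ i = y, v (h.nbr e) = z, v i = w
  revert x y z w; decide

theorem runs_exchangeNat (hn : 1 < n) (hp : f.At 0 p) {L : Fin n → Link}
    (hL : ∀ i h, Frame.Own h σ p i → (L i).Correct σ h) (b : ℕ) (v : Fin n → ℕ) :
    ∃ a : Fin n → Bool → ℕ, Runs σ p (fun i => Prog.exchangeNat (L i) b (v i)) (4 * b) p a ∧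
      ∀ i h, Frame.Own h σ p i → ∀ e, a i e = v (h.nbr e) % 2 ^ b := by
  induction b generalizing v with
  | zero => exact ⟨fun _ _ => 0, Runs.pure p _, fun i h hi e => by simp [Nat.mod_one]⟩
  | succ b ih =>
    obtain ⟨r, hr, H⟩ := runs_exchange hn hp hL fun i => v i % 2 == 1
    obtain ⟨q, hq, H'⟩ := ih fun i => v i / 2
    refine ⟨fun i e => (r i e).toNat + 2 * q i e, ?_, fun i h hi e => ?_⟩
    · have := hr.bind (k := fun i r => Prog.exchangeNat (L i) b (v i / 2) >>= fun q =>
        pure fun e => (r e).toNat + 2 * q e)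
        (hq.bind (k := fun i q => pure fun e => (r i e).toNat + 2 * q e) (Runs.pure p _))
      rwa [show 4 + (4 * b + 0) = 4 * (b + 1) by ring] at this
    · show (r i e).toNat + 2 * q i e = _
      rw [H i h hi e, H' i h hi e, pow_succ', Nat.mod_mul]
      congr 1
      rcases Nat.mod_two_eq_zero_or_one (v (h.nbr e)) with h4 | h4 <;> simp [h4]

theorem runs_flood (hn : 1 < n) (hp : f.At 0 p) {L : Fin n → Link}
    (hL : ∀ i h, Frame.Own h σ p i → (L i).Correct σ h) (b j : ℕ) (v : Fin n → ℕ)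
    (hb : ∀ i, v i < 2 ^ b) :
    ∃ a : Fin n → ℕ, Runs σ p (fun i => Prog.flood (L i) b j (v i)) (4 * b * j) p a ∧
      (∀ k d : ℤ, |d| ≤ j → v (f.ag (k + d)) ≤ a (f.ag k)) ∧
      ∀ V, (∀ i, v i ≤ V) → ∀ i, a i ≤ V := by
  induction j generalizing v with
  | zero =>
    refine ⟨v, Runs.pure p _, fun k d hd => ?_, fun V hV => hV⟩
    have : d = 0 := by simpa using hd
    simp [this]
  | succ j ih =>
    obtain ⟨q, hq, H⟩ := runs_exchangeNat hn hp hL b v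
    have hq' : ∀ i h, Frame.Own h σ p i → ∀ e, q i e = v (h.nbr e) := fun i h hi e => by
      rw [H i h hi e, Nat.mod_eq_of_lt (hb _)]
    have hqV : ∀ V, (∀ i, v i ≤ V) → ∀ i, max (v i) (max (q i true) (q i false)) ≤ V := by
      intro V hV i
      obtain ⟨h, hi⟩ := Frame.exists_own hp σ i
      rw [hq' i h hi, hq' i h hi]
      exact max_le (hV _) (max_le (hV _) (hV _))
    have h2 : 0 < 2 ^ b := by positivity
    obtain ⟨a, ha, H1, H2⟩ := ih (fun i => max (v i) (max (q i true) (q i false))) fun i => by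
      have := hqV (2 ^ b - 1) (fun i => by have := hb i; omega) i
      omega
    refine ⟨a, ?_, fun k d hd => ?_, fun V hV => H2 V (hqV V hV)⟩
    · have := hq.bind (k := fun i q =>
        Prog.flood (L i) b j (max (v i) (max (q true) (q false)))) ha
      rwa [show 4 * b + 4 * b * j = 4 * b * (j + 1) by ring] at this
    · have hstep : ∀ k e : ℤ, |e| ≤ 1 → v (f.ag (k + e)) ≤
          max (v (f.ag k)) (max (q (f.ag k) true) (q (f.ag k) false)) := by
        intro k e he
        rw [hq' _ _ (f.own_own hp k), hq' _ _ (f.own_own hp k)]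
        rw [abs_le] at he
        obtain rfl | rfl | rfl : e = 0 ∨ e = 1 ∨ e = -1 := by omega
        · simp
        · rcases f.own_nbr (σ := σ) k with ⟨h1, h2⟩ | ⟨h1, h2⟩ <;> rw [h1, h2] <;> simp
        · rcases f.own_nbr (σ := σ) k with ⟨h1, h2⟩ | ⟨h1, h2⟩ <;> rw [h1, h2] <;>
            simp [sub_eq_add_neg]
      push_cast at hd
      rw [abs_le] at hd
      obtain ⟨d', h3, h4⟩ : ∃ d' : ℤ, |d'| ≤ j ∧ |d - d'| ≤ 1 := by
        rcases lt_trichotomy d 0 with h | h | h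
        · exact ⟨d + 1, by rw [abs_le]; omega, by rw [abs_le]; omega⟩
        · exact ⟨d, by rw [abs_le]; omega, by rw [abs_le]; omega⟩
        · exact ⟨d - 1, by rw [abs_le]; omega, by rw [abs_le]; omega⟩
      have h5 := hstep (k + d') (d - d') h4
      rw [show k + d' + (d - d') = k + d by ring] at h5
      exact h5.trans (H1 k d' h3)

end RingNetwork

namespace RingNetwork

variable {n : ℕ} {f h : Frame n} {R : ℤ} {p : Fin n → UnitAddCircle} {σ : Fin n → Bool}
  {c : Fin n → Bool} {i : Fin n}

/-! ### Electing a leader -/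

/-- The sum of the signs (senses of direction with respect to `g`) of the agents in a set. -/
def signSum (σ : Fin n → Bool) (g : Bool) (F : Fin n → Bool) : ℤ :=
  ∑ i, if F i then (if σ i == g then 1 else -1) else 0

lemma rotOf_flip (g : Bool) (F : Fin n → Bool) :
    rotOf σ g (fun i => !F i) = rotOf σ g (fun _ => true) - 2 * signSum σ g F := by
  unfold rotOf rot signSum fwd
  rw [Finset.mul_sum, ← Finset.sum_sub_distrib]
  refine Finset.sum_congr rfl fun i _ => ?_
  show (if (σ i == !F i) == g then (1 : ℤ) else -1) = (if (σ i == true) == g then 1 else -1) -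
    2 * if F i then (if σ i == g then 1 else -1) else 0
  generalize σ i = x, F i = y
  revert x y g; decide

/-- One round, and its reversal, in which all agents except those with `fl = true` start right;
the result is the displacement of the agent. -/
def Prog.spin (fl : Bool) : Prog UnitAddCircle := do
  let o ← Prog.probe (!fl)
  return (o.dist : UnitAddCircle)

/-- The displacement of agent `i` in the round in which exactly the agents in `F` start left. -/
def spinResult (σ : Fin n → Bool) (p : Fin n → UnitAddCircle) (F : Fin n → Bool) (i : Fin n) :
    UnitAddCircle := ((obs σ p (fun i => !F i) i).dist : UnitAddCircle)

lemma runs_spin (hp : f.At R p) (F : Fin n → Bool) :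
    Runs σ p (fun i => Prog.spin (F i)) 2 p (spinResult σ p F) :=
  (Runs.probe hp fun i => !F i).bind (k := fun _ o => pure (o.dist : UnitAddCircle))
    (Runs.pure p _)

/-- The criterion does not involve the agent: all agents reach the same verdict, and therefore take
the same branch of a program. -/
lemma spinResult_eq_iff (hp : f.At 0 p) (F G : Fin n → Bool) (i : Fin n) :
    spinResult σ p F i = spinResult σ p G i ↔
      (n : ℤ) ∣ 2 * (signSum σ f.g F - signSum σ f.g G) := by
  obtain ⟨k, rfl⟩ := f.ag_surj i
  unfold spinResult
  rw [obs_dist hp, obs_dist hp, rotOf_flip, rotOf_flip]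
  set r := rotOf σ f.g fun _ => true
  have h1 : ∀ (b : Bool) (x y z : ℝ), ((sgn b * (x - z) : ℝ) : UnitAddCircle) =
      ((sgn b * (y - z) : ℝ) : UnitAddCircle) ↔ (x : UnitAddCircle) = y := by
    intro b x y z
    cases b
    · rw [sgn_false, neg_one_mul, neg_one_mul, neg_sub, neg_sub, AddCircle.coe_sub,
        AddCircle.coe_sub, sub_right_inj]
    · rw [sgn_true, one_mul, one_mul, AddCircle.coe_sub, AddCircle.coe_sub, sub_left_inj]
  rw [h1, f.coe_x_eq_iff]
  congr! 1
  ring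

namespace Prog

open Classical in
/-- Find a set of identifiers in the list such that the round in which the marked agents in it
start left rotates differently from the round with displacement `D`. -/
def search (D : UnitAddCircle) (m : Bool) (id : ℕ) : List (ℕ → Bool) → Prog (Option (ℕ → Bool))
  | [] => return none
  | F :: l => do
    let E ← spin (m && F id)
    if E = D then search D m id l else return some F

open Classical in
/-- Find `θ` in `[lo, hi)` such that the agent `θ` makes a difference. -/
def bisect (D : UnitAddCircle) (q : Bool) (id : ℕ) : ℕ → ℕ → ℕ → Prog ℕ
  | 0, lo, _ => return lo
  | b + 1, lo, hi => do
    let E ← spin (q && decide (id < (lo + hi) / 2))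
    if E = D then bisect D q id b ((lo + hi) / 2) hi else bisect D q id b lo ((lo + hi) / 2)

open Classical in
/-- Elect a leader, given the link to the neighbours. -/
def elect (fam : List (ℕ → Bool)) (b j : ℕ) (L : Link) (id : ℕ) : Prog (Option ℕ) := do
  let v ← flood L b j id
  let D ← spin false
  let r ← search D (decide (v = id)) id fam
  match r with
  | none => return none
  | some F => do
    let θ ← bisect D (decide (v = id) && F id) id b 0 (2 ^ b)
    return some θ

end Prog

theorem runs_search (hp : f.At 0 p) (m : Fin n → Bool) (id : Fin n → ℕ) (l : List (ℕ → Bool)) :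
    ∃ T ≤ 2 * l.length, ∃ r : Option (ℕ → Bool),
      Runs σ p (fun i => Prog.search (spinResult σ p (fun _ => false) i) (m i) (id i) l) T p
        (fun _ => r) ∧
      (r = none → ∀ F ∈ l, (n : ℤ) ∣ 2 * signSum σ f.g fun i => m i && F (id i)) ∧
      ∀ F, r = some F → ¬ (n : ℤ) ∣ 2 * signSum σ f.g fun i => m i && F (id i) := by
  classical
  have h0 : signSum σ f.g (fun _ => false) = 0 := by simp [signSum]
  induction l with
  | nil => exact ⟨0, le_rfl, none, Runs.pure p _, by simp, by simp⟩
  | cons F l ih =>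
    obtain ⟨T, hT, r, hr, H1, H2⟩ := ih
    have hs := runs_spin (σ := σ) hp fun i => m i && F (id i)
    have he := spinResult_eq_iff (σ := σ) hp (fun i => m i && F (id i)) fun _ => false
    rw [h0, sub_zero] at he
    by_cases hd : (n : ℤ) ∣ 2 * signSum σ f.g fun i => m i && F (id i)
    · refine ⟨2 + T, by simp; omega, r, hs.bind (k := fun i E =>
        if E = spinResult σ p (fun _ => false) i then Prog.search _ (m i) (id i) l
        else pure (some F)) ?_, fun hn G hG => ?_, H2⟩
      · simpa only [he, hd, if_true] using hr
      · rcases List.mem_cons.1 hG with rfl | hG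
        · exact hd
        · exact H1 hn G hG
    · refine ⟨2 + 0, by simp, some F, hs.bind (k := fun i E =>
        if E = spinResult σ p (fun _ => false) i then Prog.search _ (m i) (id i) l
        else pure (some F)) ?_, by simp, fun G hG => ?_⟩
      · simpa only [he, hd, if_false] using Runs.pure p _
      · obtain rfl := Option.some_inj.1 hG; exact hd

/-- The invariant is that the signed count of the marked identifiers below `lo` makes no difference
to the rotation while that below `hi` does. At `hi = lo + 1` the two counts differ, so some agent
must have the identifier `lo`. -/
theorem runs_bisect (hp : f.At 0 p) (q : Fin n → Bool) (id : Fin n → ℕ) (b lo hi : ℕ)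
    (hlt : lo < hi) (hle : hi - lo ≤ 2 ^ b)
    (hlo : (n : ℤ) ∣ 2 * signSum σ f.g fun i => q i && decide (id i < lo))
    (hhi : ¬ (n : ℤ) ∣ 2 * signSum σ f.g fun i => q i && decide (id i < hi)) :
    ∃ θ : ℕ, Runs σ p
        (fun i => Prog.bisect (spinResult σ p (fun _ => false) i) (q i) (id i) b lo hi) (2 * b) p
        (fun _ => θ) ∧ ∃ i, id i = θ := by
  classical
  have h0 : signSum σ f.g (fun _ => false) = 0 := by simp [signSum]
  induction b generalizing lo hi with
  | zero =>
    refine ⟨lo, Runs.pure p _, ?_⟩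
    by_contra hc
    push Not at hc
    obtain rfl : hi = lo + 1 := by simp at hle; omega
    refine hhi ?_
    convert hlo using 6 with i
    have := hc i
    omega
  | succ b ih =>
    have hs := runs_spin (σ := σ) hp fun i => q i && decide (id i < (lo + hi) / 2)
    have he := spinResult_eq_iff (σ := σ) hp
      (fun i => q i && decide (id i < (lo + hi) / 2)) fun _ => false
    rw [h0, sub_zero] at he
    rw [pow_succ] at hle
    rw [show 2 * (b + 1) = 2 + 2 * b by ring]
    by_cases hd : (n : ℤ) ∣ 2 * signSum σ f.g fun i => q i && decide (id i < (lo + hi) / 2)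
    · obtain ⟨θ, hθ, H⟩ := ih ((lo + hi) / 2) hi (by omega) (by omega) hd hhi
      refine ⟨θ, hs.bind (k := fun i E => if E = spinResult σ p (fun _ => false) i then
        Prog.bisect _ (q i) (id i) b ((lo + hi) / 2) hi else
        Prog.bisect _ (q i) (id i) b lo ((lo + hi) / 2)) ?_, H⟩
      simpa only [he, hd, if_true] using hθ
    · have hne : lo ≠ (lo + hi) / 2 := fun h => hd (by rwa [← h])
      obtain ⟨θ, hθ, H⟩ := ih lo ((lo + hi) / 2) (by omega) (by omega) hlo hd
      refine ⟨θ, hs.bind (k := fun i E => if E = spinResult σ p (fun _ => false) i then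
        Prog.bisect _ (q i) (id i) b ((lo + hi) / 2) hi else
        Prog.bisect _ (q i) (id i) b lo ((lo + hi) / 2)) ?_, H⟩
      simpa only [he, hd, if_false] using hθ

/-! ### A family of sets that tells small signed sets from zero -/

/-- The sets of identifiers `x` for which a given bit of a given power of `x` modulo `P` is set. -/
def powerFamily (P m b : ℕ) : List (ℕ → Bool) :=
  (List.range m).flatMap fun e => (List.range b).map fun β => fun x => (x ^ e % P).testBit β

lemma length_powerFamily (P m b : ℕ) : (powerFamily P m b).length = m * b := by
  simp [powerFamily, List.length_flatMap]

lemma sum_testBit (b x : ℕ) (hx : x < 2 ^ b) :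
    ∑ β ∈ Finset.range b, (if x.testBit β then 2 ^ β else 0) = x := by
  induction b generalizing x with
  | zero => simp at hx; simp [hx]
  | succ b ih =>
    rw [Finset.sum_range_succ']
    have h1 := ih (x / 2) (by rw [pow_succ] at hx; omega)
    have h2 : ∀ β, (if x.testBit (β + 1) then 2 ^ (β + 1) else 0) =
        2 * (if (x / 2).testBit β then 2 ^ β else 0) := fun β => by
      rw [Nat.testBit_succ]; split_ifs
      · ring
      · rfl
    rw [Finset.sum_congr rfl fun β _ => h2 β, ← Finset.mul_sum, h1, Nat.testBit_zero]
    rcases Nat.mod_two_eq_zero_or_one x with h | h <;> simp [h] <;> omega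

/-- If all signed counts vanished, recombining the bits would make the signed power sums of the
identifiers vanish modulo `P` for all exponents below `m`. The identifiers are distinct residues, so
the Vandermonde argument forces all signs to be zero modulo `P`, though they are ±1. -/
theorem exists_powerFamily {ι : Type*} {P m b : ℕ} [Fact P.Prime] (hP : P ≤ 2 ^ b)
    (M : Finset ι) (hM : M.Nonempty) (hm : M.card ≤ m) (id : ι → ℕ)
    (hid : Set.InjOn id M) (hlt : ∀ i ∈ M, id i < P) (s : ι → ℤ) (hs : ∀ i, s i = 1 ∨ s i = -1) :
    ∃ F ∈ powerFamily P m b, ∑ i ∈ M, (if F (id i) then s i else 0) ≠ 0 := by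
  by_contra hc
  push Not at hc
  have hP0 : 0 < P := (Fact.out : P.Prime).pos
  have h1 : ∀ e < m, ∑ i ∈ M, s i * ((id i ^ e % P : ℕ) : ℤ) = 0 := by
    intro e he
    have h2 : ∀ i, ((id i ^ e % P : ℕ) : ℤ) =
        ∑ β ∈ Finset.range b, if (id i ^ e % P).testBit β then (2 : ℤ) ^ β else 0 := fun i => by
      have := sum_testBit b (id i ^ e % P) ((Nat.mod_lt _ hP0).trans_le hP)
      conv_lhs => rw [← this]
      push_cast; rfl
    simp_rw [h2, Finset.mul_sum]
    rw [Finset.sum_comm]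
    refine Finset.sum_eq_zero fun β hβ => ?_
    have h3 := hc (fun x => (x ^ e % P).testBit β) (by
      simp only [powerFamily, List.mem_flatMap, List.mem_map, List.mem_range]
      exact ⟨e, he, β, Finset.mem_range.1 hβ, rfl⟩)
    have h4 : ∀ i, s i * (if (id i ^ e % P).testBit β then (2 : ℤ) ^ β else 0) =
        2 ^ β * (if (id i ^ e % P).testBit β then s i else 0) := fun i => by
      split_ifs <;> ring
    rw [Finset.sum_congr rfl fun i _ => h4 i, ← Finset.mul_sum, h3, mul_zero]
  let φ := M.equivFin.symm
  have h2 := Matrix.eq_zero_of_forall_pow_sum_mul_pow_eq_zero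
    (f := fun j : Fin M.card => ((id (φ j) : ℕ) : ZMod P))
    (v := fun j => ((s (φ j) : ℤ) : ZMod P)) ?_ ?_
  · obtain ⟨i, hi⟩ := hM
    have h3 := congrFun h2 (M.equivFin ⟨i, hi⟩)
    simp only [φ, Equiv.symm_apply_apply, Pi.zero_apply] at h3
    rcases hs i with h | h <;> rw [h] at h3 <;> simp at h3
  · intro j j' hj
    have h3 := (ZMod.natCast_eq_natCast_iff' _ _ _).1 hj
    rw [Nat.mod_eq_of_lt (hlt _ (φ j).2), Nat.mod_eq_of_lt (hlt _ (φ j').2)] at h3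
    exact φ.injective (Subtype.ext (hid (φ j).2 (φ j').2 h3))
  · intro e
    have h3 := congrArg (Int.cast : ℤ → ZMod P) (h1 e (lt_of_lt_of_le e.2 hm))
    rw [← Finset.sum_coe_sort, ← Equiv.sum_comp φ] at h3
    push_cast at h3
    rw [← h3]

/-- The marked agents are those with the largest identifier within distance 2k. There are so few of
them when n ≤ 32k² that the power family separates their signed sum from zero, even modulo `n`. A
leader found for larger `n` is genuine as well, because bisection does not use this bound. -/
theorem runs_elect (hn : 1 < n) (hp : f.At 0 p) {L : Fin n → Link}
    (hL : ∀ i h, Frame.Own h σ p i → (L i).Correct σ h) (id : Fin n → ℕ)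
    (hid : Function.Injective id) {b k P : ℕ} (hb : ∀ i, id i < 2 ^ b) [Fact P.Prime]
    (hP : P ≤ 2 ^ (b + 1)) (hlt : ∀ i, id i < P) (hk : 0 < k) (hkn : 2 * k + 1 ≤ n) :
    ∃ T ≤ 8 * b * k + 32 * k * (b + 1) + 2 * b + 2, ∃ r : Option ℕ,
      Runs σ p (fun i => Prog.elect (powerFamily P (16 * k) (b + 1)) b (2 * k) (L i) (id i)) T p
        (fun _ => r) ∧
      (∀ θ, r = some θ → ∃ i, id i = θ) ∧ (n ≤ 32 * k ^ 2 → r ≠ none) := by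
  classical
  obtain ⟨v, hv, H1, H2⟩ := runs_flood hn hp hL b (2 * k) id hb
  obtain ⟨T, hT, r, hr, H3, H4⟩ := runs_search (σ := σ) hp (fun i => decide (v i = id i)) id
    (powerFamily P (16 * k) (b + 1))
  rw [length_powerFamily] at hT
  have hs := runs_spin (σ := σ) hp fun _ => false
  have hself : ∀ i, id i ≤ v i := fun i => by
    obtain ⟨k, rfl⟩ := f.ag_surj i
    simpa using H1 k 0 (by simp)
  have hfin : n ≤ 32 * k ^ 2 → r ≠ none := by
    intro hn32 hnone
    choose κ hκ using f.ag_surj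
    set M : Finset (Fin n) := Finset.univ.filter fun i => v i = id i with hM
    have hMne : M.Nonempty := by
      obtain ⟨i, -, hi⟩ := Finset.exists_max_image Finset.univ id ⟨f.ag 0, Finset.mem_univ _⟩
      refine ⟨i, Finset.mem_filter.2 ⟨Finset.mem_univ _, ?_⟩⟩
      exact le_antisymm (H2 _ (fun j => hi j (Finset.mem_univ _)) i) (hself i)
    -- The stretches of 2k + 1 places starting at marked agents are disjoint: otherwise two marked
    -- agents within distance 2k would each have the larger identifier.
    have hcard : M.card * (2 * k + 1) ≤ n := by
      have h1 : (M ×ˢ Finset.range (2 * k + 1)).card ≤ (Finset.univ : Finset (Fin n)).card := by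
        refine Finset.card_le_card_of_injOn (fun q => f.ag (κ q.1 + (q.2 : ℕ)))
          (fun _ _ => Finset.mem_coe.2 (Finset.mem_univ _)) ?_
        rintro ⟨i, j⟩ hij ⟨i', j'⟩ hij' he
        simp only [hM, Finset.coe_product, Set.mem_prod, Finset.mem_coe, Finset.mem_filter,
          Finset.mem_univ, true_and, Finset.mem_range] at hij hij' he
        have h2 : ∀ i i' j j', f.ag (κ i + (j : ℕ)) = f.ag (κ i' + (j' : ℕ)) →
            j < 2 * k + 1 → j' < 2 * k + 1 → id i' ≤ v i := by
          intro i i' j j' he hj hj'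
          have h3 : f.ag (κ i + (j - j' : ℤ)) = i' := by
            rw [← hκ i', f.ag_eq_iff]
            rw [f.ag_eq_iff] at he
            convert he using 1; ring
          have := H1 (κ i) (j - j') (by rw [abs_le]; push_cast; omega)
          rwa [h3, hκ] at this
        have h3 := h2 i i' j j' he hij.2 hij'.2
        have h4 := h2 i' i j' j he.symm hij'.2 hij.2
        have h5 : i = i' := hid (by omega)
        subst h5
        rw [f.ag_eq_iff] at he
        have h6 := Int.eq_zero_of_abs_lt_dvd he (by rw [abs_lt]; omega)
        have : j = j' := by omega
        rw [this]
      simpa using h1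
    have hM16 : M.card ≤ 16 * k := by
      by_contra hc
      have : (16 * k + 1) * (2 * k + 1) ≤ M.card * (2 * k + 1) :=
        Nat.mul_le_mul_right _ (by omega)
      nlinarith
    obtain ⟨F, hF, hF'⟩ := exists_powerFamily (b := b + 1) hP M hMne hM16 id hid.injOn
      (fun i _ => hlt i) (fun i => if σ i == f.g then 1 else -1) (fun i => by split_ifs <;> simp)
    have h1 := H3 hnone F hF
    have h2 : signSum σ f.g (fun i => decide (v i = id i) && F (id i)) =
        ∑ i ∈ M, (if F (id i) then (if σ i == f.g then 1 else -1) else 0) := by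
      unfold signSum
      rw [hM, Finset.sum_filter]
      refine Finset.sum_congr rfl fun i _ => ?_
      by_cases h : v i = id i <;> simp [h]
    rw [h2] at h1
    have h3 : |∑ i ∈ M, (if F (id i) then (if σ i == f.g then (1 : ℤ) else -1) else 0)| ≤
        M.card := by
      refine (Finset.abs_sum_le_sum_abs _ _).trans ?_
      rw [Finset.card_eq_sum_ones, Nat.cast_sum]
      refine Finset.sum_le_sum fun i _ => ?_
      split_ifs <;> simp
    refine hF' ?_
    -- From 2k + 1 ≥ 3: twice the signed sum is then less than `n` in absolute value, so
    -- divisibility by `n` would make it zero.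
    have h4 : M.card * 3 ≤ n := le_trans (Nat.mul_le_mul_left _ (by omega)) hcard
    have h5 := M.card_pos.2 hMne
    have h6 := Int.eq_zero_of_abs_lt_dvd h1 (by
      rw [abs_mul, show |(2 : ℤ)| = 2 from rfl]; omega)
    omega
  cases hr' : r with
  | none =>
    rw [hr'] at hr hfin
    refine ⟨4 * b * (2 * k) + (2 + (T + 0)), by nlinarith, none, ?_, by simp, fun h => absurd rfl (hfin h)⟩
    exact hv.bind (hs.bind (hr.bind (Runs.pure p _)))
  | some F =>
    rw [hr'] at hr hfin
    have h1 := H4 F hr'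
    obtain ⟨θ, hθ, hex⟩ := runs_bisect (σ := σ) hp (fun i => decide (v i = id i) && F (id i)) id b 0
      (2 ^ b) (by positivity) (by simp) (by simp [signSum]) (by simpa [hb] using h1)
    refine ⟨4 * b * (2 * k) + (2 + (T + (2 * b + 0))), by nlinarith, some θ, ?_,
      by simpa using hex, by simp⟩
    exact hv.bind (hs.bind (hr.bind (hθ.bind (Runs.pure p _))))

end RingNetwork

namespace RingNetwork

variable {n : ℕ} {f h : Frame n} {R : ℤ} {p : Fin n → UnitAddCircle} {σ : Fin n → Bool}
  {c : Fin n → Bool} {i : Fin n}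

/-! ### Agreement on the leader's orientation -/

open Classical in
/-- Decide whether the leader has the same sense of direction. -/
def Prog.orient (b id : ℕ) (L : Link) (isLeader : Bool) : Prog Bool := do
  let o ← Prog.turn true
  let o' ← Prog.turn isLeader
  let r ← Prog.gaps b id
  let _ ← Prog.turn (!isLeader)
  let _ ← Prog.turn (!true)
  return decide ((o.dist : UnitAddCircle) + (o'.dist : UnitAddCircle) =
    ((2 * L.halfGap true + 2 * r false : ℝ) : UnitAddCircle))

/-- Every agent but `l` starts right in one round and left in the other and cancels out; only `l`
counts twice. -/
lemma rotOf_leader (g : Bool) (l : Fin n) :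
    rotOf σ g (fun _ => true) + rotOf σ g (fun i => decide (i = l)) =
      2 * if σ l == g then 1 else -1 := by
  unfold rotOf rot
  rw [← Finset.sum_add_distrib, Finset.sum_eq_single l]
  · show (if (σ l == true) == g then (1 : ℤ) else -1) +
      (if (σ l == decide (l = l)) == g then 1 else -1) = _
    rw [decide_eq_true rfl]
    generalize σ l = x
    revert x g; decide
  · intro i _ hi
    show (if (σ i == true) == g then (1 : ℤ) else -1) +
      (if (σ i == decide (i = l)) == g then 1 else -1) = _
    rw [decide_eq_false hi]
    generalize σ i = x
    revert x g; decide
  · simp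

/-- After the two rounds the agents have rotated by two places in the leader's sense. If that is the
agent's own right, its displacement is its former right gap plus its present left gap; otherwise it
is not, even modulo a full turn. -/
theorem runs_orient (hn : 4 < n) (hp : f.At 0 p) {L : Fin n → Link}
    (hL : ∀ i h, Frame.Own h σ p i → (L i).Correct σ h) (id : Fin n → ℕ)
    (hid : Function.Injective id) {b : ℕ} (hb : ∀ i, id i < 2 ^ b) (l : Fin n) :
    Runs σ p (fun i => Prog.orient b (id i) (L i) (decide (i = l))) (4 * (b + 2)) p
      (fun i => σ l == σ i) := by
  classical
  set c₁ : Fin n → Bool := fun _ => true with hc₁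
  set c₂ : Fin n → Bool := fun i => decide (i = l) with hc₂
  set p₁ := (roundEnd σ p c₁).pos with hp₁
  set p₂ := (roundEnd σ p₁ c₂).pos with hp₂
  have h₁ : f.At _ p₁ := roundEnd_at hp
  have h₂ : f.At _ p₂ := roundEnd_at h₁
  obtain ⟨r, hr, H⟩ := runs_gaps (σ := σ) (by omega) h₂.rotate b id
  have t₁ := Runs.turn (σ := σ) p c₁
  have t₂ := Runs.turn (σ := σ) p₁ c₂
  have t₃ := Runs.turn (σ := σ) p₂ fun i => !c₂ i
  have t₄ := Runs.turn (σ := σ) p₁ fun i => !c₁ i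
  rw [hp₂, roundEnd_reverse h₁, ← hp₂] at t₃
  rw [hp₁, roundEnd_reverse hp, ← hp₁] at t₄
  have hres : (fun i => decide (((obs σ p c₁ i).dist : UnitAddCircle) +
      ((obs σ p₁ c₂ i).dist : UnitAddCircle) =
        ((2 * (L i).halfGap true + 2 * r i false : ℝ) : UnitAddCircle))) =
      fun i => σ l == σ i := by
    funext i
    obtain ⟨h, hi⟩ := Frame.exists_own hp σ i
    have h1 : h.At _ p₁ := roundEnd_at hi.at_zero
    have h2 : h.At _ p₂ := roundEnd_at h1
    have d₁ := obs_dist (σ := σ) (c := c₁) hi.at_zero 0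
    have d₂ := obs_dist (σ := σ) (c := c₂) h1 0
    have hrot := rotOf_leader (σ := σ) h.g l
    set s : ℤ := if σ l == h.g then 1 else -1 with hs
    rw [add_assoc, hrot, zero_add] at h2
    rw [hi.ag_zero, hi.g_eq, BEq.rfl, sgn_true, one_mul, ← hi.g_eq, zero_add, zero_add] at d₁ d₂
    rw [hrot] at d₂
    have hown : (h.rotate (2 * s)).Own σ p₂ i := ⟨hi.g_eq, hi.ag_zero, h2.rotate⟩
    have hg := (H i _ hown false).2 (Or.inr (by
      rw [Nat.mod_eq_of_lt (hb _), Nat.mod_eq_of_lt (hb _)]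
      intro he
      have h3 := hid he
      rw [← hi.ag_zero] at h3
      have h4 : h.ag (-1) = h.ag 0 := h3
      rw [h.ag_eq_iff] at h4
      have := Int.eq_zero_of_abs_lt_dvd h4 (by simp; omega)
      omega))
    have e1 : r i false = (h.x (2 * s) - h.x (2 * s - 1)) / 2 := by
      rw [hg]
      show (h.x (0 + 2 * s) - h.x (-1 + 2 * s)) / 2 = _
      rw [zero_add, show -1 + 2 * s = 2 * s - 1 by ring]
    have e2 : (L i).halfGap true = (h.x 1 - h.x 0) / 2 := by rw [(hL i h hi).1]; rfl
    rw [d₁, d₂, e1, e2, ← AddCircle.coe_add,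
      show h.x (rotOf σ h.g c₁) - h.x 0 + (h.x (2 * s) - h.x (rotOf σ h.g c₁)) =
        h.x 1 + (h.x (2 * s) - h.x 0 - h.x 1) by ring,
      show 2 * ((h.x 1 - h.x 0) / 2) + 2 * ((h.x (2 * s) - h.x (2 * s - 1)) / 2) =
        (h.x 1 - h.x (2 * s - 1)) + h.x 1 + (h.x (2 * s) - h.x 0 - h.x 1) by ring,
      AddCircle.coe_add, AddCircle.coe_add, AddCircle.coe_add]
    simp only [add_left_inj]
    have e3 : ((h.x 1 : ℝ) : UnitAddCircle) = ((h.x 1 - h.x (2 * s - 1) : ℝ) : UnitAddCircle) +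
        ((h.x 1 : ℝ) : UnitAddCircle) ↔
        ((h.x 1 : ℝ) : UnitAddCircle) = ((h.x (2 * s - 1) : ℝ) : UnitAddCircle) := by
      rw [eq_comm, add_eq_right, AddCircle.coe_sub, sub_eq_zero]
    have e4 : (n : ℤ) ∣ 2 * s - 1 - 1 ↔ (σ l == σ i) = true := by
      rw [hi.g_eq] at hs
      by_cases hsl : (σ l == σ i) = true
      · rw [if_pos hsl] at hs
        rw [hs]; simpa using hsl
      · rw [if_neg hsl] at hs
        rw [hs]
        refine ⟨fun hd => ?_, fun h => absurd h hsl⟩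
        -- For opposite senses the two places to be compared differ by 4; here n > 4 is needed.
        have := Int.eq_zero_of_abs_lt_dvd hd (by norm_num; omega)
        omega
    simp only [e3, h.coe_x_eq_iff, e4]
    rw [Bool.eq_iff_iff, decide_eq_true_iff]
  have := t₁.bind (k := fun i o => Prog.turn (c₂ i) >>= fun o' => Prog.gaps b (id i) >>= fun r =>
      Prog.turn (!c₂ i) >>= fun _ => Prog.turn (!true) >>= fun _ =>
      pure (decide ((o.dist : UnitAddCircle) + (o'.dist : UnitAddCircle) =
    ((2 * (L i).halfGap true + 2 * r false : ℝ) : UnitAddCircle))))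
    (t₂.bind (hr.bind (t₃.bind (t₄.bind (Runs.pure p _)))))
  rw [hres, show 1 + (1 + (4 * (b + 1) + (1 + (1 + 0)))) = 4 * (b + 2) by ring] at this
  exact this

/-! ### The places after the leader -/

/-- The place `m` as seen from agent `a`, in its own orientation. -/
def Frame.rel (f : Frame n) (σ : Fin n → Bool) (a m : ℤ) : UnitAddCircle :=
  ((sgn (σ (f.ag a) == f.g) * (f.x m - f.x a) : ℝ) : UnitAddCircle)

lemma Frame.rel_eq_iff (a m m' : ℤ) : f.rel σ a m = f.rel σ a m' ↔ (n : ℤ) ∣ m - m' := by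
  rw [dvd_sub_comm, ← f.coe_x_eq_iff]
  unfold Frame.rel
  cases σ (f.ag a) == f.g
  · rw [sgn_false, neg_one_mul, neg_one_mul, neg_sub, neg_sub, AddCircle.coe_sub,
      AddCircle.coe_sub, sub_right_inj]
  · rw [sgn_true, one_mul, one_mul, AddCircle.coe_sub, AddCircle.coe_sub, sub_left_inj]

@[simp] lemma Frame.rel_self (a : ℤ) : f.rel σ a a = 0 := by simp [Frame.rel]

lemma Frame.rel_add (a m m' : ℤ) : f.rel σ a m +
    ((sgn (σ (f.ag a) == f.g) * (f.x m' - f.x m) : ℝ) : UnitAddCircle) = f.rel σ a m' := by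
  unfold Frame.rel
  rw [← AddCircle.coe_add]; congr 1; ring

lemma Frame.rel_eq_rel (a : ℤ) {m m' : ℤ} (h : f.ag m = f.ag m') : f.rel σ a m = f.rel σ a m' := by
  rw [Frame.rel_eq_iff, dvd_sub_comm, ← f.ag_eq_iff, h]

/-- The flag `e` says whether the agent agrees with the orientation `g`; it can then start forward
or backward at will. -/
lemma fwd_flag (g : Bool) (b : Fin n → Bool) (i : Fin n) :
    fwd σ g (fun i => (σ i == g) == b i) i = b i := by
  show ((σ i == ((σ i == g) == b i)) == g) = b i
  generalize σ i = x, b i = y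
  revert x y g; decide

lemma rotOf_flag (g : Bool) (b : Fin n → Bool) :
    rotOf σ g (fun i => (σ i == g) == b i) = rot b := by
  unfold rotOf; congr 1; ext i; exact fwd_flag g b i

lemma exists_obs_coll'_fwd (hp : f.At R p) {a : ℤ} (ha : fwd σ f.g c (f.ag a) = true)
    (hex : ∃ j, fwd σ f.g c j = false) :
    ∃ δ : ℤ, 0 < δ ∧ fwd σ f.g c (f.ag (a + δ)) = false ∧
      (obs σ p c (f.ag a)).coll' = (f.x (a + δ + R) - f.x (a + R)) / 2 := by
  obtain ⟨j, hj⟩ := hex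
  obtain ⟨δ, h1, h2, h3⟩ := f.exists_first (fwd σ f.g c) a ⟨j, by rw [hj, ha]; simp⟩
  rw [ha] at h2 h3
  refine ⟨δ, h1, by simpa using h2, ?_⟩
  unfold Observation.coll'
  rw [obs_coll_fwd hp h1 ha (by simpa using h2) h3]; rfl

lemma exists_obs_coll'_bwd (hp : f.At R p) {a : ℤ} (ha : fwd σ f.g c (f.ag a) = false)
    (hex : ∃ j, fwd σ f.g c j = true) :
    ∃ δ : ℤ, 0 < δ ∧ fwd σ f.g c (f.ag (a - δ)) = true ∧
      (obs σ p c (f.ag a)).coll' = (f.x (a + R) - f.x (a - δ + R)) / 2 := by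
  obtain ⟨δ, h1, h2, h3⟩ := exists_obs_coll'_fwd (σ := σ) (c := c) hp.mirror (a := -a)
    (by simpa [Frame.mirror, fwd_not] using ha) (by simpa [Frame.mirror, fwd_not] using hex)
  refine ⟨δ, h1, ?_, ?_⟩
  · have : -δ + a = a - δ := by ring
    simpa [Frame.mirror, fwd_not, this] using h2
  · simp only [Frame.mirror, neg_neg] at h3
    rw [h3, show -(-a + -R) = a + R by ring, show -(-a + δ + -R) = a - δ + R by ring]
    ring

/-- What the agents see when a single one starts forward. -/
lemma obs_single (hp : f.At R p) (j a : ℤ) (ha : f.ag a ≠ f.ag j) :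
    f.rel σ a (a + R) + ((sgn (σ (f.ag a) == f.g) *
      -(2 * (obs σ p (fun i => (σ i == f.g) == decide (i = f.ag j)) (f.ag a)).coll') : ℝ) :
        UnitAddCircle) = f.rel σ a (j + R) := by
  obtain ⟨δ, h1, h2, h3⟩ := exists_obs_coll'_bwd (σ := σ)
    (c := fun i => (σ i == f.g) == decide (i = f.ag j)) hp (a := a)
    (by rw [fwd_flag f.g fun i => decide (i = f.ag j)]; simpa using ha)
    ⟨f.ag j, by rw [fwd_flag f.g fun i => decide (i = f.ag j)]; simp⟩
  rw [fwd_flag f.g fun i => decide (i = f.ag j), decide_eq_true_iff] at h2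
  have h4 : f.ag (a - δ + R) = f.ag (j + R) := by
    rw [f.ag_eq_iff] at h2 ⊢; convert h2 using 1; ring
  rw [← f.rel_eq_rel a h4, ← f.rel_add a (a + R) (a - δ + R), h3,
    show -(2 * ((f.x (a + R) - f.x (a - δ + R)) / 2)) = f.x (a - δ + R) - f.x (a + R) by ring]

lemma Frame.own_halfGap (a : ℤ) :
    (f.own σ a).halfGap (!(σ (f.ag a) == f.g)) = (f.x a - f.x (a - 1)) / 2 := by
  unfold Frame.own
  split_ifs with hg
  · simp [Frame.halfGap, Frame.shift, hg, sub_eq_add_neg, add_comm]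
  · have : (σ (f.ag a) == f.g) = false := by simpa using hg
    rw [this]
    simp [Frame.halfGap, Frame.shift, Frame.mirror, sub_eq_add_neg, add_comm]

/-- The sequence `z, P 0, P 1, …`. -/
def seqCons {α : Type*} (z : α) (P : ℕ → α) : ℕ → α
  | 0 => z
  | j + 1 => P j

open Classical in
/-- Learn the positions of the next `w` places, starting with that of the marked agent; `e` says
whether the agent agrees with the orientation of the leader and `g` is half the distance to the
agent before it. -/
def Prog.window (e : Bool) (g : ℝ) : ℕ → Bool → Prog (ℕ → UnitAddCircle)
  | 0, _ => return fun _ => 0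
  | w + 1, me => do
    let o ← Prog.probe (e == me)
    let P ← Prog.window e g w (!me && decide (o.coll' = g))
    return seqCons (if me then 0 else ((sgn e * -(2 * o.coll') : ℝ) : UnitAddCircle)) P

/-- When only the marked agent starts forward, every other agent first collides halfway to it and so
learns its place. The one that sees this at half its own gap is its successor, which takes over the
mark. -/
theorem runs_window (hn : 1 < n) (hp : f.At 0 p) {L : Fin n → Link}
    (hL : ∀ i h, Frame.Own h σ p i → (L i).Correct σ h) (w : ℕ) (j₀ : ℤ) :
    ∃ P : Fin n → ℕ → UnitAddCircle, Runs σ p (fun i => Prog.window (σ i == f.g)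
        ((L i).halfGap (!(σ i == f.g))) w (decide (i = f.ag j₀))) (2 * w) p P ∧
      ∀ a, ∀ j < w, P (f.ag a) j = f.rel σ a (j₀ + j) := by
  classical
  induction w generalizing j₀ with
  | zero => exact ⟨fun _ _ => 0, Runs.pure p _, fun a j hj => by omega⟩
  | succ w ih =>
    obtain ⟨P, hP, H⟩ := ih (j₀ + 1)
    set c : Fin n → Bool := fun i => (σ i == f.g) == decide (i = f.ag j₀) with hc
    have hpr := Runs.probe (σ := σ) hp c
    have hne : ∀ a, f.ag a = f.ag (a + 1) → False := fun a ha => by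
      rw [f.ag_eq_iff] at ha
      have := Int.eq_zero_of_abs_lt_dvd ha (by rw [abs_lt]; omega)
      omega
    have hme : (fun i => !decide (i = f.ag j₀) &&
        decide ((obs σ p c i).coll' = (L i).halfGap (!(σ i == f.g)))) =
        fun i => decide (i = f.ag (j₀ + 1)) := by
      funext i
      obtain ⟨a, rfl⟩ := f.ag_surj i
      by_cases ha : f.ag a = f.ag j₀
      · have : ¬ f.ag a = f.ag (j₀ + 1) := fun h => hne j₀ (ha.symm.trans h)
        simp [ha] at this ⊢
        exact this
      · have hf : fwd σ f.g c (f.ag a) = false := by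
          rw [hc, fwd_flag f.g fun i => decide (i = f.ag j₀)]; simpa using ha
        have h1 := obs_coll'_bwd_eq_iff hn hp hf
        rw [hc, fwd_flag f.g fun i => decide (i = f.ag j₀), add_zero, add_zero, ← hc,
          decide_eq_true_iff] at h1
        rw [(hL _ _ (f.own_own hp a)).1, f.own_halfGap]
        simp only [h1, ha, decide_false, Bool.not_false, Bool.true_and]
        have h2 : f.ag (a - 1) = f.ag j₀ ↔ f.ag a = f.ag (j₀ + 1) := by
          rw [f.ag_eq_iff, f.ag_eq_iff, show j₀ - (a - 1) = j₀ + 1 - a by ring]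
        simp only [h2]
    refine ⟨fun i => seqCons (if decide (i = f.ag j₀) then 0 else
        ((sgn (σ i == f.g) * -(2 * (obs σ p c i).coll') : ℝ) : UnitAddCircle)) (P i),
      ?_, fun a j hj => ?_⟩
    · have hP' : Runs σ p (fun i => Prog.window (σ i == f.g) ((L i).halfGap (!(σ i == f.g))) w
          (!decide (i = f.ag j₀) &&
            decide ((obs σ p c i).coll' = (L i).halfGap (!(σ i == f.g))))) (2 * w) p P := by
        have : ∀ i, (!decide (i = f.ag j₀) &&
            decide ((obs σ p c i).coll' = (L i).halfGap (!(σ i == f.g)))) =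
            decide (i = f.ag (j₀ + 1)) := congrFun hme
        simpa only [this] using hP
      have := hpr.bind (k := fun i o => Prog.window (σ i == f.g) ((L i).halfGap (!(σ i == f.g))) w
          (!decide (i = f.ag j₀) && decide (o.coll' = (L i).halfGap (!(σ i == f.g)))) >>= fun P =>
          pure (seqCons (if decide (i = f.ag j₀) then 0 else
            ((sgn (σ i == f.g) * -(2 * o.coll') : ℝ) : UnitAddCircle)) P))
        (hP'.bind (Runs.pure p _))
      rw [show 2 + (2 * w + 0) = 2 * (w + 1) by ring] at this
      exact this
    · cases j with
      | zero =>
        show (if decide (f.ag a = f.ag j₀) then 0 else _) = f.rel σ a (j₀ + (0 : ℕ))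
        rw [Nat.cast_zero, add_zero]
        split_ifs with h1
        · rw [decide_eq_true_iff] at h1
          rw [← f.rel_eq_rel a h1, f.rel_self]
        · rw [decide_eq_true_iff] at h1
          have := obs_single (σ := σ) hp j₀ a h1
          simp only [add_zero, f.rel_self, zero_add] at this
          exact this
      | succ j =>
        show P (f.ag a) j = _
        rw [H a j (by omega)]; congr 1; push_cast; ring

end RingNetwork

namespace RingNetwork

variable {n : ℕ} {f h : Frame n} {R : ℤ} {p : Fin n → UnitAddCircle} {σ : Fin n → Bool}
  {c : Fin n → Bool} {i : Fin n}

/-! ### Walking once around the circle -/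

lemma Frame.At.of_dvd {R' : ℤ} (hp : f.At R p) (hd : (n : ℤ) ∣ R' - R) : f.At R' p := by
  obtain ⟨m, hm⟩ := hd
  intro k
  rw [hp k, show k + R' = k + R + m * n by linarith, f.x_add_mul]
  cases f.g <;> simp

lemma Frame.ag_emod (f : Frame n) (a : ℤ) : f.ag (a % n) = f.ag a := by
  rw [f.ag_eq_iff]
  exact (Int.mod_modEq a n).dvd

lemma sum_ite_lt {u b : ℕ} (h : u ≤ b) :
    ∑ m ∈ Finset.range b, (if m < u then (1 : ℤ) else -1) = 2 * u - b := by
  obtain ⟨v, rfl⟩ := Nat.exists_eq_add_of_le h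
  rw [Finset.sum_range_add, Finset.sum_congr rfl fun m hm => if_pos (Finset.mem_range.1 hm),
    Finset.sum_congr rfl fun m _ => if_neg (show ¬ u + m < u by omega)]
  simp; ring

open Classical in
/-- The least index below `w` at which the sequence takes the value `z`. -/
def lookup (P : ℕ → UnitAddCircle) (w : ℕ) (z : UnitAddCircle) : Option ℕ :=
  if h : ∃ j, j < w ∧ P j = z then some (Nat.find h) else none

/-- As w ≤ n, the first `w` places are distinct, so a position determines its index. -/
lemma lookup_rel (hn : 0 < n) {a : ℤ} {P : ℕ → UnitAddCircle} {w : ℕ} (hw : w ≤ n)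
    (hP : ∀ j < w, P j = f.rel σ a j) (m : ℤ) :
    lookup P w (f.rel σ a m) = if m % n < w then some (m % n).toNat else none := by
  have h0 := Int.emod_nonneg m (show (n : ℤ) ≠ 0 by omega)
  have h1 := Int.emod_lt_of_pos m (show (0 : ℤ) < n by omega)
  have key : ∀ j, j < w ∧ P j = f.rel σ a m ↔ j < w ∧ m % n = j := by
    intro j
    refine and_congr_right fun hj => ?_
    rw [hP j hj, f.rel_eq_iff, ← Int.modEq_iff_dvd, Int.ModEq,
      Int.emod_eq_of_lt (a := (j : ℤ)) (by omega) (by omega)]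
  unfold lookup
  simp only [key]
  split_ifs with h h' h'
  · rw [Option.some_inj]
    have := (Nat.find_spec h).2
    omega
  · obtain ⟨j, hj⟩ := h; omega
  · exact absurd ⟨(m % n).toNat, by omega, by omega⟩ h
  · rfl

open Classical in
/-- Rotate by `2 * k` places in each round until the leader is back among the first `2 * k` places,
whose positions are given by `P`; the result consists of the number of agents and the number of
the own place, or it is `none` if the leader does not come back in time. -/
def Prog.walk (e me : Bool) (k : ℕ) (P : ℕ → UnitAddCircle) :
    ℕ → ℕ → UnitAddCircle → ℤ → Prog (Option (ℕ × ℤ))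
  | 0, _, _, _ => return none
  | t + 1, q, Δ, off => do
    let o ← Prog.turn (e == decide (∃ j < k, P j = 0))
    let o' ← Prog.probe (e == me)
    let Δ' : UnitAddCircle := Δ + (o.dist : UnitAddCircle)
    let off' : ℤ := (lookup P (2 * k) Δ').elim off fun j => j - (2 * k * (q + 1) : ℕ)
    let r ← (lookup P (2 * k)
        (if me then Δ' else Δ' + ((sgn e * -(2 * o'.coll') : ℝ) : UnitAddCircle))).elim
      (Prog.walk e me k P t (q + 1) Δ' off') fun j => return some (2 * k * (q + 1) - j, off')
    let _ ← Prog.turn (!(e == decide (∃ j < k, P j = 0)))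
    return r

/-- After q + 1 rotations the leader stands at place 2k(q + 1). It reappears at a place `j` among
the first 2k as soon as this number is at least `n`, and then n = 2k(q + 1) - j. Likewise an agent
recognises its own place when it comes into this window; the second alternative in `hoff` says that
it has not been there yet. -/
theorem runs_walk (hn : 0 < n) {k : ℕ} (hkn : 2 * k ≤ n) {P : Fin n → ℕ → UnitAddCircle}
    (hP : ∀ a, ∀ j < 2 * k, P (f.ag a) j = f.rel σ a j) (t q : ℕ) (hq : 2 * k * q < n)
    (hp : f.At (2 * k * q : ℕ) p) (Δ : Fin n → UnitAddCircle)
    (hΔ : ∀ a, Δ (f.ag a) = f.rel σ a (a + (2 * k * q : ℕ))) (off : Fin n → ℤ)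
    (hoff : ∀ a, (n : ℤ) ∣ off (f.ag a) - a ∨
      ∀ q' ≤ q, ¬ (a + (2 * k * q' : ℕ)) % (n : ℤ) < (2 * k : ℕ)) :
    ∃ T ≤ 4 * t, ∃ r : Fin n → Option (ℕ × ℤ),
      Runs σ p (fun i => Prog.walk (σ i == f.g) (decide (i = f.ag 0)) k (P i) t q (Δ i) (off i))
        T p r ∧
      ((r = fun _ => none) ∧ 2 * k * (q + t) < n ∨ ∃ off' : Fin n → ℤ,
        (r = fun i => some (n, off' i)) ∧ n ≤ 2 * k * (q + t) ∧
          ∀ a, (n : ℤ) ∣ off' (f.ag a) - a) := by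
  classical
  induction t generalizing q p Δ off with
  | zero => exact ⟨0, le_rfl, _, Runs.pure p _, Or.inl ⟨rfl, by simpa using hq⟩⟩
  | succ t ih =>
    set S : Fin n → Bool := fun i => decide (∃ j < k, P i j = 0) with hS
    set c : Fin n → Bool := fun i => (σ i == f.g) == S i with hc
    set c' : Fin n → Bool := fun i => (σ i == f.g) == decide (i = f.ag 0) with hc'
    have hSa : ∀ m : ℕ, m < n → (S (f.ag m) = true ↔ m < k) := by
      intro m hm
      rw [hS, decide_eq_true_iff]
      have : ∀ j < k, P (f.ag m) j = 0 ↔ j = m := fun j hj => by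
        rw [hP m j (by omega), ← f.rel_self (σ := σ) m, f.rel_eq_iff]
        refine ⟨fun h => ?_, fun h => by simp [h]⟩
        have := Int.eq_zero_of_abs_lt_dvd h (by rw [abs_lt]; omega)
        omega
      constructor
      · rintro ⟨j, hj, h⟩
        rw [this j hj] at h; omega
      · exact fun h => ⟨m, h, (this m h).2 rfl⟩
    -- The `k` agents of the first `k` places start forward, all others backward; modulo `n` this is
    -- a rotation by 2k.
    have hrot : rotOf σ f.g c = 2 * k - n := by
      rw [hc, rotOf_flag, ← sum_ite_lt (show k ≤ n by omega)]
      unfold rot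
      rw [← f.sum_ag fun i => if S i = true then (1 : ℤ) else -1]
      refine Finset.sum_congr rfl fun m hm => ?_
      simp only [hSa m (Finset.mem_range.1 hm)]
    have hmul : 2 * k * (q + 1) = 2 * k * q + 2 * k := by ring
    set p₁ := (roundEnd σ p c).pos with hp₁
    have h₁ : f.At (2 * k * (q + 1) : ℕ) p₁ := Frame.At.of_dvd (roundEnd_at (σ := σ) (c := c) hp) (by
      rw [hrot, hmul]; push_cast; exact ⟨1, by ring⟩)
    have hΔ' : ∀ a, Δ (f.ag a) + ((obs σ p c (f.ag a)).dist : UnitAddCircle) =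
        f.rel σ a (a + (2 * k * (q + 1) : ℕ)) := by
      intro a
      rw [hΔ, obs_dist hp, f.rel_add, f.rel_eq_iff, hrot, hmul]
      push_cast; exact ⟨-1, by ring⟩
    have hΛ : ∀ a, (if decide (f.ag a = f.ag 0) then
        Δ (f.ag a) + ((obs σ p c (f.ag a)).dist : UnitAddCircle) else
        Δ (f.ag a) + ((obs σ p c (f.ag a)).dist : UnitAddCircle) +
          ((sgn (σ (f.ag a) == f.g) * -(2 * (obs σ p₁ c' (f.ag a)).coll') : ℝ) :
            UnitAddCircle)) = f.rel σ a (2 * k * (q + 1) : ℕ) := by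
      intro a
      rw [hΔ']
      split_ifs with h
      · rw [decide_eq_true_iff, f.ag_eq_iff] at h
        rw [f.rel_eq_iff, add_sub_cancel_right]
        simpa using h
      · rw [decide_eq_true_iff] at h
        rw [obs_single h₁ 0 a h, zero_add]
    set off' : Fin n → ℤ := fun i =>
      (lookup (P i) (2 * k) (Δ i + ((obs σ p c i).dist : UnitAddCircle))).elim (off i)
        fun j => j - (2 * k * (q + 1) : ℕ) with hoff'
    have hoff₁ : ∀ a, (n : ℤ) ∣ off' (f.ag a) - a ∨
        ∀ q' ≤ q + 1, ¬ (a + (2 * k * q' : ℕ)) % (n : ℤ) < (2 * k : ℕ) := by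
      intro a
      have h1 : off' (f.ag a) = if (a + (2 * k * (q + 1) : ℕ)) % (n : ℤ) < (2 * k : ℕ) then
          (a + (2 * k * (q + 1) : ℕ)) % (n : ℤ) - (2 * k * (q + 1) : ℕ) else off (f.ag a) := by
        simp only [hoff']
        rw [hΔ', lookup_rel hn hkn (hP a)]
        split_ifs with h
        · rw [Option.elim_some, Int.toNat_of_nonneg (Int.emod_nonneg _ (by omega))]
        · rfl
      rw [h1]
      split_ifs with h
      · left
        rw [sub_sub, add_comm _ a, ← Int.modEq_iff_dvd]
        exact (Int.mod_modEq _ _).symm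
      · rcases hoff a with h2 | h2
        · exact Or.inl h2
        · refine Or.inr fun q' hq' => ?_
          rcases hq'.eq_or_lt with rfl | h3
          · exact h
          · exact h2 q' (by omega)
    have hlook : ∀ i, lookup (P i) (2 * k) (if decide (i = f.ag 0) then
        Δ i + ((obs σ p c i).dist : UnitAddCircle) else
        Δ i + ((obs σ p c i).dist : UnitAddCircle) +
          ((sgn (σ i == f.g) * -(2 * (obs σ p₁ c' i).coll') : ℝ) :
            UnitAddCircle)) =
        if n ≤ 2 * k * (q + 1) then some (2 * k * (q + 1) - n) else none := by
      intro i
      obtain ⟨a, rfl⟩ := f.ag_surj i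
      rw [hΛ, lookup_rel hn hkn (hP a)]
      by_cases h : n ≤ 2 * k * (q + 1)
      · have h2 : ((2 * k * (q + 1) : ℕ) : ℤ) % n = (2 * k * (q + 1) - n : ℕ) := by
          rw [← Int.sub_emod_right, ← Nat.cast_sub h, Int.emod_eq_of_lt (by omega) (by omega)]
        rw [if_pos h, h2, if_pos (by omega), Int.toNat_natCast]
      · rw [if_neg h, Int.emod_eq_of_lt (by omega) (by omega), if_neg (by omega)]
    have t₁ := Runs.turn (σ := σ) p c
    have t₂ := Runs.probe (σ := σ) h₁ c'
    have t₃ := Runs.turn (σ := σ) p₁ fun i => !c i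
    rw [hp₁, roundEnd_reverse hp, ← hp₁] at t₃
    have main : ∀ T r, Runs σ p₁ (fun i => (if n ≤ 2 * k * (q + 1) then
          some (2 * k * (q + 1) - n) else none).elim
        (Prog.walk (σ i == f.g) (decide (i = f.ag 0)) k (P i) t (q + 1)
          (Δ i + ((obs σ p c i).dist : UnitAddCircle)) (off' i))
        fun j => pure (some (2 * k * (q + 1) - j, off' i))) T p₁ r →
        Runs σ p (fun i => Prog.walk (σ i == f.g) (decide (i = f.ag 0)) k (P i) (t + 1) q
          (Δ i) (off i)) (T + 4) p r := by
      intro T r hr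
      have hr' : Runs σ p₁ (fun i => (lookup (P i) (2 * k) (if decide (i = f.ag 0) then
          Δ i + ((obs σ p c i).dist : UnitAddCircle) else
          Δ i + ((obs σ p c i).dist : UnitAddCircle) +
            ((sgn (σ i == f.g) * -(2 * (obs σ p₁ c' i).coll') : ℝ) : UnitAddCircle))).elim
          (Prog.walk (σ i == f.g) (decide (i = f.ag 0)) k (P i) t (q + 1)
            (Δ i + ((obs σ p c i).dist : UnitAddCircle)) (off' i))
          fun j => pure (some (2 * k * (q + 1) - j, off' i))) T p₁ r := by
        simpa only [hlook] using hr
      have := t₁.bind (k := fun i o => Prog.probe (c' i) >>= fun o' => (lookup (P i) (2 * k)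
        (if decide (i = f.ag 0) then Δ i + (o.dist : UnitAddCircle) else Δ i + (o.dist : UnitAddCircle) +
          ((sgn (σ i == f.g) * -(2 * o'.coll') : ℝ) : UnitAddCircle))).elim
        (Prog.walk (σ i == f.g) (decide (i = f.ag 0)) k (P i) t (q + 1) (Δ i + (o.dist : UnitAddCircle))
          ((lookup (P i) (2 * k) (Δ i + (o.dist : UnitAddCircle))).elim (off i)
            fun j => j - (2 * k * (q + 1) : ℕ)))
        (fun j => pure (some (2 * k * (q + 1) - j,
          (lookup (P i) (2 * k) (Δ i + (o.dist : UnitAddCircle))).elim (off i)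
            fun j => j - (2 * k * (q + 1) : ℕ)))) >>= fun r =>
        Prog.turn (!c i) >>= fun _ => pure r)
        (t₂.bind (hr'.bind (t₃.bind (Runs.pure p r))))
      rw [show 1 + (2 + (T + (1 + 0))) = T + 4 by ring] at this
      exact this
    by_cases h : n ≤ 2 * k * (q + 1)
    · refine ⟨_, ?_, _, main 0 (fun i => some (n, off' i)) ?_, Or.inr ⟨off', rfl,
        h.trans (Nat.mul_le_mul_left _ (by omega)), fun a => ?_⟩⟩
      · omega
      · simp only [if_pos h, Option.elim_some, Nat.sub_sub_self h]
        exact Runs.pure p₁ _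
      · have h0 := Int.emod_nonneg a (show (n : ℤ) ≠ 0 by omega)
        have h0' := Int.emod_lt_of_pos a (show (0 : ℤ) < n by omega)
        have h2 := hoff₁ (a % n)
        rw [f.ag_emod] at h2
        refine h2.elim (fun h1 => ?_) fun h1 => ?_
        · have := (Int.mod_modEq a n).symm.dvd
          rw [← sub_add_sub_cancel _ (a % n)]
          exact dvd_add h1 this
        · exfalso
          -- Steps of length 2k cannot jump over the window of 2k places: the first step that
          -- carries the agent past `n` ends in it.
          have hex : ∃ q', (n : ℤ) ≤ a % n + (2 * k * q' : ℕ) := ⟨q + 1, by omega⟩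
          have h3 := Nat.find_spec hex
          have h4 : Nat.find hex ≤ q + 1 := Nat.find_min' hex (by omega)
          have h5 := h1 _ h4
          have h6 : Nat.find hex ≠ 0 := fun h7 => by rw [h7, mul_zero] at h3; omega
          have h7 := Nat.find_min hex (m := Nat.find hex - 1) (by omega)
          have h8 : 2 * k * Nat.find hex = 2 * k * (Nat.find hex - 1) + 2 * k := by
            rw [← mul_add_one, Nat.sub_add_cancel (by omega)]
          rw [← Int.sub_emod_right, Int.emod_eq_of_lt (by omega) (by omega)] at h5
          omega
    · obtain ⟨T, hT, r, hr, H⟩ := ih (q + 1) (by omega) h₁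
        (fun i => Δ i + ((obs σ p c i).dist : UnitAddCircle)) hΔ' off' hoff₁
      refine ⟨_, ?_, r, main T r ?_, ?_⟩
      · omega
      · simpa only [if_neg h, Option.elim_none] using hr
      · rwa [show q + 1 + t = q + (t + 1) by ring] at H

end RingNetwork

namespace RingNetwork

variable {n : ℕ} {f h : Frame n} {R : ℤ} {p : Fin n → UnitAddCircle} {σ : Fin n → Bool}
  {c : Fin n → Bool} {i : Fin n}

/-! ### The final sweep -/

/-- Whether the agent at the place `m` starts forward when the agents shall rotate by `r` places,
the first `B` places are responsible for the rotation and the others are paired. -/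
def sweepFwd (B : ℕ) (r m : ℤ) : Bool :=
  if m < B then decide (2 * m < B + r) else decide (Even (m - B))

lemma sweepFwd_of_lt {B : ℕ} {r m : ℤ} (h : m < B) :
    sweepFwd B r m = decide (2 * m < B + r) := if_pos h

lemma sweepFwd_of_le {B : ℕ} {r m : ℤ} (h : B ≤ m) :
    sweepFwd B r m = decide (Even (m - B)) := if_neg h.not_gt

lemma sum_ite_even (d : ℕ) :
    ∑ m ∈ Finset.range (2 * d), (if Even m then (1 : ℤ) else -1) = 0 := by
  induction d with
  | zero => simp
  | succ d ih =>
    rw [show 2 * (d + 1) = 2 * d + 1 + 1 by ring, Finset.sum_range_succ, Finset.sum_range_succ, ih,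
      if_pos (by simp), if_neg (by simp)]
    norm_num

/-- Of the first `B` places (B + r) / 2 start forward, an integer by parity; the paired places
cancel. -/
lemma sum_sweepFwd {B : ℕ} {r : ℤ} (hB : B ≤ n) (hnB : Even (n - B)) (hr : |r| ≤ B)
    (hrB : Even (r - B)) :
    ∑ m ∈ Finset.range n, (if sweepFwd B r (m : ℕ) = true then (1 : ℤ) else -1) = r := by
  obtain ⟨d, hd⟩ := hnB
  obtain ⟨u, hu⟩ := hrB
  obtain rfl : n = B + 2 * d := by omega
  rw [abs_le] at hr
  rw [Finset.sum_range_add]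
  refine (congrArg₂ (· + ·) (?_ : _ = r) (?_ : _ = (0 : ℤ))).trans (add_zero r)
  · have := sum_ite_lt (u := (B + u).toNat) (b := B) (by omega)
    refine Eq.trans (Finset.sum_congr rfl fun m hm => ?_) (this.trans (by omega))
    rw [Finset.mem_range] at hm
    simp only [sweepFwd_of_lt (show (m : ℤ) < B by omega), decide_eq_true_iff]
    congr 1
    rw [eq_iff_iff]
    omega
  · rw [← sum_ite_even d]
    refine Finset.sum_congr rfl fun m hm => ?_
    simp only [sweepFwd_of_le (show (B : ℤ) ≤ (B + m : ℕ) by omega), decide_eq_true_iff]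
    push_cast
    rw [add_sub_cancel_left]
    simp only [Int.even_coe_nat]

/-- Rotate according to the plan `S`; the result is the set of positions visited or seen. -/
def Prog.sweep (e : Bool) (n B : ℕ) (off : ℤ) (S : ℕ → ℤ) :
    ℕ → ℕ → UnitAddCircle → Prog (Set UnitAddCircle)
  | 0, _, _ => return ∅
  | s + 1, t, Δ => do
    let b := sweepFwd B (S (t + 1) - S t) ((off + S t) % n)
    let o ← Prog.turn (e == b)
    let K ← Prog.sweep e n B off S s (t + 1) (Δ + (o.dist : UnitAddCircle))
    return K ∪ {z | z = Δ ∨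
      ∃ v, o.coll = some v ∧ z = Δ + ((sgn e * (sgn b * (2 * v)) : ℝ) : UnitAddCircle)}

/-- All starting directions depend on the current place only, which an agent computes from `off` and
the schedule. Besides its own place, an agent on a paired place sees that of its partner, since the
two start towards each other. -/
theorem runs_sweep {B : ℕ} (hB : B ≤ n) (hnB : Even (n - B)) (S : ℕ → ℤ)
    (hS : ∀ t, |S (t + 1) - S t| ≤ B) (hSB : ∀ t, Even (S (t + 1) - S t - B)) (off : Fin n → ℤ)
    (hoff : ∀ a, (n : ℤ) ∣ off (f.ag a) - a) (s t : ℕ) (hp : f.At (S t) p)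
    (Δ : Fin n → UnitAddCircle) (hΔ : ∀ a, Δ (f.ag a) = f.rel σ a (a + S t)) :
    ∃ p' K, Runs σ p (fun i => Prog.sweep (σ i == f.g) n B (off i) S s t (Δ i)) s p' K ∧
      ∀ a, (∀ z ∈ K (f.ag a), ∃ m, z = f.rel σ a m) ∧ ∀ t', t ≤ t' → t' < t + s →
        f.rel σ a (a + S t') ∈ K (f.ag a) ∧ (B ≤ (a + S t') % n → f.rel σ a
          (a + S t' + if Even ((a + S t') % n - B) then 1 else -1) ∈ K (f.ag a)) := by
  classical
  induction s generalizing t p Δ with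
  | zero => exact ⟨p, _, Runs.pure p _, fun a => ⟨by simp, fun t' h1 h2 => by omega⟩⟩
  | succ s ih =>
    have hn : 0 < n := (f.ag 0).pos
    set r := S (t + 1) - S t with hr
    set b : Fin n → Bool := fun i => sweepFwd B r ((off i + S t) % n) with hb
    set c : Fin n → Bool := fun i => (σ i == f.g) == b i with hc
    have hba : ∀ a, b (f.ag a) = sweepFwd B r ((a + S t) % n) := fun a => by
      simp only [hb]
      congr 1
      have := (Int.modEq_iff_dvd.2 (hoff a)).symm
      exact this.add_right (S t)
    have hrot : rotOf σ f.g c = r := by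
      rw [hc, rotOf_flag]
      unfold rot
      -- Summing over the agents in the order of their current places.
      rw [← (f.shift (-S t)).sum_ag fun i => if b i = true then (1 : ℤ) else -1]
      refine Eq.trans (Finset.sum_congr rfl fun m hm => ?_) (sum_sweepFwd hB hnB (hS t) (hSB t))
      rw [Finset.mem_range] at hm
      show (if b (f.ag (m + -S t)) = true then (1 : ℤ) else -1) = _
      rw [hba, neg_add_cancel_right, Int.emod_eq_of_lt (by omega) (by omega)]
    set p₁ := (roundEnd σ p c).pos with hp₁
    have h₁ : f.At (S (t + 1)) p₁ := by
      have := roundEnd_at (σ := σ) (c := c) hp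
      rwa [hrot, hr, add_sub_cancel] at this
    have hΔ' : ∀ a, Δ (f.ag a) + ((obs σ p c (f.ag a)).dist : UnitAddCircle) =
        f.rel σ a (a + S (t + 1)) := by
      intro a
      rw [hΔ, obs_dist hp, f.rel_add, hrot, hr, add_assoc, add_sub_cancel]
    obtain ⟨p', K, hK, H⟩ := ih (t + 1) h₁
      (fun i => Δ i + ((obs σ p c i).dist : UnitAddCircle)) hΔ'
    refine ⟨p', fun i => K i ∪ {z | z = Δ i ∨ ∃ v, (obs σ p c i).coll = some v ∧
      z = Δ i + ((sgn (σ i == f.g) * (sgn (b i) * (2 * v)) : ℝ) : UnitAddCircle)}, ?_, fun a => ?_⟩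
    · have := (Runs.turn (σ := σ) p c).bind (k := fun i o => Prog.sweep (σ i == f.g) n B (off i) S s
        (t + 1) (Δ i + (o.dist : UnitAddCircle)) >>= fun K => pure (K ∪ {z | z = Δ i ∨
          ∃ v, o.coll = some v ∧
            z = Δ i + ((sgn (σ i == f.g) * (sgn (b i) * (2 * v)) : ℝ) : UnitAddCircle)}))
        (hK.bind (Runs.pure p' _))
      rw [show 1 + (s + 0) = s + 1 by ring] at this
      exact this
    · have hfwd : fwd σ f.g c (f.ag a) = b (f.ag a) := fwd_flag f.g b _
      constructor
      · rintro z (hz | rfl | ⟨v, hv, rfl⟩)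
        · exact (H a).1 z hz
        · exact ⟨_, hΔ a⟩
        · cases hba' : b (f.ag a) with
          | false =>
            obtain ⟨δ, -, -, h3⟩ := exists_obs_coll_bwd hp (hfwd.trans hba') hv
            refine ⟨a - δ + S t, ?_⟩
            rw [hΔ, ← f.rel_add a (a + S t) (a - δ + S t), h3, sgn_false]
            congr 3; ring
          | true =>
            obtain ⟨δ, -, -, h3⟩ := exists_obs_coll_fwd hp (hfwd.trans hba') hv
            refine ⟨a + δ + S t, ?_⟩
            rw [hΔ, ← f.rel_add a (a + S t) (a + δ + S t), h3, sgn_true]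
            congr 3; ring
      · intro t' h1 h2
        rcases h1.eq_or_lt with rfl | h3
        · refine ⟨Or.inr (Or.inl (hΔ a).symm), fun h4 => Or.inr (Or.inr ?_)⟩
          set m := (a + S t) % (n : ℤ) with hm
          have hmn : m < n := Int.emod_lt_of_pos _ (by omega)
          have hm0 : 0 ≤ m := Int.emod_nonneg _ (by omega)
          obtain ⟨d, hd⟩ := hnB
          have hag : ∀ j, (a + j + S t) % (n : ℤ) = (m + j) % n := fun j => by
            rw [show a + j + S t = a + S t + j by ring, ← Int.emod_add_emod]
          by_cases he : Even (m - B)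
          · have he' := he
            obtain ⟨u, hu⟩ := he'
            have hb1 : b (f.ag a) = true := by
              rw [hba, sweepFwd_of_le h4]; simpa using he
            have hb2 : b (f.ag (a + 1)) = false := by
              rw [hba, hag, Int.emod_eq_of_lt (by omega) (by omega)]
              rw [sweepFwd_of_le (by omega), decide_eq_false_iff_not]
              rintro ⟨w, hw⟩; omega
            have h5 := obs_coll_fwd (σ := σ) (c := c) hp one_pos (hfwd.trans hb1)
              ((fwd_flag f.g b _).trans hb2) (fun j h6 h7 => by omega)
            refine ⟨_, h5, ?_⟩
            rw [hΔ, hb1, if_pos he, ← f.rel_add a (a + S t) (a + S t + 1), sgn_true,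
              show a + 1 + S t = a + S t + 1 by ring]
            congr 3; ring
          · have hb1 : b (f.ag a) = false := by
              rw [hba, sweepFwd_of_le h4]; simpa using he
            have hb2 : b (f.ag (a - 1)) = true := by
              rw [Int.not_even_iff_odd] at he
              obtain ⟨u, hu⟩ := he
              rw [hba, sub_eq_add_neg a, hag, Int.emod_eq_of_lt (by omega) (by omega)]
              rw [sweepFwd_of_le (by omega), decide_eq_true_iff]
              exact ⟨u, by omega⟩
            have h5 := obs_coll_bwd (σ := σ) (c := c) hp one_pos (hfwd.trans hb1)
              ((fwd_flag f.g b _).trans hb2) (fun j h6 h7 => by omega)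
            refine ⟨_, h5, ?_⟩
            rw [hΔ, hb1, if_neg he, ← f.rel_add a (a + S t) (a + S t + -1), sgn_false,
              show a - 1 + S t = a + S t + -1 by ring]
            congr 3; ring
        · have := (H a).2 t' h3 (by omega)
          exact ⟨Or.inl this.1, fun h4 => Or.inl (this.2 h4)⟩

end RingNetwork

namespace RingNetwork

variable {n : ℕ} {f h : Frame n} {R : ℤ} {p : Fin n → UnitAddCircle} {σ : Fin n → Bool}
  {c : Fin n → Bool} {i : Fin n}

/-! ### The schedule of rotations in the sweep -/

/-- The number of places that are responsible for the rotation. -/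
def sweepBlock (n k : ℕ) : ℕ := if Even n then 2 else 2 * k - 1

/-- The number of places by which the agents have rotated after `t` rounds of the sweep. -/
def sweepShift (n k t : ℕ) : ℤ :=
  if Even n then 2 * t
  else (t / (2 * k) : ℕ) * (4 * k - 2) + 2 * (t % (2 * k) / 2 : ℕ) +
    (t % (2 * k) % 2 : ℕ) * (2 * k - 1)

/-- The number of rounds of the sweep. -/
def sweepTime (n k : ℕ) : ℕ := if Even n then n / 2 else 2 * k * (n / (4 * k - 2) + 1)

lemma sweepShift_zero (n k : ℕ) : sweepShift n k 0 = 0 := by simp [sweepShift]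

lemma sweepShift_odd (hn : ¬ Even n) {k v : ℕ} (s : ℕ) (hv : v < 2 * k) :
    sweepShift n k (2 * k * s + v) =
      s * (4 * k - 2) + 2 * (v / 2 : ℕ) + (v % 2 : ℕ) * (2 * k - 1) := by
  unfold sweepShift
  rw [if_neg hn, Nat.mul_add_div (by omega), Nat.mul_add_mod, Nat.div_eq_of_lt hv,
    Nat.mod_eq_of_lt hv, add_zero]

/-- For odd `n` the steps alternate between 2k - 1 and 3 - 2k, and the last step of a block of 2k
rounds is 1; all are odd and bounded by 2k - 1. -/
lemma sweepShift_succ_sub {k : ℕ} (hk : 0 < k) (t : ℕ) :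
    |sweepShift n k (t + 1) - sweepShift n k t| ≤ sweepBlock n k ∧
      Even (sweepShift n k (t + 1) - sweepShift n k t - sweepBlock n k) := by
  by_cases hn : Even n
  · simp [sweepShift, sweepBlock, hn, mul_add]
  · have hv : t % (2 * k) < 2 * k := Nat.mod_lt _ (by omega)
    have ht := Nat.div_add_mod t (2 * k)
    set s := t / (2 * k)
    set v := t % (2 * k)
    have h1 := sweepShift_odd hn s hv
    rw [ht] at h1
    have hB : (sweepBlock n k : ℤ) = 2 * k - 1 := by
      unfold sweepBlock; rw [if_neg hn]; omega
    rw [hB, h1, abs_le]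
    by_cases hv' : v + 1 < 2 * k
    · have h2 := sweepShift_odd hn s hv'
      rw [show 2 * k * s + (v + 1) = t + 1 by omega] at h2
      rw [h2]
      rcases Nat.even_or_odd' v with ⟨u, hu | hu⟩
      · rw [hu, show 2 * u / 2 = u by omega, show 2 * u % 2 = 0 by omega,
          show (2 * u + 1) / 2 = u by omega, show (2 * u + 1) % 2 = 1 by omega]
        push_cast
        exact ⟨⟨by linarith, by linarith⟩, 0, by ring⟩
      · rw [hu, show (2 * u + 1) / 2 = u by omega, show (2 * u + 1) % 2 = 1 by omega,
          show (2 * u + 1 + 1) / 2 = u + 1 by omega, show (2 * u + 1 + 1) % 2 = 0 by omega]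
        push_cast
        have : (1 : ℤ) ≤ k := by omega
        exact ⟨⟨by linarith, by linarith⟩, 2 - 2 * k, by ring⟩
    · have h2 := sweepShift_odd hn (s + 1) (show 0 < 2 * k by omega)
      rw [show 2 * k * (s + 1) + 0 = t + 1 by rw [mul_add]; omega] at h2
      rw [h2, show v / 2 = k - 1 by omega, show v % 2 = 1 by omega]
      have : (1 : ℤ) ≤ k := by omega
      push_cast [Nat.cast_sub (show 1 ≤ k from hk)]
      exact ⟨⟨by linarith, by linarith⟩, 1 - k, by ring⟩

/-- For odd `n` the shifts in a block are 0, 2, …, 2k - 2 and 2k - 1, 2k + 1, …, 4k - 3 relative to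
its start, so no two consecutive ones are missed. One of two suffices, because the sweep shows the
partner too. -/
lemma exists_sweepShift {k : ℕ} (hn : 0 < n) (hk : 0 < k) (y : ℤ) : ∃ t < sweepTime n k,
    (n : ℤ) ∣ sweepShift n k t - y ∨ (n : ℤ) ∣ sweepShift n k t - (y + 1) := by
  obtain ⟨z, hz, hzy⟩ : ∃ z < n, (n : ℤ) ∣ z - y := by
    have h0 := Int.emod_nonneg y (show (n : ℤ) ≠ 0 by omega)
    have h1 := Int.emod_lt_of_pos y (show (0 : ℤ) < n by omega)
    refine ⟨(y % n).toNat, by omega, ?_⟩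
    rw [Int.toNat_of_nonneg h0]
    exact (Int.mod_modEq y n).symm.dvd
  have key : ∀ t : ℕ, (n : ℤ) ∣ sweepShift n k t - z ∨ (n : ℤ) ∣ sweepShift n k t - (z + 1) →
      (n : ℤ) ∣ sweepShift n k t - y ∨ (n : ℤ) ∣ sweepShift n k t - (y + 1) := by
    rintro t (h | h)
    · left
      rw [← sub_add_sub_cancel _ (z : ℤ)]; exact dvd_add h hzy
    · right
      rw [← sub_add_sub_cancel _ (z + 1 : ℤ), add_sub_add_right_eq_sub]; exact dvd_add h hzy
  suffices h : ∃ t < sweepTime n k,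
      (n : ℤ) ∣ sweepShift n k t - z ∨ (n : ℤ) ∣ sweepShift n k t - (z + 1) by
    obtain ⟨t, h1, h2⟩ := h
    exact ⟨t, h1, key t h2⟩
  by_cases he : Even n
  · obtain ⟨d, hd⟩ := he
    have hS : ∀ t, sweepShift n k t = 2 * t := fun t => if_pos ⟨d, hd⟩
    have hT : sweepTime n k = n / 2 := if_pos ⟨d, hd⟩
    simp only [hS, hT]
    rcases Nat.even_or_odd' z with ⟨u, rfl | rfl⟩
    · exact ⟨u, by omega, Or.inl ⟨0, by push_cast; ring⟩⟩
    · by_cases hu : 2 * u + 2 = n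
      -- The successor of the last place is place 0 of the next turn.
      · exact ⟨0, by omega, Or.inr ⟨-1, by rw [← hu]; push_cast; ring⟩⟩
      · exact ⟨u + 1, by omega, Or.inr ⟨0, by push_cast; ring⟩⟩
  · set s := z / (4 * k - 2) with hs
    have hw : z % (4 * k - 2) < 4 * k - 2 := Nat.mod_lt _ (by omega)
    have hzw := Nat.div_add_mod z (4 * k - 2)
    set w := z % (4 * k - 2) with hwdef
    have hzw' : (z : ℤ) = s * (4 * k - 2) + w := by
      have h1 : ((4 * k - 2 : ℕ) : ℤ) = 4 * k - 2 := by omega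
      rw [← hzw, ← hs, Nat.cast_add, Nat.cast_mul, h1]; ring
    have hsT : ∀ v < 2 * k, 2 * k * s + v < sweepTime n k := by
      intro v hv
      unfold sweepTime
      rw [if_neg he]
      have h1 : s ≤ n / (4 * k - 2) := Nat.div_le_div_right hz.le
      have h2 := Nat.mul_le_mul_left (2 * k) h1
      rw [mul_add]; omega
    have main : ∀ v < 2 * k, (2 * (v / 2 : ℕ) + (v % 2 : ℕ) * (2 * k - 1) = (w : ℤ) ∨
        2 * (v / 2 : ℕ) + (v % 2 : ℕ) * (2 * k - 1) = (w + 1 : ℤ)) →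
        ∃ t < sweepTime n k,
      (n : ℤ) ∣ sweepShift n k t - z ∨ (n : ℤ) ∣ sweepShift n k t - (z + 1) := by
      intro v hv h
      refine ⟨2 * k * s + v, hsT v hv, ?_⟩
      rw [sweepShift_odd he s hv, hzw']
      rcases h with h | h
      · exact Or.inl ⟨0, by linear_combination h⟩
      · exact Or.inr ⟨0, by linear_combination h⟩
    have hev : ∀ u : ℕ, 2 * u / 2 = u ∧ 2 * u % 2 = 0 ∧ (2 * u + 1) / 2 = u ∧
        (2 * u + 1) % 2 = 1 := fun u => by omega
    by_cases hwk : w < 2 * k - 1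
    · rcases Nat.even_or_odd' w with ⟨u, hu | hu⟩
      · refine main (2 * u) (by omega) (Or.inl ?_)
        rw [(hev u).1, (hev u).2.1]; push_cast; omega
      · refine main (2 * (u + 1)) (by omega) (Or.inr ?_)
        rw [(hev _).1, (hev _).2.1]; push_cast; omega
    · obtain ⟨x, hx⟩ := Nat.exists_eq_add_of_le (not_lt.1 hwk)
      rcases Nat.even_or_odd' x with ⟨u, hu | hu⟩
      · refine main (2 * u + 1) (by omega) (Or.inl ?_)
        rw [(hev u).2.2.1, (hev u).2.2.2]; push_cast; omega
      · refine main (2 * (u + 1) + 1) (by omega) (Or.inr ?_)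
        rw [(hev _).2.2.1, (hev _).2.2.2]; push_cast; omega

/-- Doubled, a block of 2k rounds costs 4k for 4k - 2 places, an excess of 2. There are at most 16k
full blocks, and the extra block adds 4k, whence 36k. -/
lemma sweepTime_le {k : ℕ} (hk : 0 < k) (hn : n ≤ 32 * k ^ 2) :
    2 * sweepTime n k ≤ n + 36 * k := by
  unfold sweepTime
  split_ifs with h
  · omega
  · have h1 := Nat.div_mul_le_self n (4 * k - 2)
    set m := n / (4 * k - 2)
    obtain ⟨j, rfl⟩ := Nat.exists_eq_add_of_le' hk
    rw [show 4 * (j + 1) - 2 = 4 * j + 2 by omega] at h1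
    have h2 : m ≤ 16 * (j + 1) := by
      by_contra hc
      have : (16 * (j + 1) + 1) * (4 * j + 2) ≤ m * (4 * j + 2) := Nat.mul_le_mul_right _ (by omega)
      nlinarith
    nlinarith

/-- Sweep the circle; `P` are the positions of the first `2 * k` places and `off` is the number of
the own place. -/
def Prog.locate (e : Bool) (k : ℕ) (P : ℕ → UnitAddCircle) (n : ℕ) (off : ℤ) : Prog (Set ℝ) := do
  let K ← Prog.sweep e n (sweepBlock n k) off (sweepShift n k) (sweepTime n k) 0 0
  return {y | ∃ z, (z ∈ K ∨ ∃ j < 2 * k, z = P j) ∧ z ≠ 0 ∧ y = (AddCircle.equivIco (1 : ℝ) 0 z : ℝ)}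

lemma rightDist_eq_rel (hp : f.At 0 p) (a m : ℤ) :
    rightDist (σ (f.ag a)) (p (f.ag a)) (p (f.ag m)) =
      (AddCircle.equivIco (1 : ℝ) 0 (f.rel σ a m) : ℝ) := by
  unfold rightDist cwArc
  rw [hp, hp, add_zero, add_zero, ← AddCircle.coe_sub, ← AddCircle.coe_sub, ← mul_sub, ← mul_sub]
  unfold Frame.rel
  rw [sgn_beq]
  cases σ (f.ag a)
  · rw [sgn_false, if_neg (by simp), show sgn f.g * (f.x a - f.x m) =
      -1 * sgn f.g * (f.x m - f.x a) by ring]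
  · rw [sgn_true, if_pos rfl, one_mul]

/-- The window supplies the first 2k places and the sweep all others. Nothing else enters the
result, since only actual places are recorded. -/
theorem runs_locate (hp : f.At 0 p) {k : ℕ} (hk : 0 < k) (hkn : 2 * k + 1 ≤ n)
    {P : Fin n → ℕ → UnitAddCircle} (hP : ∀ a, ∀ j < 2 * k, P (f.ag a) j = f.rel σ a j)
    {off : Fin n → ℤ} (hoff : ∀ a, (n : ℤ) ∣ off (f.ag a) - a) :
    ∃ p' K, Runs σ p (fun i => Prog.locate (σ i == f.g) k (P i) n (off i)) (sweepTime n k) p' K ∧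
      ∀ i, K i = {x | ∃ j, j ≠ i ∧ x = rightDist (σ i) (p i) (p j)} := by
  have hB : sweepBlock n k ≤ 2 * k := by unfold sweepBlock; split_ifs <;> omega
  have hnB : Even (n - sweepBlock n k) := by
    unfold sweepBlock
    split_ifs with h
    · obtain ⟨d, hd⟩ := h; exact ⟨d - 1, by omega⟩
    · obtain ⟨d, hd⟩ := Nat.not_even_iff_odd.1 h; exact ⟨d + 1 - k, by omega⟩
  obtain ⟨p', K, hK, H⟩ := runs_sweep (σ := σ) (p := p) (hB.trans (by omega)) hnB (sweepShift n k)
    (fun t => (sweepShift_succ_sub hk t).1) (fun t => (sweepShift_succ_sub hk t).2) off hoff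
    (sweepTime n k) 0 (by rwa [sweepShift_zero]) (fun _ => 0) (by simp [sweepShift_zero])
  refine ⟨p', _, hK.bind (k := fun i K => pure {y | ∃ z, (z ∈ K ∨ ∃ j < 2 * k, z = P i j) ∧ z ≠ 0 ∧
    y = (AddCircle.equivIco (1 : ℝ) 0 z : ℝ)}) (Runs.pure p' _), fun i => ?_⟩
  obtain ⟨a, rfl⟩ := f.ag_surj i
  have hall : ∀ z, (z ∈ K (f.ag a) ∨ ∃ j < 2 * k, z = P (f.ag a) j) ↔ ∃ m, z = f.rel σ a m := by
    intro z
    constructor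
    · rintro (h | ⟨j, hj, rfl⟩)
      · exact (H a).1 z h
      · exact ⟨j, hP a j hj⟩
    · rintro ⟨m, rfl⟩
      set m' := m % (n : ℤ) with hm
      have hmn : m' < n := Int.emod_lt_of_pos _ (by omega)
      have hm0 : 0 ≤ m' := Int.emod_nonneg _ (by omega)
      rw [← f.rel_eq_rel a (f.ag_emod m), ← hm]
      by_cases hmk : m' < 2 * k
      · right
        exact ⟨m'.toNat, by omega, by rw [hP a _ (by omega), Int.toNat_of_nonneg hm0]⟩
      · left
        obtain ⟨d, hd⟩ := hnB
        set B := sweepBlock n k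
        have hfin : ∀ (t : ℕ) (m₀ : ℤ), (n : ℤ) ∣ sweepShift n k t - (m₀ - a) → 0 ≤ m₀ → m₀ < n →
            (a + sweepShift n k t) % n = m₀ := by
          intro t m₀ h1 h2 h3
          rw [← Int.emod_eq_of_lt h2 h3]
          refine (Int.modEq_iff_dvd.2 ?_).symm
          convert h1 using 1; ring
        have hrel : ∀ (t : ℕ) (m₀ j : ℤ), (a + sweepShift n k t) % n = m₀ →
            f.rel σ a (a + sweepShift n k t + j) = f.rel σ a (m₀ + j) := by
          intro t m₀ j h1
          rw [f.rel_eq_iff, add_sub_add_right_eq_sub, ← h1]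
          exact (Int.mod_modEq _ _).dvd
        -- A visit to either member of the pair y, y + 1 reveals both.
        have hcov : ∀ y : ℤ, B ≤ y → y + 1 < n → Even (y - B) →
            f.rel σ a y ∈ K (f.ag a) ∧ f.rel σ a (y + 1) ∈ K (f.ag a) := by
          intro y hy1 hy2 hy3
          have hy4 : ¬ Even (y + 1 - B) := by
            rw [show y + 1 - (B : ℤ) = y - B + 1 by ring, Int.even_add_one, not_not]; exact hy3
          obtain ⟨t, ht, h1⟩ := exists_sweepShift (n := n) (by omega) hk (y - a)
          obtain ⟨h2, h3⟩ := (H a).2 t (by omega) (by omega)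
          rcases h1 with h1 | h1
          · have h4 := hfin t y h1 (by omega) (by omega)
            have h5 := hrel t y 0 h4
            have h6 := hrel t y 1 h4
            rw [add_zero, add_zero] at h5
            rw [h4, if_pos hy3, h6] at h3
            rw [h5] at h2
            exact ⟨h2, h3 hy1⟩
          · have h4 := hfin t (y + 1) (by convert h1 using 1; ring) (by omega) (by omega)
            have h5 := hrel t (y + 1) 0 h4
            have h6 := hrel t (y + 1) (-1) h4
            rw [add_zero, add_zero] at h5
            rw [h4, if_neg hy4, h6, add_neg_cancel_right] at h3
            rw [h5] at h2
            exact ⟨h3 (by omega), h2⟩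
        rcases Int.even_or_odd (m' - B) with he | he
        · refine (hcov m' (by omega) ?_ he).1
          obtain ⟨u, hu⟩ := he; omega
        · have he' : Even (m' - 1 - B) := by
            obtain ⟨u, hu⟩ := he; exact ⟨u, by omega⟩
          have := (hcov (m' - 1) (by obtain ⟨u, hu⟩ := he; omega) (by omega) he').2
          rwa [sub_add_cancel] at this
  ext y
  simp only [hall, Set.mem_ofPred_eq]
  constructor
  · rintro ⟨z, ⟨m, rfl⟩, h1, rfl⟩
    refine ⟨f.ag m, fun h => h1 ?_, (rightDist_eq_rel hp a m).symm⟩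
    rw [f.rel_eq_rel a h, f.rel_self]
  · rintro ⟨j, hj, rfl⟩
    obtain ⟨m, rfl⟩ := f.ag_surj j
    refine ⟨_, ⟨m, rfl⟩, fun h => hj ?_, rightDist_eq_rel hp a m⟩
    rw [← f.rel_self (σ := σ) a, f.rel_eq_iff] at h
    rw [f.ag_eq_iff, dvd_sub_comm]; exact h

end RingNetwork

namespace RingNetwork

variable {n : ℕ} {f h : Frame n} {R : ℤ} {p : Fin n → UnitAddCircle} {σ : Fin n → Bool}
  {c : Fin n → Bool} {i : Fin n}

/-! ### The algorithm -/

/-- Try to solve location discovery with blocks of `2 * k` places. -/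
def Prog.stage (b P id : ℕ) (L : Link) (k : ℕ) : Prog (Option (Set ℝ)) := do
  let r ← Prog.elect (powerFamily P (16 * k) (b + 1)) b (2 * k) L id
  r.elim (return none) fun θ => do
    let e ← Prog.orient b id L (decide (id = θ))
    let W ← Prog.window e (L.halfGap (!e)) (2 * k) (decide (id = θ))
    let w ← Prog.walk e (decide (id = θ)) k W (16 * k) 0 0 ((lookup W (2 * k) 0).elim 0 fun j => j)
    w.elim (return none) fun w => some <$> Prog.locate e k W w.1 w.2

/-- Try longer and longer blocks. -/
def Prog.stages (b P id : ℕ) (L : Link) : ℕ → ℕ → Prog (Set ℝ)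
  | 0, _ => return ∅
  | s + 1, k => do
    let r ← Prog.stage b P id L k
    r.elim (Prog.stages b P id L s (2 * k)) pure

/-- The walk has 16k steps of 2k places, so failure of either the election or the walk means n >
32k². Everything before the sweep restores the positions. -/
theorem runs_stage (hn : 4 < n) (hp : f.At 0 p) {L : Fin n → Link}
    (hL : ∀ i h, Frame.Own h σ p i → (L i).Correct σ h) (id : Fin n → ℕ)
    (hid : Function.Injective id) {b k P : ℕ} (hb : ∀ i, id i < 2 ^ b) [Fact P.Prime]
    (hP : P ≤ 2 ^ (b + 1)) (hlt : ∀ i, id i < P) (hk : 0 < k) (hkn : 2 * k + 1 ≤ n) :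
    ∃ T p' r, Runs σ p (fun i => Prog.stage b P (id i) (L i) k) T p' r ∧
      ((r = fun _ => none) ∧ p' = p ∧ 32 * k ^ 2 < n ∧ T ≤ 118 * (k * (b + 1)) ∨
        2 * T ≤ n + 272 * (k * (b + 1)) ∧
        r = fun i => some {x | ∃ j, j ≠ i ∧ x = rightDist (σ i) (p i) (p j)}) := by
  classical
  have hkb : k ≤ k * (b + 1) := Nat.le_mul_of_pos_right _ (by omega)
  have hbk : b + 1 ≤ k * (b + 1) := Nat.le_mul_of_pos_left _ hk
  have hbk' : b * k ≤ k * (b + 1) := by rw [mul_comm b]; exact Nat.mul_le_mul_left _ (by omega)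
  obtain ⟨T₁, hT₁, r, hr, hr1, hr2⟩ := runs_elect (by omega) hp hL id hid hb hP hlt hk hkn
  replace hT₁ : T₁ ≤ 42 * (k * (b + 1)) := by
    rw [mul_assoc] at hT₁
    rw [mul_assoc] at hT₁
    omega
  cases r with
  | none =>
    refine ⟨_, p, _, hr.bind (Runs.pure p fun _ => none), Or.inl ⟨rfl, rfl, ?_, by omega⟩⟩
    by_contra hc
    exact hr2 (by omega) rfl
  | some θ =>
    obtain ⟨l, hl⟩ := hr1 θ rfl
    obtain ⟨φ, hφ⟩ := Frame.exists_own hp σ l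
    have hid' : ∀ i, decide (id i = θ) = decide (i = φ.ag 0) := fun i => by
      rw [hφ.ag_zero, ← hl, decide_eq_decide]; exact hid.eq_iff
    have ho := runs_orient hn hp hL id hid hb (φ.ag 0)
    obtain ⟨W, hW, hW'⟩ := runs_window (σ := σ) (by omega) hφ.at_zero hL (2 * k) 0
    simp only [zero_add] at hW'
    obtain ⟨T₂, hT₂, w, hw, hw'⟩ := runs_walk (σ := σ) (by omega) (by omega) hW' (16 * k) 0
      (by omega) (by simpa using hφ.at_zero) (fun _ => 0) (by simp)
      (fun i => (lookup (W i) (2 * k) 0).elim 0 fun j => j) (fun a => by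
        rw [← φ.rel_self (σ := σ) a, lookup_rel (by omega) (by omega) (hW' a)]
        split_ifs with h
        · left
          rw [Option.elim_some, Int.toNat_of_nonneg (Int.emod_nonneg _ (by omega))]
          exact (Int.mod_modEq _ _).symm.dvd
        · right
          intro q' hq'
          obtain rfl : q' = 0 := by omega
          simpa using h)
    have hσ : ∀ i, (σ (φ.ag 0) == σ i) = (σ i == φ.g) := fun i => by
      rw [hφ.ag_zero, hφ.g_eq, BEq.comm]
    simp only [hσ] at ho
    have main : ∀ T p' a, Runs σ p (fun i => (w i).elim (pure none)
        fun w => some <$> Prog.locate (σ i == φ.g) k (W i) w.1 w.2) T p' a →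
        Runs σ p (fun i => Prog.stage b P (id i) (L i) k)
          (T₁ + (4 * (b + 2) + (2 * (2 * k) + (T₂ + T)))) p' a := by
      intro T p' a ha
      simp only [← hid'] at ho hW hw
      exact hr.bind (ho.bind (hW.bind (hw.bind ha)))
    rcases hw' with ⟨rfl, hlt⟩ | ⟨off, rfl, hle, hoff⟩
    · refine ⟨_, p, _, main 0 p (fun _ => none) (Runs.pure p _), Or.inl ⟨rfl, rfl, ?_, by omega⟩⟩
      nlinarith
    · obtain ⟨p', K, hK, hK'⟩ := runs_locate hφ.at_zero hk hkn hW' hoff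
      have hsw := sweepTime_le hk (n := n) (by nlinarith)
      refine ⟨_, p', _, main _ p' (fun i => some (K i))
        (hK.bind (k := fun i K => pure (some K)) (Runs.pure p' _)), Or.inr ⟨by omega, ?_⟩⟩
      funext i; rw [hK']

/-- The term 272k(b + 1) on the left is a potential: doubling `k` doubles it, and the increase pays
for the failed stage, 2 · 118 ≤ 272. Failure gives 32k² < n, so (2k)² ≤ n persists. -/
theorem runs_stages (hn : 4 < n) (hp : f.At 0 p) {L : Fin n → Link}
    (hL : ∀ i h, Frame.Own h σ p i → (L i).Correct σ h) (id : Fin n → ℕ)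
    (hid : Function.Injective id) {b P : ℕ} (hb : ∀ i, id i < 2 ^ b) [Fact P.Prime]
    (hP : P ≤ 2 ^ (b + 1)) (hlt : ∀ i, id i < P) (s k : ℕ) (hk : 0 < k) (hkn : 2 * k + 1 ≤ n)
    (hk2 : k ^ 2 ≤ n) (hs : n ≤ k * 2 ^ s) :
    ∃ T p', Runs σ p (fun i => Prog.stages b P (id i) (L i) s k) T p'
        (fun i => {x | ∃ j, j ≠ i ∧ x = rightDist (σ i) (p i) (p j)}) ∧
      ∃ m, m ^ 2 ≤ n ∧ 2 * T + 272 * (k * (b + 1)) ≤ n + 544 * (m * (b + 1)) := by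
  induction s generalizing k with
  | zero => rw [pow_zero] at hs; omega
  | succ s ih =>
    obtain ⟨T, p', r, hr, ⟨rfl, rfl, h1, h2⟩ | ⟨h1, rfl⟩⟩ :=
      runs_stage hn hp hL id hid hb hP hlt hk hkn
    · obtain ⟨T', p'', hr', m, hm, h3⟩ := ih (2 * k) (by omega) (by nlinarith) (by nlinarith)
        (by rw [pow_succ] at hs; linarith)
      refine ⟨T + T', p'', hr.bind hr', m, hm, ?_⟩
      rw [mul_assoc 2 k] at h3
      omega
    · exact ⟨T + 0, p', hr.bind (Runs.pure p' _), k, hk2, by omega⟩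

/-! ### Choice of the parameters and the final count -/

/-- A prime number larger than `N`. -/
def primeAbove (N : ℕ) : ℕ := Nat.find (Nat.exists_infinite_primes (N + 1))

lemma primeAbove_prime (N : ℕ) : (primeAbove N).Prime :=
  (Nat.find_spec (Nat.exists_infinite_primes (N + 1))).2

lemma lt_primeAbove (N : ℕ) : N < primeAbove N :=
  (Nat.find_spec (Nat.exists_infinite_primes (N + 1))).1

/-- Bertrand's postulate; it bounds the number of bits of the residues used in the election. -/
lemma primeAbove_le {N : ℕ} (hN : N ≠ 0) : primeAbove N ≤ 2 * N := by
  obtain ⟨q, h1, h2, h3⟩ := Nat.exists_prime_lt_and_le_two_mul N hN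
  exact (Nat.find_min' _ ⟨h2, h1⟩).trans h3

lemma Network.le {N : ℕ} (net : Network N n) : n ≤ N := by
  have := Finset.card_le_card_of_injOn (s := Finset.univ) (t := Finset.Icc 1 N) net.ident
    (fun i _ => Finset.mem_coe.2 (net.ident_mem i)) net.ident_injective.injOn
  simpa using this

/-- The programs of the agents. -/
def locationDiscovery (N : ℕ) (_ : Bool) (id : ℕ) : Prog (Set ℝ) := do
  let L ← Prog.link (Nat.log 2 N + 1) id
  Prog.stages (Nat.log 2 N + 1) (primeAbove N) id L N 1

theorem locationDiscovery_solves {N : ℕ} (hn : 4 < n) (net : Network N n) :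
    ∃ T, (Algorithm.ofProg locationDiscovery).SolvesLocationDiscovery net T ∧
      ∃ m, m ^ 2 ≤ n ∧ 2 * T ≤ n + 544 * (m * (Nat.log 2 N + 2)) + 8 * (Nat.log 2 N + 3) := by
  obtain ⟨f, hf⟩ := exists_frame (by omega) net.pos_injective
  have hmem := fun i => Finset.mem_Icc.1 (net.ident_mem i)
  have hnN := net.le
  set b := Nat.log 2 N + 1 with hbdef
  have hNb : N < 2 ^ b := Nat.lt_pow_succ_log_self (by norm_num) N
  have hb : ∀ i, net.ident i < 2 ^ b := fun i => (hmem i).2.trans_lt hNb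
  have : Fact (primeAbove N).Prime := ⟨primeAbove_prime N⟩
  obtain ⟨L, hL, hL'⟩ := runs_link (σ := net.sense) (by omega) hf b net.ident
    net.ident_injective hb
  obtain ⟨T, p', hT, m, hm, h⟩ := runs_stages hn hf hL' net.ident net.ident_injective hb
    (P := primeAbove N) (by
      have := primeAbove_le (N := N) (by omega)
      rw [pow_succ]; omega)
    -- `N` stages starting at k = 1 are ample, since n ≤ N ≤ 2 ^ N.
    (fun i => (hmem i).2.trans_lt (lt_primeAbove N)) N 1 one_pos (by omega) (by omega) (by
      rw [one_mul]; exact hnN.trans Nat.lt_two_pow_self.le)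
  refine ⟨_, solves_of_runs net locationDiscovery (hL.bind hT) fun i => rfl, m, hm, ?_⟩
  rw [hbdef] at h ⊢
  rw [show Nat.log 2 N + 1 + 1 = Nat.log 2 N + 2 from rfl] at h
  omega

end RingNetwork
end

theorem mainTheorem5 :
    ∃ (A : RingNetwork.Algorithm) (C : ℝ),
      ∀ (N n : ℕ), 4 < n → ∀ net : RingNetwork.Network N n,
        ∃ t : ℕ, (t : ℝ) ≤ (n : ℝ) / 2 + C * (Real.sqrt n * Real.log N) ∧
          A.SolvesLocationDiscovery net t := by
  -- 1108 = (544 · 4 + 8 · 5) / 2, where 4 and 5 come from `h4` and `h5`.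
  refine ⟨.ofProg RingNetwork.locationDiscovery, 1108, fun N n hn net => ?_⟩
  obtain ⟨T, hT, m, hm, h⟩ := RingNetwork.locationDiscovery_solves hn net
  refine ⟨T, ?_, hT⟩
  have hN : (3 : ℝ) ≤ N := by exact_mod_cast (show 3 ≤ N by have := net.le; omega)
  have hm' : (m : ℝ) ≤ √n := Real.le_sqrt_of_sq_le (by exact_mod_cast hm)
  have hn1 : (1 : ℝ) ≤ √n := Real.one_le_sqrt.2 (by exact_mod_cast (by omega : 1 ≤ n))
  have hlog : 1 ≤ Real.log N := by
    rw [Real.le_log_iff_exp_le (by linarith)]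
    exact Real.exp_one_lt_three.le.trans hN
  have hl : (Nat.log 2 N : ℝ) ≤ 2 * Real.log N := by
    have h1 : ((2 : ℝ) ^ Nat.log 2 N) ≤ N := by
      exact_mod_cast Nat.pow_log_le_self 2 (by have := net.le; omega)
    have h2 := Real.log_le_log (by positivity) h1
    rw [Real.log_pow] at h2
    nlinarith [Real.log_two_gt_d9, Nat.cast_nonneg (α := ℝ) (Nat.log 2 N)]
  have h3 : (2 : ℝ) * T ≤ n + 544 * (m * (Nat.log 2 N + 2)) + 8 * (Nat.log 2 N + 3) := by
    exact_mod_cast h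
  have h4 : (m : ℝ) * (Nat.log 2 N + 2) ≤ √n * (4 * Real.log N) :=
    mul_le_mul hm' (by linarith) (by positivity) (by positivity)
  have h5 : (1 : ℝ) * (Nat.log 2 N + 3) ≤ √n * (5 * Real.log N) :=
    mul_le_mul hn1 (by linarith) (by positivity) (by positivity)
  linarith
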